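/- **Conventions.** Let $\mathcal E$ be a category and $u : \mathcal J \to \mathcal E^{\to}$ a functor to its arrow category. A *right $\mathcal J$-map* is an arrow $p$ together with a choice of a diagonal filler for every commutative square from an arrow $u_j$ to $p$, natural in $j \in \mathcal J$; a morphism of right $\mathcal J$-maps is a commutative square compatible with the chosen fillers. They form a category $\mathcal J^{\pitchfork}$ over $\mathcal E^{\to}$. For a category $\mathcal D \to \mathcal E^\to$ over the arrow category and $X\in\mathcal E$, the category $\mathcal D_{/X}$ has as objects an object $f : A \to B$ of $\mathcal D$ together with a map $B \to X$ (hence $A\to B\to X$), and as morphisms those of $\mathcal D$ that lie over $X$; it has a forgetful functor to $\mathcal E_{/X}^{\to} = (\mathcal E/X)^{\to}$. A functor (natural transformation) *lifts* along forgetful functors if there is a functor (natural transformation) upstairs lying strictly over it. Right maps are stable under base change, so pullback $t^*$ along any $t : Y\to V$ has a canonical lift $\widetilde{t^*}:\mathcal J^{\pitchfork}_{/V}\to\mathcal J^{\pitchfork}_{/Y}$. **Setting.** Let $\mathcal E$ be a locally presentable, locally cartesian closed category, with a functorial cylinder $I\otimes(-):\mathcal E\to\mathcal E$, $\delta^0,\delta^1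 : \mathrm{Id}\to I\otimes(-)$, that has a right adjoint, contractions $\varepsilon : I\otimes(-)\to\mathrm{Id}$ ($\varepsilon\delta^k = \mathrm{id}$) and connections $c^k : I\otimes I\otimes (-)\to I\otimes(-)$, $k\in\{0,1\}$, i.e. natural transformations with $$c^k\circ\delta^k_{I\otimes X} = \delta^k_X\circ\varepsilon_X = c^k\circ (I\otimes\delta^k_X),\qquad c^k\circ\delta^{1-k}_{I\otimes X}= \mathrm{id} = c^k\circ(I\otimes\delta^{1-k}_X).$$ For $i:A\to B$, let $\delta^k\mathbin{\hat\otimes} i : (I\otimes A)+_A B\to I\otimes B$ be the Leibniz product. An algebraic weak factorization system (awfs) $(\mathsf L,\mathsf R)$ is *algebraically-free* on $u$ if the category of algebras for the monad $\mathsf R$ is isomorphic over $\mathcal E^\to$ to $\mathcal J^{\pitchfork}$, and *cofibrantly generated* if it is algebraically-free on some $u$ with $\mathcal J$ small. Let $(\mathsf C,\mathsf F_{\mathsf t})$ be an awfs on $\mathcal E$ and $\mathsf{Cof}$ the category of coalgebras for the copointed endofunctor of $\mathsf C$; assume that the awfs is *suitable*: it is cofibrantly generated; the functor $X\mapsto (0\to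 X)$ lifts to a functor $\mathcal E\to\mathsf{Cof}$; the pullback functor $\mathcal E^\to\times_{\mathcal E}\mathcal E^\to\to\mathcal E^\to$ lifts to a functor $\mathsf{Cof}\times_{\mathcal E}\mathcal E^\to\to\mathsf{Cof}$; and $\delta^k\mathbin{\hat\otimes}(-)$ lifts to a functor $\mathsf{Cof}\to\mathsf{Cof}$ for $k\in\{0,1\}$. Let $u:\mathcal I\to\mathcal E^\to$, with $\mathcal I$ small, be a functor on which $(\mathsf C,\mathsf F_{\mathsf t})$ is algebraically-free, put $\mathcal I_\otimes=\mathcal I+\mathcal I$, with $u_\otimes : \mathcal I_\otimes\to\mathcal E^\to$ given by $\delta^0\mathbin{\hat\otimes}u$ and $\delta^1\mathbin{\hat\otimes} u$ on the two summands. A *uniform fibration* is a right $\mathcal I_\otimes$-map; $\mathsf{Fib}=(\mathcal I_\otimes)^{\pitchfork}$. Write $p_*$ for the right adjoint of pullback along $p$. **Theorem.** There is a family of functors $\widetilde{p_*}$, one for each uniform fibration $p$, such that: 1. For every uniform fibration $p:X\to Y$, the functor $\widetilde{p_*}:\mathsf{Fib}_{/X}\to\mathsf{Fib}_{/Y}$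 is a lift of the functor $p_*:\mathcal E_{/X}^\to\to\mathcal E_{/Y}^\to$. 2. For every morphism $(s,t):p\to q$ of uniform fibrations, where $p:X\to Y$ and $q:U\to V$, the canonical Beck–Chevalley transformation $\psi : t^*q_*\to p_*s^*$ lifts to a natural transformation $\widetilde\psi:\widetilde{t^*}\,\widetilde{q_*}\to\widetilde{p_*}\,\widetilde{s^*}$ of functors $\mathsf{Fib}_{/U}\to\mathsf{Fib}_{/Y}$. If the square $(s,t)$ is a pullback, then $\widetilde\psi$ is a natural isomorphism. **Simplicial and cubical sets.** The same conclusions 1 and 2 hold for uniform Kan fibrations in $\mathbf{SSet}$ and in $\mathbf{CSet}$ (so pushforward along a uniform Kan fibration preserves uniform Kan fibrations). Here $\mathbf{CSet}$ is the category of presheaves on the category $\Box$ of de Morgan cubes (objects are finite sets; a map from $A$ to $B$ is a function from $B$ to the free de Morgan algebra on $A$); the cylinder is $\Delta^1\times(-)$, respectively $\Box^1\times(-)$, with its two endpoints; and uniform Kan fibrations are the right $\mathcal I_\otimes$-maps for $\mathcal I$ the category of monomorphisms with representable codomain and pullback squares between them. -/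

import Mathlib

open CategoryTheory CategoryTheory.Limits MonoidalCategory

universe w v u v₁ u₁ v₂ u₂ v₃ u₃

namespace UniformFibrations

/-! ### Right maps, slices, lifts of functors -/

section Orthogonality

variable {E : Type u} [Category.{v} E] {J : Type u₁} [Category.{v₁} J]

/-- A right `J`-map, for a functor `U : J ⥤ Arrow E`: an arrow together with a choice of a diagonal
filler for every commutative square from some `U j` to it (such a square is a morphism in the arrow
category), naturally in `j`. -/
structure RightMap (U : J ⥤ Arrow E) where
  /-- the underlying arrow -/
  arrow : Arrow E
  /-- the chosen diagonal filler of a square -/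
  fill (j : J) (sq : U.obj j ⟶ arrow) : (U.obj j).right ⟶ arrow.left
  fac_left (j : J) (sq : U.obj j ⟶ arrow) : (U.obj j).hom ≫ fill j sq = sq.left
  fac_right (j : J) (sq : U.obj j ⟶ arrow) : fill j sq ≫ arrow.hom = sq.right
  natural {i j : J} (σ : i ⟶ j) (sq : U.obj j ⟶ arrow) :
    (U.map σ).right ≫ fill j sq = fill i (U.map σ ≫ sq)

namespace RightMap

variable {U : J ⥤ Arrow E}

/-- A morphism of right maps: a square that is compatible with the chosen fillers. -/
@[ext]
structure Hom (f g : RightMap U) where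
  /-- the underlying square -/
  sq : f.arrow ⟶ g.arrow
  comm (j : J) (t : U.obj j ⟶ f.arrow) : f.fill j t ≫ sq.left = g.fill j (t ≫ sq)

instance : Category (RightMap U) where
  Hom := Hom
  id f := ⟨𝟙 _, fun j t => by simp⟩
  comp a b := ⟨a.sq ≫ b.sq, fun j t => by
    simp [← b.comm, ← a.comm, ← Category.assoc]⟩
  id_comp _ := by ext1; exact Category.id_comp _
  comp_id _ := by ext1; exact Category.comp_id _
  assoc _ _ _ := by ext1; exact Category.assoc _ _ _

variable (U) in
/-- The right orthogonal of `U`, as a functor: the forgetful functor from right maps to arrows. -/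
def forget : RightMap U ⥤ Arrow E where
  obj f := f.arrow
  map a := a.sq
  map_id _ := rfl
  map_comp _ _ := rfl

end RightMap

/-- An object of the slice category `J / X` of `U : J ⥤ Arrow E`: an index `i` together with
a commutative triangle over `X` with top side `U i`. -/
structure Slice (U : J ⥤ Arrow E) (X : E) where
  /-- the index -/
  index : J
  /-- the left side of the triangle -/
  a : (U.obj index).left ⟶ X
  /-- the right side of the triangle -/
  b : (U.obj index).right ⟶ X
  w : (U.obj index).hom ≫ b = a

namespace Slice

variable {U : J ⥤ Arrow E} {X : E}

/-- A morphism in `J / X`: a morphism in `J` whose image under `U` lies over `X`. -/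
@[ext]
structure Hom (s t : Slice U X) where
  /-- the underlying morphism in `J` -/
  map : s.index ⟶ t.index
  left_w : (U.map map).left ≫ t.a = s.a
  right_w : (U.map map).right ≫ t.b = s.b

instance : Category (Slice U X) where
  Hom := Hom
  id s := ⟨𝟙 _, by simp, by simp⟩
  comp m n := ⟨m.map ≫ n.map, by simp [n.left_w, m.left_w], by simp [n.right_w, m.right_w]⟩
  id_comp _ := by ext1; exact Category.id_comp _
  comp_id _ := by ext1; exact Category.comp_id _
  assoc _ _ _ := by ext1; exact Category.assoc _ _ _

variable (U X) in
/-- The functor `U / X` from `J / X` to the arrows of the slice category of `E` over `X`. -/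
def forget : Slice U X ⥤ Arrow (Over X) where
  obj s := Arrow.mk (Over.homMk (U.obj s.index).hom s.w : Over.mk s.a ⟶ Over.mk s.b)
  map m := Arrow.homMk (Over.homMk (U.map m.map).left m.left_w)
    (Over.homMk (U.map m.map).right m.right_w) (by
      apply Over.OverMorphism.ext
      exact Arrow.w (U.map m.map))
  map_id s := by
    apply Arrow.hom_ext <;> apply Over.OverMorphism.ext
    · exact congrArg (fun z => z.left) (U.map_id s.index)
    · exact congrArg (fun z => z.right) (U.map_id s.index)
  map_comp m n := by
    apply Arrow.hom_ext <;> apply Over.OverMorphism.ext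
    · exact congrArg (fun z => z.left) (U.map_comp m.map n.map)
    · exact congrArg (fun z => z.right) (U.map_comp m.map n.map)

end Slice

end Orthogonality

/-- A lift of a functor `T` along functors `V` and `V'`: a functor that makes the square with
vertical sides `V`, `V'` and lower side `T` commute. -/
structure Lift {A : Type u} [Category.{v} A] {A' : Type u₁} [Category.{v₁} A']
    {D : Type u₂} [Category.{v₂} D] {D' : Type u₃} [Category.{v₃} D']
    (V : A ⥤ D) (V' : A' ⥤ D') (T : D ⥤ D') where
  /-- the lifted functor -/
  functor : A ⥤ A'
  comm : functor ⋙ V' = V ⋙ T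

/-- The natural transformation `β` between two lifted functors is a lift of the natural
transformation `α` between the original functors. The two identity morphisms `eqToHom` only
account for the commutativity of the two squares. -/
def IsLiftOf {A : Type u} [Category.{v} A] {A' : Type u₁} [Category.{v₁} A']
    {D : Type u₂} [Category.{v₂} D] {D' : Type u₃} [Category.{v₃} D']
    {V : A ⥤ D} {V' : A' ⥤ D'} {T₁ T₂ : D ⥤ D'} (L₁ : Lift V V' T₁) (L₂ : Lift V V' T₂)
    (β : L₁.functor ⟶ L₂.functor) (α : T₁ ⟶ T₂) : Prop :=
  Functor.whiskerRight β V' =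
    eqToHom L₁.comm ≫ Functor.whiskerLeft V α ≫ eqToHom L₂.comm.symm

/-! ### Locally cartesian closed categories and pushforward -/

/-- A category with finite limits in which every pullback functor between slices has a right
adjoint. -/
class LocallyCartesianClosed (E : Type u) [Category.{v} E] : Prop extends HasFiniteLimits E where
  isLeftAdjoint_pullback {X Y : E} (f : X ⟶ Y) : (Over.pullback f).IsLeftAdjoint

attribute [instance] LocallyCartesianClosed.isLeftAdjoint_pullback

/-! Presheaf categories are locally cartesian closed. -/

namespace PresheafPushforward

variable {D : Type u} [Category.{v} D] {X Y : D ⥤ Type (max w v u)} (f : X ⟶ Y)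

lemma over_w_apply {Z : D ⥤ Type (max w v u)} {B C : Over Z} (h : B ⟶ C) (c : D) (b : B.left.obj c) :
    C.hom.app c (h.left.app c b) = B.hom.app c b := by
  rw [← Over.w h]; rfl

/-- explicit pullback -/
def pbObj (B : Over Y) : D ⥤ Type (max w v u) where
  obj c := { p : B.left.obj c × X.obj c // B.hom.app c p.1 = f.app c p.2 }
  map g := TypeCat.ofHom fun p => ⟨(B.left.map g p.1.1, X.map g p.1.2), by
    rw [NatTrans.naturality_apply, NatTrans.naturality_apply, p.2]⟩

def pb : Over Y ⥤ Over X where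
  obj B := Over.mk (Y := pbObj f B)
    { app c := TypeCat.ofHom fun p => p.1.2 }
  map {B C} h := Over.homMk
    { app c := TypeCat.ofHom fun p => ⟨(h.left.app c p.1.1, p.1.2), by
        rw [over_w_apply]; exact p.2⟩
      naturality c d g := by
        ext p; apply Subtype.ext; apply Prod.ext
        · exact (NatTrans.naturality_apply h.left g _)
        · rfl }

def pbAdj : Over.map f ⊣ pb f := Adjunction.mkOfHomEquiv
  { homEquiv C B :=
      { toFun h := Over.homMk
          { app c := TypeCat.ofHom fun x => ⟨(h.left.app c x, C.hom.app c x), over_w_apply h c x⟩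
            naturality c d g := by
              ext p; apply Subtype.ext; apply Prod.ext
              · exact (NatTrans.naturality_apply h.left g _)
              · exact (NatTrans.naturality_apply C.hom g _) }
        invFun h := Over.homMk
          { app c := TypeCat.ofHom fun x => (h.left.app c x).1.1
            naturality c d g := by
              ext p
              exact congrArg (fun z => z.1.1) (NatTrans.naturality_apply h.left g _) } (by
            ext c x
            refine (h.left.app c x).2.trans ?_
            exact congrArg (f.app c) (over_w_apply h c x))
        left_inv h := rfl
        right_inv h := by
          ext c x
          apply Subtype.ext; apply Prod.ext
          · rfl
          · exact (over_w_apply h c x).symm }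
    homEquiv_naturality_left_symm _ _ := rfl
    homEquiv_naturality_right h k := rfl }

/-- sections -/

structure Sec (A : Over X) (c : D) where
  base : Y.obj c
  sec (d : D) (g : c ⟶ d) (x : X.obj d) (h : Y.map g base = f.app d x) : A.left.obj d
  hover d g x h : A.hom.app d (sec d g x h) = x
  nat d g x h d' (k : d ⟶ d') (h' : Y.map (g ≫ k) base = f.app d' (X.map k x)) :
    A.left.map k (sec d g x h) = sec d' (g ≫ k) (X.map k x) h'

variable {f}

lemma Sec.congr {A : Over X} {c : D} (s : Sec f A c) {d : D} {g g' : c ⟶ d} {x x' : X.obj d} (hg : g = g') (hx : x = x')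
   (h h') : s.sec d g x h = s.sec d g' x' h' := by subst hg hx; rfl

lemma Sec.ext' {A : Over X} {c : D} (s t : Sec f A c) (hb : s.base = t.base)
    (h : ∀ d g x h h', s.sec d g x h = t.sec d g x h') : s = t := by
  obtain ⟨b, s, o, n⟩ := s
  obtain ⟨b', s', o', n'⟩ := t
  obtain rfl : b = b' := hb
  congr
  funext d g x hx
  exact h d g x hx hx

def Sec.map {A : Over X} {c c' : D} (g : c ⟶ c') (s : Sec f A c) : Sec f A c' where
  base := Y.map g s.base
  sec d k x h := s.sec d (g ≫ k) x (by rw [← h]; simp)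
  hover d k x h := s.hover ..
  nat d k x h d' k' h' := (s.nat _ _ _ _ _ _ (by rw [← h']; simp)).trans (s.congr (by simp) rfl _ _)

variable (f)

def piObj (A : Over X) : Over Y := Over.mk (Y :=
  { obj c := Sec f A c
    map g := TypeCat.ofHom fun s => s.map g
    map_id c := by
      refine ConcreteCategory.hom_ext _ _ fun s => ?_
      apply Sec.ext'
      · simp [Sec.map]
      · intro d g x h h'; exact s.congr (by simp) rfl _ _
    map_comp g g' := by
      refine ConcreteCategory.hom_ext _ _ fun s => ?_
      apply Sec.ext'
      · simp [Sec.map]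
      · intro d g x h h'; exact s.congr (by simp) rfl _ _ })
  { app c := TypeCat.ofHom fun s => s.base }

def piEquiv (B : Over Y) (A : Over X) : ((pb f).obj B ⟶ A) ≃ (B ⟶ piObj f A) where
  toFun h := Over.homMk
    { app c := TypeCat.ofHom fun b =>
        { base := B.hom.app c b
          sec d g x hx := h.left.app d ⟨(B.left.map g b, x), by
            rw [NatTrans.naturality_apply, hx]⟩
          hover d g x hx := over_w_apply h d _
          nat d g x hx d' k hx' := by
            refine (NatTrans.naturality_apply h.left k _).symm.trans ?_
            refine congrArg (h.left.app d') ?_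
            apply Subtype.ext; apply Prod.ext
            · change B.left.map k (B.left.map g b) = B.left.map (g ≫ k) b
              simp
            · rfl }
      naturality c c' g := by
        ext b
        apply Sec.ext'
        · exact NatTrans.naturality_apply B.hom g b
        · intro d k x hx hx'
          change h.left.app d _ = h.left.app d _
          congr 1
          apply Subtype.ext; apply Prod.ext
          · change B.left.map k (B.left.map g b) = B.left.map (g ≫ k) b
            simp
          · rfl }
  invFun h := Over.homMk
    { app c := TypeCat.ofHom fun p => (h.left.app c p.1.1).sec c (𝟙 c) p.1.2 (by
        rw [Y.map_id]
        exact (over_w_apply h c p.1.1).trans p.2)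
      naturality c c' g := by
        ext p
        have e : h.left.app c' (B.left.map g p.1.1) = Sec.map g (h.left.app c p.1.1) :=
          NatTrans.naturality_apply h.left g p.1.1
        have key : ∀ (s t : Sec f A c') (_ : s = t) x h₁ h₂, s.sec c' (𝟙 c') x h₁ = t.sec c' (𝟙 c') x h₂ := by
          rintro s _ rfl x _ _; rfl
        refine (key _ _ e _ _ ?_).trans ?_
        · have h1 := over_w_apply h c p.1.1
          have h2 : (h.left.app c p.1.1).base = f.app c p.1.2 := h1.trans p.2
          change Y.map (𝟙 c') (Y.map g (h.left.app c p.1.1).base) = f.app c' (X.map g p.1.2)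
          rw [h2, NatTrans.naturality_apply]; simp
        · refine Eq.trans ?_ ((h.left.app c p.1.1).nat _ _ _ _ _ g ?_).symm
          · exact Sec.congr _ ((Category.comp_id g).trans (Category.id_comp g).symm) rfl _ _
          · have h1 := over_w_apply h c p.1.1
            have h2 : (h.left.app c p.1.1).base = f.app c p.1.2 := h1.trans p.2
            rw [h2, NatTrans.naturality_apply]; simp } (by
      ext c p
      exact Sec.hover _ _ _ _ _)
  left_inv h := by
    ext c p
    change h.left.app c _ = h.left.app c _
    congr 1
    apply Subtype.ext; apply Prod.ext
    · change B.left.map (𝟙 c) _ = _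
      simp
    · rfl
  right_inv h := by
    ext c b
    apply Sec.ext'
    · exact (over_w_apply h c b).symm
    · intro d g x hx hx'
      have e : h.left.app d (B.left.map g b) = Sec.map g (h.left.app c b) :=
          NatTrans.naturality_apply h.left g b
      have key : ∀ (s t : Sec f A d) (_ : s = t) x h₁ h₂, s.sec d (𝟙 d) x h₁ = t.sec d (𝟙 d) x h₂ := by
          rintro s _ rfl x _ _; rfl
      refine (key _ _ e x _ ?_).trans ?_
      · change Y.map (𝟙 d) (Y.map g (h.left.app c b).base) = _
        rw [← hx']; simp
      · exact Sec.congr _ (Category.comp_id g) rfl _ _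

theorem isLeftAdjoint_pullback : (Over.pullback f).IsLeftAdjoint := by
  have adj : (pb f) ⊣ Adjunction.rightAdjointOfEquiv (F := pb f) (piEquiv f) (by
    intro B' B A h k
    refine Over.OverMorphism.ext (NatTrans.ext (funext fun c =>
      ConcreteCategory.hom_ext _ _ fun b => ?_))
    apply Sec.ext'
    · exact (over_w_apply h c b).symm
    · intro d g x hx hx'
      change k.left.app d _ = k.left.app d _
      congr 1
      apply Subtype.ext; apply Prod.ext
      · exact NatTrans.naturality_apply h.left g b
      · rfl) := Adjunction.adjunctionOfEquivRight _ _
  have := adj.isLeftAdjoint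
  exact Functor.isLeftAdjoint_of_iso
    ((pbAdj f).rightAdjointUniq (Over.mapPullbackAdj f))

end PresheafPushforward

section Pushforward

variable {E : Type u} [Category.{v} E] [LocallyCartesianClosed E]

/-- Pushforward along `f`, the right adjoint of pullback along `f`. -/
noncomputable def pushforward {X Y : E} (f : X ⟶ Y) : Over X ⥤ Over Y :=
  (Over.pullback f).rightAdjoint

/-- The adjunction between pullback and pushforward. -/
noncomputable def pushforwardAdj {X Y : E} (f : X ⟶ Y) : Over.pullback f ⊣ pushforward f :=
  Adjunction.ofIsLeftAdjoint _

variable {X Y U V : E} {p : X ⟶ Y} {q : U ⟶ V} {s : X ⟶ U} {t : Y ⟶ V}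

/-- For a commutative square `(s, t) : p ⟶ q`, the canonical transformation `s_! p^* ⟶ q^* t_!`,
which at `Z ⟶ Y` is the map `Z ×_Y X ⟶ Z ×_V U` induced by `s`. -/
noncomputable def beckChevalleyPullback (sq : s ≫ q = p ≫ t) :
    Over.pullback p ⋙ Over.map s ⟶ Over.map t ⋙ Over.pullback q where
  app Z := Over.homMk
    (pullback.lift (pullback.fst Z.hom p) (pullback.snd Z.hom p ≫ s)
      (by simp [sq, pullback.condition_assoc]) :
      pullback Z.hom p ⟶ pullback (Z.hom ≫ t) q)
    (pullback.lift_snd _ _ _)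
  naturality Z Z' h := by
    apply Over.OverMorphism.ext
    apply pullback.hom_ext
    · simp only [Functor.comp_map, Over.comp_left, Over.map_map_left, Over.pullback_map_left,
        Over.homMk_left, Category.assoc]
      erw [pullback.lift_fst, pullback.lift_fst, pullback.lift_fst, pullback.lift_fst_assoc]
    · simp only [Functor.comp_map, Over.comp_left, Over.map_map_left, Over.pullback_map_left,
        Over.homMk_left, Category.assoc]
      erw [pullback.lift_snd, pullback.lift_snd_assoc, pullback.lift_snd, pullback.lift_snd]

/-- For a commutative square `(s, t) : p ⟶ q`, the canonical transformation `t^* q_* ⟶ p_* s^*`: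
the mate of `s_! p^* ⟶ q^* t_!`. -/
noncomputable def beckChevalley (sq : s ≫ q = p ≫ t) :
    pushforward q ⋙ Over.pullback t ⟶ Over.pullback s ⋙ pushforward p :=
  conjugateEquiv ((Over.mapPullbackAdj t).comp (pushforwardAdj q))
    ((pushforwardAdj p).comp (Over.mapPullbackAdj s)) (beckChevalleyPullback sq)

end Pushforward

/-! ### Lifting pullback and pushforward to right maps -/

section LiftPullback

variable {E : Type u} [Category.{v} E] {J : Type u₁} [Category.{v₁} J] {U : J ⥤ Arrow E}

/-- Right maps are stable under base change: if `κ` is a cartesian square from the arrow `f` to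
a right map `g`, then `f` is a right map in a unique way such that `κ` is a morphism of right
maps. -/
noncomputable def RightMap.baseChange (g : RightMap U) {f : Arrow E} (κ : f ⟶ g.arrow)
    (h : IsPullback κ.left f.hom g.arrow.hom κ.right) : RightMap U where
  arrow := f
  fill j sq := h.lift (g.fill j (sq ≫ κ)) sq.right (by rw [g.fac_right]; simp)
  fac_left j sq := by
    apply h.hom_ext
    · rw [Category.assoc, h.lift_fst, g.fac_left]; simp
    · rw [Category.assoc, h.lift_snd, Arrow.w sq]
  fac_right j sq := h.lift_snd _ _ _
  natural σ sq := by
    apply h.hom_ext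
    · rw [Category.assoc, h.lift_fst, g.natural, h.lift_fst, Category.assoc]
    · rw [Category.assoc, h.lift_snd, h.lift_snd]; simp

lemma RightMap.baseChange_comm {g g' : RightMap U} (m : g ⟶ g') {f f' : Arrow E}
    (κ : f ⟶ g.arrow) (h : IsPullback κ.left f.hom g.arrow.hom κ.right) (κ' : f' ⟶ g'.arrow)
    (h' : IsPullback κ'.left f'.hom g'.arrow.hom κ'.right) (n : f ⟶ f')
    (hn : n ≫ κ' = κ ≫ m.sq) (j : J) (sq : U.obj j ⟶ f) :
    (g.baseChange κ h).fill j sq ≫ n.left = (g'.baseChange κ' h').fill j (sq ≫ n) := by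
  apply h'.hom_ext
  · have hl : n.left ≫ κ'.left = κ.left ≫ m.sq.left := congrArg (fun z => z.left) hn
    simp only [RightMap.baseChange]
    rw [Category.assoc, hl, h.lift_fst_assoc, h'.lift_fst, m.comm, Category.assoc, Category.assoc,
      hn]
  · simp only [RightMap.baseChange]
    rw [Category.assoc, Arrow.w n, h.lift_snd_assoc, h'.lift_snd]
    simp

variable [HasPullbacks E] {Y V : E} (t : Y ⟶ V)

lemma isPullback_pullback_map {A B : Over V} (f : A ⟶ B) :
    IsPullback (pullback.fst A.hom t) ((Over.pullback t).map f).left f.left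
      (pullback.fst B.hom t) := by
  have e : ((Over.pullback t).map f).left ≫ pullback.snd B.hom t = pullback.snd A.hom t :=
    Over.w ((Over.pullback t).map f)
  have h : IsPullback (((Over.pullback t).map f).left ≫ pullback.snd B.hom t)
      (pullback.fst A.hom t) t (f.left ≫ B.hom) := by
    have h₀ := (IsPullback.of_hasPullback A.hom t).flip
    rw [e, show f.left ≫ B.hom = A.hom from Over.w f]
    exact h₀
  have h' := (IsPullback.of_hasPullback B.hom t).flip
  exact (IsPullback.of_right h (pullback.lift_fst _ _ _) h').flip

/-- The cartesian square from the pullback along `t : Y ⟶ V` of an arrow over `V` to that arrow. -/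
noncomputable def pullbackSquare {A B : Over V} (f : A ⟶ B) :
    Arrow.mk ((Over.pullback t).map f).left ⟶ Arrow.mk f.left :=
  Arrow.homMk (pullback.fst A.hom t) (pullback.fst B.hom t) (isPullback_pullback_map t f).w

lemma pullbackSquare_naturality {A B A' B' : Over V} (f : A ⟶ B) (f' : A' ⟶ B') (a : A ⟶ A')
    (b : B ⟶ B') (h : ((Over.pullback t).map a).left ≫ ((Over.pullback t).map f').left =
      ((Over.pullback t).map f).left ≫ ((Over.pullback t).map b).left)
    (h' : a.left ≫ f'.left = f.left ≫ b.left) :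
    (Arrow.homMk ((Over.pullback t).map a).left ((Over.pullback t).map b).left h :
        Arrow.mk ((Over.pullback t).map f).left ⟶ Arrow.mk ((Over.pullback t).map f').left) ≫
      pullbackSquare t f' =
    pullbackSquare t f ≫ (Arrow.homMk a.left b.left h' : Arrow.mk f.left ⟶ Arrow.mk f'.left) := by
  apply Arrow.hom_ext
  · exact pullback.lift_fst _ _ _
  · exact pullback.lift_fst _ _ _

/-- Pullback along `t : Y ⟶ V` as a functor from right maps over `V` to right maps over `Y`. -/
noncomputable def pullbackSlice :
    Slice (RightMap.forget U) V ⥤ Slice (RightMap.forget U) Y where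
  obj x :=
    { index := x.index.baseChange (pullbackSquare t ((Slice.forget _ V).obj x).hom)
        (isPullback_pullback_map t ((Slice.forget _ V).obj x).hom)
      a := pullback.snd x.a t
      b := pullback.snd x.b t
      w := Over.w ((Over.pullback t).map ((Slice.forget _ V).obj x).hom) }
  map {x y} m :=
    { map :=
        { sq := Arrow.homMk ((Over.pullback t).map ((Slice.forget _ V).map m).left).left
            ((Over.pullback t).map ((Slice.forget _ V).map m).right).left
            (congrArg (fun z => z.left)
              (Arrow.w ((Over.pullback t).mapArrow.map ((Slice.forget _ V).map m))))
          comm := RightMap.baseChange_comm m.map _ _ _ _ _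
            (pullbackSquare_naturality t _ _ _ _ _ (Arrow.w m.map.sq)) }
      left_w := Over.w ((Over.pullback t).map ((Slice.forget _ V).map m).left)
      right_w := Over.w ((Over.pullback t).map ((Slice.forget _ V).map m).right) }
  map_id x := by
    apply Slice.Hom.ext
    apply RightMap.Hom.ext
    apply Arrow.hom_ext
    · exact congrArg (fun z => z.left.left)
        ((Slice.forget _ V ⋙ (Over.pullback t).mapArrow).map_id x)
    · exact congrArg (fun z => z.right.left)
        ((Slice.forget _ V ⋙ (Over.pullback t).mapArrow).map_id x)
  map_comp m n := by
    apply Slice.Hom.ext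
    apply RightMap.Hom.ext
    apply Arrow.hom_ext
    · exact congrArg (fun z => z.left.left)
        ((Slice.forget _ V ⋙ (Over.pullback t).mapArrow).map_comp m n)
    · exact congrArg (fun z => z.right.left)
        ((Slice.forget _ V ⋙ (Over.pullback t).mapArrow).map_comp m n)

variable (U) in
/-- The lift of pullback along `t : Y ⟶ V` to right maps. -/
noncomputable def pullbackLift :
    Lift (Slice.forget (RightMap.forget U) V) (Slice.forget (RightMap.forget U) Y)
      (Over.pullback t).mapArrow where
  functor := pullbackSlice t
  comm := rfl

end LiftPullback

section PushforwardLifts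

variable {E : Type u} [Category.{v} E] [LocallyCartesianClosed E]
  {J : Type u₁} [Category.{v₁} J]

/-- The composite of two lifts. -/
def Lift.comp {A₁ : Type*} [Category* A₁] {A₂ : Type*} [Category* A₂] {A₃ : Type*} [Category* A₃]
    {D₁ : Type*} [Category* D₁] {D₂ : Type*} [Category* D₂] {D₃ : Type*} [Category* D₃]
    {V₁ : A₁ ⥤ D₁} {V₂ : A₂ ⥤ D₂} {V₃ : A₃ ⥤ D₃} {T : D₁ ⥤ D₂} {T' : D₂ ⥤ D₃}
    (L : Lift V₁ V₂ T) (L' : Lift V₂ V₃ T') : Lift V₁ V₃ (T ⋙ T') where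
  functor := L.functor ⋙ L'.functor
  comm := by
    rw [Functor.assoc, L'.comm, ← Functor.assoc, L.comm, Functor.assoc]

/-- For the category of right `J`-maps of `U : J ⥤ Arrow E`: the pushforward functors along
(the underlying arrows of) right maps `p` lift to functors `p̃_*` between slices of the category of
right maps and, for every morphism `(s, t) : p ⟶ q` of right maps, the canonical transformation
`t^* q_* ⟶ p_* s^*` lifts to a transformation of the lifted functors, which is invertible whenever
the square `(s, t)` is a pullback. -/
def PushforwardLifts (U : J ⥤ Arrow E) : Prop :=
  ∃ push : ∀ p : RightMap U,
      Lift (Slice.forget (RightMap.forget U) p.arrow.left)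
        (Slice.forget (RightMap.forget U) p.arrow.right)
        (pushforward p.arrow.hom).mapArrow,
    ∀ (p q : RightMap U) (m : p ⟶ q),
      ∃ ψ : ((push q).comp (pullbackLift U m.sq.right)).functor ⟶
          ((pullbackLift U m.sq.left).comp (push p)).functor,
        IsLiftOf ((push q).comp (pullbackLift U m.sq.right))
          ((pullbackLift U m.sq.left).comp (push p)) ψ
          ((Functor.mapArrowFunctor _ _).map (beckChevalley (Arrow.w m.sq))) ∧
        (IsPullback m.sq.left p.arrow.hom q.arrow.hom m.sq.right → IsIso ψ)

end PushforwardLifts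

/-! ### Functorial cylinders and uniform fibrations -/

section Cylinder

variable (E : Type u) [Category.{v} E]

/-- A functorial cylinder: an endofunctor with left and right endpoint inclusions. -/
structure FunctorialCylinder where
  /-- the cylinder functor -/
  I : E ⥤ E
  /-- the endpoint inclusions -/
  δ : Fin 2 → (𝟭 E ⟶ I)

variable {E}

/-- Contractions: a common retraction of the two endpoint inclusions. -/
structure FunctorialCylinder.Contractions (cyl : FunctorialCylinder E) where
  /-- the retraction -/
  ε : cyl.I ⟶ 𝟭 E
  δ_ε (k : Fin 2) : cyl.δ k ≫ ε = 𝟙 (𝟭 E)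

/-- Connections on a functorial cylinder with contractions. -/
structure FunctorialCylinder.Connections (cyl : FunctorialCylinder E)
    (con : cyl.Contractions) where
  /-- the connections -/
  c : Fin 2 → (cyl.I ⋙ cyl.I ⟶ cyl.I)
  δ_c (k : Fin 2) (X : E) :
    (cyl.δ k).app (cyl.I.obj X) ≫ (c k).app X = con.ε.app X ≫ (cyl.δ k).app X
  map_δ_c (k : Fin 2) (X : E) :
    cyl.I.map ((cyl.δ k).app X) ≫ (c k).app X = con.ε.app X ≫ (cyl.δ k).app X
  δ_c' (k : Fin 2) (X : E) :
    (cyl.δ (1 - k)).app (cyl.I.obj X) ≫ (c k).app X = 𝟙 (cyl.I.obj X)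
  map_δ_c' (k : Fin 2) (X : E) :
    cyl.I.map ((cyl.δ (1 - k)).app X) ≫ (c k).app X = 𝟙 (cyl.I.obj X)

/-- The Leibniz product with a natural transformation `δ : Id ⟶ I`: it sends `i : A ⟶ B` to the
map `I A +_A B ⟶ I B` that is induced by `I i` and `δ B`. -/
noncomputable def leibniz [HasPushouts E] {I : E ⥤ E} (δ : 𝟭 E ⟶ I) : Arrow E ⥤ Arrow E where
  obj f := Arrow.mk (pushout.desc (I.map f.hom) (δ.app f.right) (δ.naturality f.hom).symm :
    pushout (show f.left ⟶ I.obj f.left from δ.app f.left) f.hom ⟶ I.obj f.right)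
  map {f g} m := Arrow.homMk
    (pushout.map _ _ _ _ (I.map m.left) m.right m.left (δ.naturality m.left).symm (Arrow.w m).symm)
    (I.map m.right) (by
      apply pushout.hom_ext
      · refine (pushout.inl_desc_assoc _ _ _ _).trans ?_
        refine ((Category.assoc _ _ _).trans (congrArg (fun z => I.map m.left ≫ z)
          (pushout.inl_desc _ _ _))).trans ?_
        refine Eq.trans ?_ (pushout.inl_desc_assoc _ _ _ _).symm
        refine (I.map_comp _ _).symm.trans (Eq.trans ?_ (I.map_comp _ _))
        exact congrArg I.map (Arrow.w m)
      · refine (pushout.inr_desc_assoc _ _ _ _).trans ?_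
        refine ((Category.assoc _ _ _).trans (congrArg (fun z => m.right ≫ z)
          (pushout.inr_desc _ _ _))).trans ?_
        refine Eq.trans ?_ (pushout.inr_desc_assoc _ _ _ _).symm
        exact δ.naturality m.right)
  map_id f := by
    apply Arrow.hom_ext
    · apply pushout.hom_ext
      · refine (pushout.inl_desc _ _ _).trans (Eq.trans ?_ (Category.comp_id _).symm)
        exact (congrArg (fun z => z ≫ _) (I.map_id f.left)).trans (Category.id_comp _)
      · refine (pushout.inr_desc _ _ _).trans (Eq.trans ?_ (Category.comp_id _).symm)
        exact Category.id_comp _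
    · exact I.map_id _
  map_comp m n := by
    apply Arrow.hom_ext
    · apply pushout.hom_ext
      · refine (pushout.inl_desc _ _ _).trans (Eq.trans ?_ (pushout.inl_desc_assoc _ _ _ _).symm)
        refine (congrArg (fun z => z ≫ _) (I.map_comp m.left n.left)).trans ?_
        refine (Category.assoc _ _ _).trans (Eq.trans ?_ (Category.assoc _ _ _).symm)
        exact congrArg (fun z => I.map m.left ≫ z) (pushout.inl_desc _ _ _).symm
      · refine (pushout.inr_desc _ _ _).trans (Eq.trans ?_ (pushout.inr_desc_assoc _ _ _ _).symm)
        refine (Category.assoc _ _ _).trans (Eq.trans ?_ (Category.assoc _ _ _).symm)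
        exact congrArg (fun z => m.right ≫ z) (pushout.inr_desc _ _ _).symm
    · exact I.map_comp _ _

/-- The generating uniform trivial cofibrations: for `U : J ⥤ Arrow E`, the Leibniz products of the
two endpoint inclusions with `U`, indexed by the coproduct of two copies of `J`. -/
noncomputable def FunctorialCylinder.trivCofGen [HasPushouts E] (cyl : FunctorialCylinder E)
    {J : Type u₁} [Category.{v₁} J] (U : J ⥤ Arrow E) : J ⊕ J ⥤ Arrow E :=
  (U ⋙ leibniz (cyl.δ 0)).sum' (U ⋙ leibniz (cyl.δ 1))

end Cylinder

/-! ### Algebraic weak factorization systems -/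

/-- A functorial factorization. -/
abbrev FunctorialFactorization (E : Type u) [Category.{v} E] :=
  MorphismProperty.FunctorialFactorizationData (⊤ : MorphismProperty E) (⊤ : MorphismProperty E)

section AWFS

namespace FunctorialFactorization

variable {E : Type u} [Category.{v} E] (F : FunctorialFactorization E)

/-- The functor sending an arrow to the left part of its factorization. -/
def L : Arrow E ⥤ Arrow E where
  obj f := Arrow.mk (F.i.app f)
  map m := Arrow.homMk m.left (F.Z.map m) (F.i.naturality m)

/-- The functor sending an arrow to the right part of its factorization. -/
def R : Arrow E ⥤ Arrow E where
  obj f := Arrow.mk (F.p.app f)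
  map m := Arrow.homMk (F.Z.map m) m.right (F.p.naturality m)

/-- The canonical copointing of `L`. -/
def counit : F.L ⟶ 𝟭 (Arrow E) where
  app f := Arrow.homMk (𝟙 f.left) (F.p.app f) ((Category.id_comp _).trans F.fac_app.symm)
  naturality f g m := by
    apply Arrow.hom_ext
    · exact (Category.comp_id _).trans (Category.id_comp _).symm
    · exact F.p.naturality m

/-- The canonical pointing of `R`. -/
def unit : 𝟭 (Arrow E) ⟶ F.R where
  app f := Arrow.homMk (F.i.app f) (𝟙 f.right) (F.fac_app.trans (Category.comp_id _).symm)
  naturality f g m := by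
    apply Arrow.hom_ext
    · exact F.i.naturality m
    · exact (Category.comp_id _).trans (Category.id_comp _).symm

end FunctorialFactorization

/-- An algebraic weak factorization system: a functorial factorization `f = R f ∘ L f` through
`Z f` together with a comultiplication, with components `δ f : Z f ⟶ Z (L f)`, and
a multiplication, with components `μ f : Z (R f) ⟶ Z f`, which make `L` a comonad (with the
canonical counit) and `R` a monad (with the canonical unit) and are such that the squares
`(δ f, μ f) : L (R f) ⟶ R (L f)` are a distributive law. Given the other equations, each of the
equations of a distributive law either holds or is equivalent to the last equation `distrib`. -/
structure AWFS (E : Type u) [Category.{v} E] where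
  /-- the underlying functorial factorization -/
  F : FunctorialFactorization E
  /-- the comultiplication -/
  δ : F.Z ⟶ F.L ⋙ F.Z
  /-- the multiplication -/
  μ : F.R ⋙ F.Z ⟶ F.Z
  i_δ (f : Arrow E) : F.i.app f ≫ δ.app f = F.i.app (F.L.obj f)
  μ_p (f : Arrow E) : μ.app f ≫ F.p.app f = F.p.app (F.R.obj f)
  δ_p (f : Arrow E) : δ.app f ≫ F.p.app (F.L.obj f) = 𝟙 (F.Z.obj f)
  δ_map_counit (f : Arrow E) : δ.app f ≫ F.Z.map (F.counit.app f) = 𝟙 (F.Z.obj f)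
  coassoc (f : Arrow E) :
    δ.app f ≫ F.Z.map (Arrow.homMk (𝟙 f.left) (δ.app f) ((Category.id_comp _).trans (i_δ f).symm) :
      F.L.obj f ⟶ F.L.obj (F.L.obj f)) = δ.app f ≫ δ.app (F.L.obj f)
  i_μ (f : Arrow E) : F.i.app (F.R.obj f) ≫ μ.app f = 𝟙 (F.Z.obj f)
  map_unit_μ (f : Arrow E) : F.Z.map (F.unit.app f) ≫ μ.app f = 𝟙 (F.Z.obj f)
  assoc (f : Arrow E) :
    F.Z.map (Arrow.homMk (μ.app f) (𝟙 f.right) ((μ_p f).trans (Category.comp_id _).symm) :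
      F.R.obj (F.R.obj f) ⟶ F.R.obj f) ≫ μ.app f = μ.app (F.R.obj f) ≫ μ.app f
  distrib (f : Arrow E) :
    μ.app f ≫ δ.app f = δ.app (F.R.obj f) ≫
      F.Z.map (Arrow.homMk (δ.app f) (μ.app f) ((δ_p f).trans (i_μ f).symm) :
        F.L.obj (F.R.obj f) ⟶ F.R.obj (F.L.obj f)) ≫ μ.app (F.L.obj f)

namespace AWFS

variable {E : Type u} [Category.{v} E] (W : AWFS E)

/-- The monad `R` of an algebraic weak factorization system. -/
def monad : Monad (Arrow E) where
  toFunctor := W.F.R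
  η := W.F.unit
  μ :=
    { app f := Arrow.homMk (W.μ.app f) (𝟙 f.right) ((W.μ_p f).trans (Category.comp_id _).symm)
      naturality f g m := by
        apply Arrow.hom_ext
        · exact W.μ.naturality m
        · exact (Category.comp_id _).trans (Category.id_comp _).symm }
  assoc f := by
    apply Arrow.hom_ext
    · exact W.assoc f
    · rfl
  left_unit f := by
    apply Arrow.hom_ext
    · exact W.i_μ f
    · exact Category.comp_id _
  right_unit f := by
    apply Arrow.hom_ext
    · exact W.map_unit_μ f
    · exact Category.comp_id _

/-- The comonad `L` of an algebraic weak factorization system. -/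
def comonad : Comonad (Arrow E) where
  toFunctor := W.F.L
  ε := W.F.counit
  δ :=
    { app f := Arrow.homMk (𝟙 f.left) (W.δ.app f) ((Category.id_comp _).trans (W.i_δ f).symm)
      naturality f g m := by
        apply Arrow.hom_ext
        · exact (Category.comp_id _).trans (Category.id_comp _).symm
        · exact W.δ.naturality m }
  coassoc f := by
    apply Arrow.hom_ext
    · rfl
    · exact W.coassoc f
  left_counit f := by
    apply Arrow.hom_ext
    · exact Category.comp_id _
    · exact W.δ_p f
  right_counit f := by
    apply Arrow.hom_ext
    · exact Category.comp_id _
    · exact W.δ_map_counit f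

/-- A coalgebra for the copointed endofunctor `L`. -/
structure LeftMap where
  /-- the underlying arrow -/
  arrow : Arrow E
  /-- the structure map -/
  str : arrow ⟶ W.F.L.obj arrow
  counit : str ≫ W.F.counit.app arrow = 𝟙 arrow

namespace LeftMap

variable {W}

/-- A morphism of coalgebras. -/
@[ext]
structure Hom (f g : W.LeftMap) where
  /-- the underlying square -/
  sq : f.arrow ⟶ g.arrow
  comm : f.str ≫ W.F.L.map sq = sq ≫ g.str

instance : Category W.LeftMap where
  Hom := Hom
  id f := ⟨𝟙 _, by simp⟩
  comp a b := ⟨a.sq ≫ b.sq, by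
    rw [Functor.map_comp, ← Category.assoc, a.comm, Category.assoc, b.comm, Category.assoc]⟩
  id_comp _ := by ext1; exact Category.id_comp _
  comp_id _ := by ext1; exact Category.comp_id _
  assoc _ _ _ := by ext1; exact Category.assoc _ _ _

variable (W) in
/-- The forgetful functor from coalgebras to arrows. -/
def forget : W.LeftMap ⥤ Arrow E where
  obj f := f.arrow
  map a := a.sq
  map_id _ := rfl
  map_comp _ _ := rfl

end LeftMap

/-- The algebraic weak factorization system `W` is algebraically-free on `U : J ⥤ Arrow E`: the
category of algebras for its monad is isomorphic, over the arrow category, to the category of right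
`J`-maps. -/
def IsAlgebraicallyFreeOn {J : Type u₁} [Category.{v₁} J] (U : J ⥤ Arrow E) : Prop :=
  ∃ (G : W.monad.Algebra ⥤ RightMap U) (H : RightMap U ⥤ W.monad.Algebra),
    G ⋙ H = 𝟭 _ ∧ H ⋙ G = 𝟭 _ ∧ G ⋙ RightMap.forget U = W.monad.forget

end AWFS

/-- The functor that sends an object `X` to the arrow `⊥ ⟶ X` from the initial object. -/
noncomputable def initialArrow (E : Type u) [Category.{v} E] [HasInitial E] : E ⥤ Arrow E where
  obj X := Arrow.mk (initial.to X)
  map f := Arrow.homMk (𝟙 _) f (by simp)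

/-- The pullback functor `P : E^→ ×_E E^→ ⥤ E^→`, which sends a cospan `(g, h)` to the pullback
`h^* g` of `g` along `h`. An object of this comma category is an arrow `g` together with
an object `X` and an arrow `h` from `X` to the codomain of `g`. -/
noncomputable def cospanPullback (E : Type u) [Category.{v} E] [HasPullbacks E] :
    Comma (𝟭 E) (Arrow.rightFunc : Arrow E ⥤ E) ⥤ Arrow E where
  obj c := Arrow.mk (pullback.snd c.right.hom (show c.left ⟶ c.right.right from c.hom))
  map m := Arrow.homMk (pullback.map _ _ _ _ m.right.left m.left m.right.right
      (Arrow.w m.right).symm m.w.symm) m.left (pullback.lift_snd _ _ _)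
  map_id c := by
    apply Arrow.hom_ext
    · apply pullback.hom_ext
      · refine (pullback.lift_fst _ _ _).trans (Eq.trans ?_ (Category.id_comp _).symm)
        exact Category.comp_id _
      · refine (pullback.lift_snd _ _ _).trans (Eq.trans ?_ (Category.id_comp _).symm)
        exact Category.comp_id _
    · rfl
  map_comp m n := by
    apply Arrow.hom_ext
    · apply pullback.hom_ext
      · refine (pullback.lift_fst _ _ _).trans (Eq.trans ?_ (Category.assoc _ _ _).symm)
        refine Eq.trans ?_ (congrArg (fun z => _ ≫ z) (pullback.lift_fst _ _ _)).symm
        refine Eq.trans ?_ (pullback.lift_fst_assoc _ _ _ _).symm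
        exact (Category.assoc _ _ _).symm
      · refine (pullback.lift_snd _ _ _).trans (Eq.trans ?_ (Category.assoc _ _ _).symm)
        refine Eq.trans ?_ (congrArg (fun z => _ ≫ z) (pullback.lift_snd _ _ _)).symm
        refine Eq.trans ?_ (pullback.lift_snd_assoc _ _ _ _).symm
        exact (Category.assoc _ _ _).symm
    · rfl

/-- An algebraic weak factorization system, with category of uniform cofibrations the coalgebras
for its copointed endofunctor, is suitable with respect to a functorial cylinder if
it is cofibrantly generated (by a small category of arrows), and if the functors `X ↦ (⊥ ⟶ X)`,
pullback of uniform cofibrations along arbitrary maps, and the Leibniz product with each of the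
endpoint inclusions lift to the category of uniform cofibrations. -/
structure AWFS.Suitable {E : Type u} [Category.{v} E] [HasPullbacks E] [HasPushouts E]
    [HasInitial E] (W : AWFS E) (cyl : FunctorialCylinder E) : Prop where
  cofibrantlyGenerated : ∃ (J : Type w) (_ : SmallCategory J) (U : J ⥤ Arrow E),
    W.IsAlgebraicallyFreeOn U
  initial : Nonempty (Lift (𝟭 E) (AWFS.LeftMap.forget W) (initialArrow E))
  pullback : Nonempty (Lift (Comma.preRight (𝟭 E) (AWFS.LeftMap.forget W) Arrow.rightFunc)
    (AWFS.LeftMap.forget W) (cospanPullback E))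
  leibniz (k : Fin 2) : Nonempty (Lift (AWFS.LeftMap.forget W) (AWFS.LeftMap.forget W)
    (leibniz (cyl.δ k)))

end AWFS

/-! ### Simplicial sets and cubical sets -/

section Monomorphisms

/-- A monomorphism whose codomain satisfies `P`. -/
structure CartMono (E : Type u) [Category.{v} E] (P : ObjectProperty E) where
  /-- the underlying arrow -/
  arrow : Arrow E
  mono : Mono arrow.hom
  cod : P arrow.right

namespace CartMono

variable {E : Type u} [Category.{v} E] {P : ObjectProperty E}

/-- A morphism between monomorphisms: a pullback square. -/
@[ext]
structure Hom (f g : CartMono E P) where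
  /-- the underlying square -/
  sq : f.arrow ⟶ g.arrow
  isPullback : IsPullback sq.left f.arrow.hom g.arrow.hom sq.right

instance : Category (CartMono E P) where
  Hom := Hom
  id f := ⟨𝟙 _, IsPullback.of_horiz_isIso ⟨by simp⟩⟩
  comp a b := ⟨a.sq ≫ b.sq, a.isPullback.paste_horiz b.isPullback⟩
  id_comp _ := by ext1; exact Category.id_comp _
  comp_id _ := by ext1; exact Category.comp_id _
  assoc _ _ _ := by ext1; exact Category.assoc _ _ _

variable (E P) in
/-- The inclusion into the arrow category. -/
def forget : CartMono E P ⥤ Arrow E where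
  obj f := f.arrow
  map a := a.sq
  map_id _ := rfl
  map_comp _ _ := rfl

end CartMono

/-- The functorial cylinder `I × (-)` given by an object `I` with two points. -/
def intervalCylinder {E : Type u} [Category.{v} E] [CartesianMonoidalCategory E] (I : E)
    (δ : Fin 2 → (𝟙_ E ⟶ I)) : FunctorialCylinder E where
  I := tensorLeft I
  δ k := { app X := (λ_ X).inv ≫ δ k ▷ X }

end Monomorphisms

section SSet

open Simplicial

/-- The functorial cylinder `Δ[1] × (-)` on simplicial sets, with endpoint inclusions given by
the two vertices of `Δ[1]`. -/
noncomputable def ssetCylinder : FunctorialCylinder SSet.{w} :=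
  intervalCylinder Δ[1] fun k => SSet.const (SSet.stdSimplex.obj₀Equiv.symm k)

/-- The generating uniform cofibrations of simplicial sets: monomorphisms with a representable
codomain, and pullback squares. -/
def ssetCofGen : CartMono SSet.{w} (fun B => ∃ n : ℕ, Nonempty (B ≅ Δ[n])) ⥤ Arrow SSet.{w} :=
  CartMono.forget _ _

instance : LocallyCartesianClosed SSet.{w} where
  isLeftAdjoint_pullback f := PresheafPushforward.isLeftAdjoint_pullback.{w} f

end SSet

section CSet

/-- Terms in the language of de Morgan algebras, with variables in `A`. -/
inductive DMTerm (A : Type) : Type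
  | var (a : A)
  | top
  | bot
  | inf (x y : DMTerm A)
  | sup (x y : DMTerm A)
  | neg (x : DMTerm A)

/-- Provable equality of terms: the smallest congruence containing the equations of de Morgan
algebras, that is, of bounded distributive lattices with an involution satisfying de Morgan's
laws. -/
inductive DMRel {A : Type} : DMTerm A → DMTerm A → Prop
  | refl (x) : DMRel x x
  | symm {x y} : DMRel x y → DMRel y x
  | trans {x y z} : DMRel x y → DMRel y z → DMRel x z
  | inf_congr {x x' y y'} : DMRel x x' → DMRel y y' → DMRel (.inf x y) (.inf x' y')
  | sup_congr {x x' y y'} : DMRel x x' → DMRel y y' → DMRel (.sup x y) (.sup x' y')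
  | neg_congr {x x'} : DMRel x x' → DMRel (.neg x) (.neg x')
  | inf_comm (x y) : DMRel (.inf x y) (.inf y x)
  | sup_comm (x y) : DMRel (.sup x y) (.sup y x)
  | inf_assoc (x y z) : DMRel (.inf (.inf x y) z) (.inf x (.inf y z))
  | sup_assoc (x y z) : DMRel (.sup (.sup x y) z) (.sup x (.sup y z))
  | inf_sup_self (x y) : DMRel (.inf x (.sup x y)) x
  | sup_inf_self (x y) : DMRel (.sup x (.inf x y)) x
  | inf_sup_left (x y z) : DMRel (.inf x (.sup y z)) (.sup (.inf x y) (.inf x z))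
  | inf_top (x) : DMRel (.inf x .top) x
  | sup_bot (x) : DMRel (.sup x .bot) x
  | neg_neg (x) : DMRel (.neg (.neg x)) x
  | neg_inf (x y) : DMRel (.neg (.inf x y)) (.sup (.neg x) (.neg y))
  | neg_sup (x y) : DMRel (.neg (.sup x y)) (.inf (.neg x) (.neg y))

/-- The free de Morgan algebra on `A`. -/
def FreeDeMorgan (A : Type) : Type := Quot (DMRel (A := A))

/-- Substitution of terms for variables. -/
def DMTerm.subst {A B : Type} (f : A → DMTerm B) : DMTerm A → DMTerm B
  | .var a => f a
  | .top => .top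
  | .bot => .bot
  | .inf x y => .inf (x.subst f) (y.subst f)
  | .sup x y => .sup (x.subst f) (y.subst f)
  | .neg x => .neg (x.subst f)

lemma DMRel.subst {A B : Type} (f : A → DMTerm B) {x y : DMTerm A} (h : DMRel x y) :
    DMRel (x.subst f) (y.subst f) := by
  induction h with
  | refl x => exact .refl _
  | symm _ ih => exact ih.symm
  | trans _ _ ih ih' => exact ih.trans ih'
  | inf_congr _ _ ih ih' => exact .inf_congr ih ih'
  | sup_congr _ _ ih ih' => exact .sup_congr ih ih'
  | neg_congr _ ih => exact .neg_congr ih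
  | inf_comm => exact .inf_comm ..
  | sup_comm => exact .sup_comm ..
  | inf_assoc => exact .inf_assoc ..
  | sup_assoc => exact .sup_assoc ..
  | inf_sup_self => exact .inf_sup_self ..
  | sup_inf_self => exact .sup_inf_self ..
  | inf_sup_left => exact .inf_sup_left ..
  | inf_top => exact .inf_top ..
  | sup_bot => exact .sup_bot ..
  | neg_neg => exact .neg_neg ..
  | neg_inf => exact .neg_inf ..
  | neg_sup => exact .neg_sup ..

namespace FreeDeMorgan

variable {A B C : Type}

/-- The generators of the free de Morgan algebra. -/
def var (a : A) : FreeDeMorgan A := Quot.mk _ (.var a)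

instance : Top (FreeDeMorgan A) := ⟨Quot.mk _ .top⟩

instance : Bot (FreeDeMorgan A) := ⟨Quot.mk _ .bot⟩

instance : Min (FreeDeMorgan A) := ⟨Quot.map₂ .inf (fun _ _ _ h => .inf_congr (.refl _) h)
  (fun _ _ _ h => .inf_congr h (.refl _))⟩

instance : Max (FreeDeMorgan A) := ⟨Quot.map₂ .sup (fun _ _ _ h => .sup_congr (.refl _) h)
  (fun _ _ _ h => .sup_congr h (.refl _))⟩

instance : Compl (FreeDeMorgan A) := ⟨Quot.map .neg fun _ _ h => .neg_congr h⟩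

/-- The evaluation of a term in a free de Morgan algebra. -/
def interp (f : A → FreeDeMorgan B) : DMTerm A → FreeDeMorgan B
  | .var a => f a
  | .top => ⊤
  | .bot => ⊥
  | .inf x y => interp f x ⊓ interp f y
  | .sup x y => interp f x ⊔ interp f y
  | .neg x => (interp f x)ᶜ

lemma interp_eq (f : A → DMTerm B) (x : DMTerm A) :
    interp (fun a => Quot.mk _ (f a)) x = Quot.mk _ (x.subst f) := by
  induction x with
  | var a => rfl
  | top => rfl
  | bot => rfl
  | inf x y hx hy => simp only [interp, hx, hy]; rfl
  | sup x y hx hy => simp only [interp, hx, hy]; rfl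
  | neg x hx => simp only [interp, hx]; rfl

lemma interp_congr (f : A → FreeDeMorgan B) {x y : DMTerm A} (h : DMRel x y) :
    interp f x = interp f y := by
  obtain ⟨g, rfl⟩ : ∃ g : A → DMTerm B, f = fun a => Quot.mk _ (g a) :=
    ⟨fun a => (f a).out, funext fun a => (Quot.out_eq (f a)).symm⟩
  rw [interp_eq, interp_eq]
  exact Quot.sound (h.subst g)

/-- The homomorphism of de Morgan algebras that extends a map on generators. -/
def lift (f : A → FreeDeMorgan B) : FreeDeMorgan A → FreeDeMorgan B :=
  Quot.lift (interp f) fun _ _ h => interp_congr f h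

lemma lift_var (x : FreeDeMorgan A) : lift var x = x := by
  obtain ⟨x, rfl⟩ := Quot.exists_rep x
  refine (interp_eq DMTerm.var x).trans (congrArg _ ?_)
  induction x with
  | var a => rfl
  | top => rfl
  | bot => rfl
  | inf x y hx hy => simp only [DMTerm.subst, hx, hy]
  | sup x y hx hy => simp only [DMTerm.subst, hx, hy]
  | neg x hx => simp only [DMTerm.subst, hx]

lemma lift_inf (f : A → FreeDeMorgan B) (x y : FreeDeMorgan A) :
    lift f (x ⊓ y) = lift f x ⊓ lift f y := by
  obtain ⟨x, rfl⟩ := Quot.exists_rep x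
  obtain ⟨y, rfl⟩ := Quot.exists_rep y
  rfl

lemma lift_sup (f : A → FreeDeMorgan B) (x y : FreeDeMorgan A) :
    lift f (x ⊔ y) = lift f x ⊔ lift f y := by
  obtain ⟨x, rfl⟩ := Quot.exists_rep x
  obtain ⟨y, rfl⟩ := Quot.exists_rep y
  rfl

lemma lift_compl (f : A → FreeDeMorgan B) (x : FreeDeMorgan A) :
    lift f xᶜ = (lift f x)ᶜ := by
  obtain ⟨x, rfl⟩ := Quot.exists_rep x
  rfl

lemma lift_lift (f : A → FreeDeMorgan B) (g : B → FreeDeMorgan C) (x : FreeDeMorgan A) :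
    lift g (lift f x) = lift (fun a => lift g (f a)) x := by
  obtain ⟨x, rfl⟩ := Quot.exists_rep x
  change lift g (interp f x) = interp _ x
  induction x with
  | var a => rfl
  | top => rfl
  | bot => rfl
  | inf x y hx hy => simp only [interp, lift_inf, hx, hy]
  | sup x y hx hy => simp only [interp, lift_sup, hx, hy]
  | neg x hx => simp only [interp, lift_compl, hx]

end FreeDeMorgan

/-- The category of cubes (in its skeletal form): objects are the natural numbers `n`, standing for
the cube on a set of `n` elements. -/
structure Box : Type where
  /-- the dimension -/
  dim : ℕ

/-- The cube category: a morphism from the `m`-cube to the `n`-cube is a function from `Fin n` to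
the free de Morgan algebra on `Fin m`, and composition is substitution. -/
instance : SmallCategory Box where
  Hom m n := Fin n.dim → FreeDeMorgan (Fin m.dim)
  id _ := FreeDeMorgan.var
  comp f g := fun i => FreeDeMorgan.lift f (g i)
  id_comp g := funext fun i => FreeDeMorgan.lift_var (g i)
  comp_id _ := rfl
  assoc f g h := funext fun i => (FreeDeMorgan.lift_lift g f (h i)).symm

/-- The category of cubical sets. -/
abbrev CSet : Type (w + 1) := Boxᵒᵖ ⥤ Type w

/-- The representable cubical set on the `n`-cube. -/
def cube (n : ℕ) : CSet.{w} := uliftYoneda.{w}.obj ⟨n⟩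

/-- The endpoint of the interval given by an element `e n` of the free de Morgan algebras on `n`
generators that is preserved by substitution. -/
def endpoint (e : ∀ n : Box, FreeDeMorgan (Fin n.dim))
    (h : ∀ (m n : Box) (f : Fin n.dim → FreeDeMorgan (Fin m.dim)),
      FreeDeMorgan.lift f (e n) = e m) :
    𝟙_ CSet.{w} ⟶ cube 1 where
  app n := TypeCat.ofHom fun _ => ULift.up fun _ => e n.unop
  naturality m n f := by
    refine ConcreteCategory.hom_ext _ _ fun _ => ?_
    apply ULift.ext
    funext _
    exact (h n.unop m.unop f.unop).symm

/-- The functorial cylinder `□¹ × (-)` on cubical sets; the left and right endpoint inclusions are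
given by the bottom and top elements of the free de Morgan algebras. -/
def csetCylinder : FunctorialCylinder CSet.{w} :=
  intervalCylinder (cube 1)
    ![endpoint (fun _ => ⊥) (fun _ _ _ => rfl), endpoint (fun _ => ⊤) (fun _ _ _ => rfl)]

/-- The generating uniform cofibrations of cubical sets: monomorphisms with a representable
codomain, and pullback squares. -/
def csetCofGen : CartMono CSet.{w} (fun B => ∃ n : ℕ, Nonempty (B ≅ cube n)) ⥤ Arrow CSet.{w} :=
  CartMono.forget _ _

instance : LocallyCartesianClosed CSet.{w} where
  isLeftAdjoint_pullback f := PresheafPushforward.isLeftAdjoint_pullback.{w} f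

end CSet

end UniformFibrations

/-! By the adjunction p^* ⊣ p_*, filling a square from a generator u to p_* f amounts to filling the
transposed square from p^* u to f. So pushforward along a fibration p preserves fibrations once
pullbacks of generating trivial cofibrations along fibrations lift against fibrations: the Frobenius
property. What has to be added algebraically is naturality of these fillers in p, in the generator
and in f, recorded in `FrobeniusFilling`. Naturality in the generator makes p_* f a right map,
naturality in f makes pushforward a functor on right maps, and naturality in p makes the
Beck–Chevalley map compatible with fillers (`fill_beckChevalleySquare`). For a pullback square the
Beck–Chevalley map is the mate of an isomorphism, and isomorphisms lift to right maps.

The Frobenius property holds because generators are strong homotopy equivalences. For i : A ⟶ B the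
connection cᵏ is constant at the end k and the identity at the end 1 - k, so it induces a square
from δᵏ ⊗̂ (δᵏ ⊗̂ i) to δᵏ ⊗̂ i with a section given by the opposite endpoint (`retraction`). Let a
be the pullback of δᵏ ⊗̂ i along a fibration p. The homotopy on the codomain lifts along p, with the
identity as its start, because p lifts against δ¹⁻ᵏ ⊗̂ (0 ⟶ X), which is an endpoint inclusion. On
the domain the homotopy is then forced, since a is a pullback of the generator. Hence a is a retract
of δᵏ ⊗̂ a (`frobeniusRetraction`). As a is a cofibration, δᵏ ⊗̂ a lifts against fibrations, and
therefore so does a. Every choice made is canonical, which gives the naturality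
(`frobeniusFill_comp`).

Two families of fillers feed this argument: right `U`-maps must lift naturally against the arrows 0
⟶ X and against the pullbacks of the arrows δᵏ ⊗̂ U j. The Leibniz adjunction turns them into
fillers of fibrations against the products of these arrows with δᵏ (`UniformFilling.ofLeibniz`). For
a suitable awfs, right `U`-maps are algebras and so lift against coalgebras (`fillingOfAlgebras`);
the generators are coalgebras because free algebras are right maps (`leftMapOfAlgebras`), and
suitability makes the other arrows coalgebras. For simplicial and cubical sets, fillers against all
monomorphisms are glued by the Yoneda lemma from fillers against base changes to representables
(`CartMono.filling`). Leibniz products with an endpoint preserve monomorphisms and the pullback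
squares between them, and the connections are meet and join on the interval. -/

namespace UniformFibrations

/-! ### The Leibniz product with a point of an endofunctor -/

section Point

variable {E : Type u} [Category.{v} E] {I : E ⥤ E} (δ : 𝟭 E ⟶ I)

/-- A component of a point of an endofunctor, with source in reduced form. -/
def point (X : E) : X ⟶ I.obj X := δ.app X

lemma point_naturality {X Y : E} (f : X ⟶ Y) : f ≫ point δ Y = point δ X ≫ I.map f :=
  δ.naturality f

end Point

namespace leibniz

variable {E : Type u} [Category.{v} E] [HasPushouts E] {I : E ⥤ E} (δ : 𝟭 E ⟶ I)

/-- The domain of the Leibniz product. -/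
noncomputable def dom (f : Arrow E) : E := ((leibniz δ).obj f).left

/-- The Leibniz product as a map. -/
noncomputable def hom (f : Arrow E) : dom δ f ⟶ I.obj f.right := ((leibniz δ).obj f).hom

/-- The first leg of the pushout that is the domain of the Leibniz product. -/
noncomputable def inl (f : Arrow E) : I.obj f.left ⟶ dom δ f := pushout.inl _ _

/-- The second leg of the pushout that is the domain of the Leibniz product. -/
noncomputable def inr (f : Arrow E) : f.right ⟶ dom δ f := pushout.inr _ _

lemma isPushout (f : Arrow E) : IsPushout (point δ f.left) f.hom (inl δ f) (inr δ f) :=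
  IsPushout.of_hasPushout _ _

variable {δ}

lemma hom_ext {f : Arrow E} {Z : E} {a b : dom δ f ⟶ Z}
    (h₁ : inl δ f ≫ a = inl δ f ≫ b) (h₂ : inr δ f ≫ a = inr δ f ≫ b) : a = b :=
  (isPushout δ f).hom_ext h₁ h₂

lemma condition (f : Arrow E) : point δ f.left ≫ inl δ f = f.hom ≫ inr δ f :=
  (isPushout δ f).w

lemma condition_assoc (f : Arrow E) {Z : E} (h : dom δ f ⟶ Z) :
    point δ f.left ≫ inl δ f ≫ h = f.hom ≫ inr δ f ≫ h := by
  rw [← Category.assoc, condition, Category.assoc]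

/-- The map out of the domain of a Leibniz product given by two compatible maps. -/
noncomputable def desc {f : Arrow E} {Z : E} (a : I.obj f.left ⟶ Z) (b : f.right ⟶ Z)
    (h : point δ f.left ≫ a = f.hom ≫ b) : dom δ f ⟶ Z :=
  (isPushout δ f).desc a b h

@[simp]
lemma inl_desc {f : Arrow E} {Z : E} (a : I.obj f.left ⟶ Z) (b : f.right ⟶ Z)
    (h : point δ f.left ≫ a = f.hom ≫ b) : inl δ f ≫ desc a b h = a :=
  (isPushout δ f).inl_desc _ _ _

@[simp]
lemma inl_desc_assoc {f : Arrow E} {Z : E} (a : I.obj f.left ⟶ Z) (b : f.right ⟶ Z)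
    (h : point δ f.left ≫ a = f.hom ≫ b) {Z' : E} (k : Z ⟶ Z') :
    inl δ f ≫ desc a b h ≫ k = a ≫ k := by
  rw [← Category.assoc, inl_desc]

@[simp]
lemma inr_desc {f : Arrow E} {Z : E} (a : I.obj f.left ⟶ Z) (b : f.right ⟶ Z)
    (h : point δ f.left ≫ a = f.hom ≫ b) : inr δ f ≫ desc a b h = b :=
  (isPushout δ f).inr_desc _ _ _

@[simp]
lemma inr_desc_assoc {f : Arrow E} {Z : E} (a : I.obj f.left ⟶ Z) (b : f.right ⟶ Z)
    (h : point δ f.left ≫ a = f.hom ≫ b) {Z' : E} (k : Z ⟶ Z') :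
    inr δ f ≫ desc a b h ≫ k = b ≫ k := by
  rw [← Category.assoc, inr_desc]

@[simp]
lemma inl_hom (f : Arrow E) : inl δ f ≫ hom δ f = I.map f.hom :=
  pushout.inl_desc _ _ _

@[simp]
lemma inl_hom_assoc (f : Arrow E) {Z : E} (k : I.obj f.right ⟶ Z) :
    inl δ f ≫ hom δ f ≫ k = I.map f.hom ≫ k := by
  rw [← Category.assoc, inl_hom]

@[simp]
lemma inr_hom (f : Arrow E) : inr δ f ≫ hom δ f = point δ f.right :=
  pushout.inr_desc _ _ _

@[simp]
lemma inr_hom_assoc (f : Arrow E) {Z : E} (k : I.obj f.right ⟶ Z) :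
    inr δ f ≫ hom δ f ≫ k = point δ f.right ≫ k := by
  rw [← Category.assoc, inr_hom]

variable (δ) in
/-- The action of the Leibniz product on squares, on domains. -/
noncomputable def domMap {f g : Arrow E} (m : f ⟶ g) : dom δ f ⟶ dom δ g :=
  ((leibniz δ).map m).left

@[simp]
lemma inl_domMap {f g : Arrow E} (m : f ⟶ g) :
    inl δ f ≫ domMap δ m = I.map m.left ≫ inl δ g :=
  pushout.inl_desc _ _ _

@[simp]
lemma inl_domMap_assoc {f g : Arrow E} (m : f ⟶ g) {Z : E} (k : dom δ g ⟶ Z) :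
    inl δ f ≫ domMap δ m ≫ k = I.map m.left ≫ inl δ g ≫ k := by
  rw [← Category.assoc, inl_domMap, Category.assoc]

@[simp]
lemma inr_domMap {f g : Arrow E} (m : f ⟶ g) :
    inr δ f ≫ domMap δ m = m.right ≫ inr δ g :=
  pushout.inr_desc _ _ _

@[simp]
lemma inr_domMap_assoc {f g : Arrow E} (m : f ⟶ g) {Z : E} (k : dom δ g ⟶ Z) :
    inr δ f ≫ domMap δ m ≫ k = m.right ≫ inr δ g ≫ k := by
  rw [← Category.assoc, inr_domMap, Category.assoc]

/-- The left side of a square out of a Leibniz product. -/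
noncomputable def sqLeft {f g : Arrow E} (m : (leibniz δ).obj f ⟶ g) : dom δ f ⟶ g.left := m.left

/-- The right side of a square out of a Leibniz product. -/
noncomputable def sqRight {f g : Arrow E} (m : (leibniz δ).obj f ⟶ g) :
    I.obj f.right ⟶ g.right := m.right

lemma sq_w {f g : Arrow E} (m : (leibniz δ).obj f ⟶ g) :
    sqLeft m ≫ g.hom = hom δ f ≫ sqRight m := Arrow.w m

/-- The square out of a Leibniz product with given sides. -/
noncomputable def sqMk {f g : Arrow E} (a : dom δ f ⟶ g.left) (b : I.obj f.right ⟶ g.right)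
    (h : a ≫ g.hom = hom δ f ≫ b) : (leibniz δ).obj f ⟶ g := Arrow.homMk a b h

lemma sq_ext {f g : Arrow E} {m m' : (leibniz δ).obj f ⟶ g}
    (h₁ : inl δ f ≫ sqLeft m = inl δ f ≫ sqLeft m') (h₂ : inr δ f ≫ sqLeft m = inr δ f ≫ sqLeft m')
    (h₃ : sqRight m = sqRight m') : m = m' :=
  Arrow.hom_ext _ _ (hom_ext h₁ h₂) h₃

@[simp]
lemma sqLeft_comp {f g g' : Arrow E} (m : (leibniz δ).obj f ⟶ g) (n : g ⟶ g') :
    sqLeft (m ≫ n) = sqLeft m ≫ n.left := rfl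

@[simp]
lemma sqRight_comp {f g g' : Arrow E} (m : (leibniz δ).obj f ⟶ g) (n : g ⟶ g') :
    sqRight (m ≫ n) = sqRight m ≫ n.right := rfl

@[simp]
lemma sqLeft_map_comp {f f' g : Arrow E} (σ : f ⟶ f') (m : (leibniz δ).obj f' ⟶ g) :
    sqLeft ((leibniz δ).map σ ≫ m) = domMap δ σ ≫ sqLeft m := rfl

@[simp]
lemma sqRight_map_comp {f f' g : Arrow E} (σ : f ⟶ f') (m : (leibniz δ).obj f' ⟶ g) :
    sqRight ((leibniz δ).map σ ≫ m) = I.map σ.right ≫ sqRight m := rfl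

end leibniz

/-! ### Natural fillers -/

section Fillings

variable {E : Type u} [Category.{v} E] {J : Type u₁} [Category.{v₁} J]
  {C : Type u₂} [Category.{v₂} C]

/-- A choice of fillers for all squares from an arrow `V c` to a right `U`-map, natural both in
the right map and in `c`. -/
structure UniformFilling (U : J ⥤ Arrow E) (V : C ⥤ Arrow E) where
  /-- the chosen filler -/
  fill (g : RightMap U) (c : C) (sq : V.obj c ⟶ g.arrow) : (V.obj c).right ⟶ g.arrow.left
  fac_left (g : RightMap U) (c : C) (sq : V.obj c ⟶ g.arrow) :
    (V.obj c).hom ≫ fill g c sq = sq.left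
  fac_right (g : RightMap U) (c : C) (sq : V.obj c ⟶ g.arrow) :
    fill g c sq ≫ g.arrow.hom = sq.right
  natural {g g' : RightMap U} (n : g ⟶ g') {c c' : C} (σ : c ⟶ c') (sq : V.obj c ⟶ g.arrow)
    (sq' : V.obj c' ⟶ g'.arrow) (h : sq ≫ n.sq = V.map σ ≫ sq') :
    fill g c sq ≫ n.sq.left = (V.map σ).right ≫ fill g' c' sq'

/-- Merges naturality in the right map and naturality in the generator into the one form that
`UniformFilling` asks for. -/
lemma RightMap.Hom.fill_comp {U : J ⥤ Arrow E} {g g' : RightMap U} (n : g ⟶ g') {j j' : J}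
    (σ : j ⟶ j') (sq : U.obj j ⟶ g.arrow) (sq' : U.obj j' ⟶ g'.arrow)
    (h : sq ≫ n.sq = U.map σ ≫ sq') :
    g.fill j sq ≫ n.sq.left = (U.map σ).right ≫ g'.fill j' sq' := by
  rw [n.comm, h, g'.natural]

namespace UniformFilling

variable {U : J ⥤ Arrow E} {V : C ⥤ Arrow E}

/-- Restriction of fillers along a functor into the category of left maps. -/
def precomp (F : UniformFilling U V) {D : Type u₃} [Category.{v₃} D] {V' : D ⥤ Arrow E}
    (K : D ⥤ C) (e : V' ≅ K ⋙ V) : UniformFilling U V' where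
  fill g d sq := (show V'.obj d ⟶ V.obj (K.obj d) from e.hom.app d).right ≫
    F.fill g (K.obj d) (e.inv.app d ≫ sq)
  fac_left g d sq := by
    have h₁ := Arrow.w (show V'.obj d ⟶ V.obj (K.obj d) from e.hom.app d)
    have h₂ := F.fac_left g (K.obj d) (e.inv.app d ≫ sq)
    have h₃ := congrArg (fun z => z.left) (e.hom_inv_id_app_assoc d sq)
    rw [← reassoc_of% h₁, h₂]
    exact h₃
  fac_right g d sq := by
    rw [Category.assoc, F.fac_right]
    exact congrArg (fun z => z.right) (e.hom_inv_id_app_assoc d sq)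
  natural {g g'} n {d d'} σ sq sq' h := by
    have hr := congrArg (fun z => z.right) (e.hom.naturality σ)
    have hi : e.inv.app d ≫ V'.map σ = V.map (K.map σ) ≫ e.inv.app d' :=
      (e.inv.naturality σ).symm
    rw [Category.assoc, F.natural n (K.map σ) (e.inv.app d ≫ sq) (e.inv.app d' ≫ sq')]
    · rw [← Category.assoc, ← Category.assoc]
      exact congrArg (fun z => z ≫ _) hr.symm
    · rw [Category.assoc, h, reassoc_of% hi]

/-- Restriction of fillers along a functor between categories of generating arrows. -/
def restrict {J' : Type u₃} [Category.{v₃} J'] {U' : J' ⥤ Arrow E} (K : J ⥤ J')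
    (F : UniformFilling (K ⋙ U') V) : UniformFilling U' V where
  fill g := F.fill ⟨g.arrow, fun j => g.fill (K.obj j), fun _ => g.fac_left _,
    fun _ => g.fac_right _, fun σ => g.natural (K.map σ)⟩
  fac_left _ := F.fac_left ⟨_, _, _, _, _⟩
  fac_right _ := F.fac_right ⟨_, _, _, _, _⟩
  natural n _ _ σ sq sq' h := F.natural (g := ⟨_, _, _, _, _⟩) (g' := ⟨_, _, _, _, _⟩)
    ⟨n.sq, fun j t => n.comm (K.obj j) t⟩ σ sq sq' h

end UniformFilling

end Fillings

/-! ### Transposition of fillers along the Leibniz product -/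

section Copoint

variable {E : Type u} [Category.{v} E] {I R : E ⥤ E} (adj : I ⊣ R) (δ : 𝟭 E ⟶ I)

/-- The copoint of the right adjoint that corresponds to a point of an endofunctor. -/
def copoint (X : E) : R.obj X ⟶ X := point δ (R.obj X) ≫ adj.counit.app X

/-- The copoint evaluates a path at an endpoint; under the adjunction this is restriction of a
homotopy along the endpoint inclusion. -/
lemma homEquiv_copoint {X Y : E} (f : I.obj X ⟶ Y) :
    adj.homEquiv _ _ f ≫ copoint adj δ Y = point δ X ≫ f := by
  have h := point_naturality δ (adj.homEquiv _ _ f)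
  rw [copoint, reassoc_of% h]
  refine congrArg (fun z => _ ≫ z) ?_
  exact (adj.homEquiv_counit _ _ _).symm.trans (Equiv.symm_apply_apply _ _)

lemma comp_copoint {X Y : E} (f : X ⟶ R.obj Y) :
    f ≫ copoint adj δ Y = point δ X ≫ (adj.homEquiv _ _).symm f := by
  rw [← homEquiv_copoint adj δ, Equiv.apply_symm_apply]

lemma copoint_naturality {X Y : E} (f : X ⟶ Y) :
    R.map f ≫ copoint adj δ Y = copoint adj δ X ≫ f := by
  have h := point_naturality δ (R.map f)
  rw [copoint, copoint, reassoc_of% h, Category.assoc]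
  exact congrArg (fun z => _ ≫ z) (adj.counit_naturality f)

end Copoint

namespace leibniz

variable {E : Type u} [Category.{v} E] [HasPullbacks E] {I R : E ⥤ E} (adj : I ⊣ R) (δ : 𝟭 E ⟶ I)

/-- The Leibniz cotensor `R A ⟶ R B ×_B A` of an arrow `A ⟶ B`. -/
noncomputable def cotensor (g : Arrow E) : R.obj g.left ⟶ pullback (copoint adj δ g.right) g.hom :=
  pullback.lift (R.map g.hom) (copoint adj δ g.left) (copoint_naturality adj δ g.hom)

lemma cotensor_fst (g : Arrow E) : cotensor adj δ g ≫ pullback.fst _ _ = R.map g.hom :=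
  pullback.lift_fst _ _ _

lemma cotensor_snd (g : Arrow E) : cotensor adj δ g ≫ pullback.snd _ _ = copoint adj δ g.left :=
  pullback.lift_snd _ _ _

/-- The action of the Leibniz cotensor on squares, on codomains. -/
noncomputable def cotensorCodMap {g g' : Arrow E} (n : g ⟶ g') :
    pullback (copoint adj δ g.right) g.hom ⟶ pullback (copoint adj δ g'.right) g'.hom :=
  pullback.map _ _ _ _ (R.map n.right) n.left n.right
    (copoint_naturality adj δ n.right).symm (Arrow.w n).symm

lemma cotensorCodMap_fst {g g' : Arrow E} (n : g ⟶ g') :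
    cotensorCodMap adj δ n ≫ pullback.fst _ _ = pullback.fst _ _ ≫ R.map n.right :=
  pullback.lift_fst _ _ _

lemma cotensorCodMap_snd {g g' : Arrow E} (n : g ⟶ g') :
    cotensorCodMap adj δ n ≫ pullback.snd _ _ = pullback.snd _ _ ≫ n.left :=
  pullback.lift_snd _ _ _

/-- The action of the Leibniz cotensor on squares. -/
noncomputable def cotensorMap {g g' : Arrow E} (n : g ⟶ g') :
    Arrow.mk (cotensor adj δ g) ⟶ Arrow.mk (cotensor adj δ g') :=
  Arrow.homMk' (R.map n.left) (cotensorCodMap adj δ n) (by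
      apply pullback.hom_ext
      · rw [Category.assoc, Category.assoc, cotensor_fst, cotensorCodMap_fst, ← Category.assoc,
          cotensor_fst, ← Functor.map_comp, ← Functor.map_comp, Arrow.w]
      · rw [Category.assoc, Category.assoc, cotensor_snd, cotensorCodMap_snd, ← Category.assoc,
          cotensor_snd, copoint_naturality])

variable {adj δ}

lemma cotensor_sq_fst {x g : Arrow E} (sq : x ⟶ Arrow.mk (cotensor adj δ g)) :
    sq.left ≫ R.map g.hom = x.hom ≫ sq.right ≫ pullback.fst _ _ := by
  have h : sq.left ≫ cotensor adj δ g = x.hom ≫ sq.right := Arrow.w sq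
  rw [← Category.assoc]
  refine Eq.trans ?_ (congrArg (fun z => z ≫ pullback.fst _ _) h)
  rw [Category.assoc, cotensor_fst]

lemma cotensor_sq_snd {x g : Arrow E} (sq : x ⟶ Arrow.mk (cotensor adj δ g)) :
    sq.left ≫ copoint adj δ g.left = x.hom ≫ sq.right ≫ pullback.snd _ _ := by
  have h : sq.left ≫ cotensor adj δ g = x.hom ≫ sq.right := Arrow.w sq
  rw [← Category.assoc]
  refine Eq.trans ?_ (congrArg (fun z => z ≫ pullback.snd _ _) h)
  rw [Category.assoc, cotensor_snd]

variable [HasPushouts E]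

/-- The transpose of a square into a Leibniz cotensor. -/
noncomputable def ofCotensor {x g : Arrow E} (sq : x ⟶ Arrow.mk (cotensor adj δ g)) :
    (leibniz δ).obj x ⟶ g :=
  sqMk (desc ((adj.homEquiv x.left g.left).symm sq.left) (sq.right ≫ pullback.snd _ _) (by
      rw [← comp_copoint, cotensor_sq_snd]))
    ((adj.homEquiv x.right g.right).symm (sq.right ≫ pullback.fst _ _)) (by
      apply leibniz.hom_ext
      · rw [inl_desc_assoc, inl_hom_assoc, ← adj.homEquiv_naturality_right_symm,
          ← adj.homEquiv_naturality_left_symm, cotensor_sq_fst]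
      · rw [inr_desc_assoc, inr_hom_assoc, ← comp_copoint, Category.assoc, Category.assoc,
          pullback.condition])

lemma inl_sqLeft_ofCotensor {x g : Arrow E} (sq : x ⟶ Arrow.mk (cotensor adj δ g)) :
    inl δ x ≫ sqLeft (ofCotensor sq) = (adj.homEquiv x.left g.left).symm sq.left :=
  inl_desc _ _ _

lemma inr_sqLeft_ofCotensor {x g : Arrow E} (sq : x ⟶ Arrow.mk (cotensor adj δ g)) :
    inr δ x ≫ sqLeft (ofCotensor sq) = sq.right ≫ pullback.snd _ _ :=
  inr_desc _ _ _

lemma sqRight_ofCotensor {x g : Arrow E} (sq : x ⟶ Arrow.mk (cotensor adj δ g)) :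
    sqRight (ofCotensor sq) = (adj.homEquiv x.right g.right).symm (sq.right ≫ pullback.fst _ _) :=
  rfl

/-- Naturality of the Leibniz adjunction in both variables at once, tested on the two legs of the
pushout and on the codomain. -/
lemma ofCotensor_comp {x x' g g' : Arrow E} (σ : x ⟶ x') (n : g ⟶ g')
    (sq : x ⟶ Arrow.mk (cotensor adj δ g)) (sq' : x' ⟶ Arrow.mk (cotensor adj δ g'))
    (h : sq ≫ cotensorMap adj δ n = σ ≫ sq') :
    ofCotensor sq ≫ n = (leibniz δ).map σ ≫ ofCotensor sq' := by
  have hl : sq.left ≫ R.map n.left = σ.left ≫ sq'.left := congrArg (fun z => z.left) h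
  have hr : sq.right ≫ cotensorCodMap adj δ n = σ.right ≫ sq'.right :=
    congrArg (fun z => z.right) h
  apply sq_ext
  · rw [sqLeft_comp, sqLeft_map_comp, inl_domMap_assoc, inl_sqLeft_ofCotensor, ← Category.assoc,
      inl_sqLeft_ofCotensor, ← adj.homEquiv_naturality_left_symm,
      ← adj.homEquiv_naturality_right_symm, hl]
  · rw [sqLeft_comp, sqLeft_map_comp, inr_domMap_assoc, inr_sqLeft_ofCotensor, ← Category.assoc,
      inr_sqLeft_ofCotensor, Category.assoc, ← cotensorCodMap_snd]
    exact (reassoc_of% hr) _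
  · rw [sqRight_comp, sqRight_map_comp, sqRight_ofCotensor, sqRight_ofCotensor,
      ← adj.homEquiv_naturality_left_symm, ← adj.homEquiv_naturality_right_symm, Category.assoc,
      ← cotensorCodMap_fst]
    exact congrArg _ ((reassoc_of% hr) _)

/-- The transpose of a square out of a Leibniz product. -/
noncomputable def toCotensor {x g : Arrow E} (sq : (leibniz δ).obj x ⟶ g) :
    x ⟶ Arrow.mk (cotensor adj δ g) :=
  Arrow.homMk (adj.homEquiv x.left g.left (inl δ x ≫ sqLeft sq))
    (pullback.lift (adj.homEquiv x.right g.right (sqRight sq)) (inr δ x ≫ sqLeft sq) (by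
      rw [homEquiv_copoint, Category.assoc, sq_w, inr_hom_assoc]))
    (by
      apply pullback.hom_ext
      · rw [Category.assoc, Category.assoc, pullback.lift_fst]
        refine (congrArg (fun z => _ ≫ z) (cotensor_fst adj δ g)).trans ?_
        rw [← adj.homEquiv_naturality_right, ← adj.homEquiv_naturality_left, Category.assoc,
          sq_w, inl_hom_assoc]
      · rw [Category.assoc, Category.assoc, pullback.lift_snd]
        refine (congrArg (fun z => _ ≫ z) (cotensor_snd adj δ g)).trans ?_
        rw [homEquiv_copoint, condition_assoc])

lemma toCotensor_comp {x x' g g' : Arrow E} (σ : x ⟶ x') (n : g ⟶ g')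
    (sq : (leibniz δ).obj x ⟶ g) (sq' : (leibniz δ).obj x' ⟶ g')
    (h : sq ≫ n = (leibniz δ).map σ ≫ sq') :
    toCotensor (adj := adj) sq ≫ cotensorMap adj δ n = σ ≫ toCotensor sq' := by
  have hl : sqLeft sq ≫ n.left = domMap δ σ ≫ sqLeft sq' := congrArg (fun z => z.left) h
  have hr : sqRight sq ≫ n.right = I.map σ.right ≫ sqRight sq' := congrArg (fun z => z.right) h
  apply Arrow.hom_ext
  · refine (adj.homEquiv_naturality_right _ _).symm.trans
      (Eq.trans ?_ (adj.homEquiv_naturality_left _ _))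
    rw [Category.assoc, hl, inl_domMap_assoc]
  · apply pullback.hom_ext
    · refine (Category.assoc _ _ _).trans ?_
      refine (congrArg (fun z => _ ≫ z) (cotensorCodMap_fst adj δ n)).trans ?_
      refine (pullback.lift_fst_assoc _ _ _ _).trans ?_
      refine Eq.trans ?_ (Category.assoc _ _ _).symm
      refine Eq.trans ?_ (congrArg (fun z => _ ≫ z) (pullback.lift_fst _ _ _)).symm
      rw [← adj.homEquiv_naturality_right, ← adj.homEquiv_naturality_left, hr]
    · refine (Category.assoc _ _ _).trans ?_
      refine (congrArg (fun z => _ ≫ z) (cotensorCodMap_snd adj δ n)).trans ?_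
      refine (pullback.lift_snd_assoc _ _ _ _).trans ?_
      refine Eq.trans ?_ (Category.assoc _ _ _).symm
      refine Eq.trans ?_ (congrArg (fun z => _ ≫ z) (pullback.lift_snd _ _ _)).symm
      rw [Category.assoc, hl, inr_domMap_assoc]

/-- Only the `inl` leg of the upper triangle enters, since `I.map x.hom` is `inl` followed by the
Leibniz product. -/
lemma homEquiv_fac_left {x g : Arrow E} (sq : x ⟶ Arrow.mk (cotensor adj δ g))
    (k : I.obj x.right ⟶ g.left) (h : hom δ x ≫ k = sqLeft (ofCotensor sq)) :
    x.hom ≫ adj.homEquiv x.right g.left k = sq.left := by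
  rw [← adj.homEquiv_naturality_left, ← inl_hom_assoc (δ := δ), h, inl_sqLeft_ofCotensor,
    Equiv.apply_symm_apply]

/-- The two projections of the pullback see the two remaining conditions on a filler: the lower
triangle and the `inr` leg of the upper one. -/
lemma homEquiv_fac_right {x g : Arrow E} (sq : x ⟶ Arrow.mk (cotensor adj δ g))
    (k : I.obj x.right ⟶ g.left) (h : hom δ x ≫ k = sqLeft (ofCotensor sq))
    (h' : k ≫ g.hom = sqRight (ofCotensor sq)) :
    adj.homEquiv x.right g.left k ≫ cotensor adj δ g = sq.right := by
  apply pullback.hom_ext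
  · rw [Category.assoc, cotensor_fst, ← adj.homEquiv_naturality_right, h', sqRight_ofCotensor,
      Equiv.apply_symm_apply]
  · rw [Category.assoc, cotensor_snd, homEquiv_copoint, ← inr_hom_assoc, h, inr_sqLeft_ofCotensor]

lemma homEquiv_symm_fac_left {x g : Arrow E} (sq : (leibniz δ).obj x ⟶ g)
    (k : x.right ⟶ R.obj g.left) (h : x.hom ≫ k = (toCotensor (adj := adj) sq).left)
    (h' : k ≫ cotensor adj δ g = (toCotensor (adj := adj) sq).right) :
    hom δ x ≫ (adj.homEquiv x.right g.left).symm k = sqLeft sq := by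
  apply leibniz.hom_ext
  · rw [inl_hom_assoc, ← adj.homEquiv_naturality_left_symm, h]
    exact Equiv.symm_apply_apply _ _
  · rw [inr_hom_assoc, ← comp_copoint, ← cotensor_snd, ← Category.assoc, h']
    exact pullback.lift_snd _ _ _

lemma homEquiv_symm_fac_right {x g : Arrow E} (sq : (leibniz δ).obj x ⟶ g)
    (k : x.right ⟶ R.obj g.left)
    (h' : k ≫ cotensor adj δ g = (toCotensor (adj := adj) sq).right) :
    (adj.homEquiv x.right g.left).symm k ≫ g.hom = sqRight sq := by
  rw [← adj.homEquiv_naturality_right_symm, ← cotensor_fst adj δ, ← Category.assoc, h',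
    Equiv.symm_apply_eq]
  exact pullback.lift_fst _ _ _

end leibniz

namespace RightMap

variable {E : Type u} [Category.{v} E] [HasPushouts E] [HasPullbacks E] {I R : E ⥤ E}
  (adj : I ⊣ R) (δ : 𝟭 E ⟶ I) {J : Type u₁} [Category.{v₁} J] {U : J ⥤ Arrow E}

/-- The Leibniz cotensor of a right map. -/
noncomputable def cotensor (g : RightMap (U ⋙ leibniz δ)) : RightMap U where
  arrow := Arrow.mk (leibniz.cotensor adj δ g.arrow)
  fill j sq := adj.homEquiv (U.obj j).right g.arrow.left (g.fill j (leibniz.ofCotensor sq))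
  fac_left j sq := leibniz.homEquiv_fac_left sq _ (g.fac_left j _)
  fac_right j sq := leibniz.homEquiv_fac_right sq _ (g.fac_left j _) (g.fac_right j _)
  natural {i j} σ sq := by
    refine (adj.homEquiv_naturality_left _ _).symm.trans (congrArg _ ?_)
    refine (g.natural σ _).trans (congrArg _ ?_)
    -- Naturality in the generator is the case of the identity of `g`; it remains to see that
    -- `cotensorMap` preserves identities.
    refine (leibniz.ofCotensor_comp (U.map σ) (𝟙 _) (U.map σ ≫ sq) sq ?_).symm.trans
      (Category.comp_id _)
    refine (congrArg (fun z => _ ≫ z) ?_).trans (Category.comp_id _)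
    apply Arrow.hom_ext
    · exact R.map_id _
    · apply pullback.hom_ext
      · refine (leibniz.cotensorCodMap_fst _ _ _).trans (Eq.trans ?_ (Category.id_comp _).symm)
        exact (congrArg (fun z => _ ≫ z) (R.map_id _)).trans (Category.comp_id _)
      · refine (leibniz.cotensorCodMap_snd _ _ _).trans (Eq.trans ?_ (Category.id_comp _).symm)
        exact Category.comp_id _

/-- The Leibniz cotensor of a morphism of right maps. -/
noncomputable def cotensorMap {g g' : RightMap (U ⋙ leibniz δ)} (n : g ⟶ g') :
    g.cotensor adj δ ⟶ g'.cotensor adj δ where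
  sq := leibniz.cotensorMap adj δ n.sq
  comm j t := by
    refine (adj.homEquiv_naturality_right _ _).symm.trans (congrArg _ ?_)
    refine (n.comm j _).trans (congrArg _ ?_)
    refine (leibniz.ofCotensor_comp (𝟙 _) n.sq t (t ≫ leibniz.cotensorMap adj δ n.sq)
      (Category.id_comp _).symm).trans ?_
    exact (congrArg (fun z => z ≫ _) ((UniformFibrations.leibniz δ).map_id _)).trans (Category.id_comp _)

end RightMap

namespace UniformFilling

variable {E : Type u} [Category.{v} E] [HasPushouts E] [HasPullbacks E] {I R : E ⥤ E}
  (adj : I ⊣ R) (δ : 𝟭 E ⟶ I) {J : Type u₁} [Category.{v₁} J] {U : J ⥤ Arrow E}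
  {C : Type u₂} [Category.{v₂} C] {V : C ⥤ Arrow E}

/-- If the right `U`-maps have natural fillers against `V`, then the right maps for the Leibniz
products with `U` have natural fillers against the Leibniz products with `V`. -/
noncomputable def ofLeibniz (F : UniformFilling U V) :
    UniformFilling (U ⋙ leibniz δ) (V ⋙ leibniz δ) where
  fill g c sq := (adj.homEquiv (V.obj c).right g.arrow.left).symm
    (F.fill (g.cotensor adj δ) c (leibniz.toCotensor sq))
  fac_left g c sq := leibniz.homEquiv_symm_fac_left sq _
    (F.fac_left (g.cotensor adj δ) c _) (F.fac_right (g.cotensor adj δ) c _)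
  fac_right g c sq := leibniz.homEquiv_symm_fac_right sq _ (F.fac_right (g.cotensor adj δ) c _)
  natural {g g'} n {c c'} σ sq sq' h := by
    refine (adj.homEquiv_naturality_right_symm _ _).symm.trans
      (Eq.trans (congrArg _ ?_) (adj.homEquiv_naturality_left_symm _ _))
    exact F.natural (RightMap.cotensorMap adj δ n) σ (leibniz.toCotensor sq)
      (leibniz.toCotensor sq') (leibniz.toCotensor_comp (V.map σ) n.sq sq sq' h)

end UniformFilling

end UniformFibrations

namespace UniformFibrations

/-! ### Strong homotopy equivalences -/

namespace leibniz

variable {E : Type u} [Category.{v} E] [HasPushouts E] {I : E ⥤ E} {δ : 𝟭 E ⟶ I}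

/-- The structure of a strong homotopy equivalence is inherited along a pullback square, given
the homotopy on the codomain. -/
noncomputable def pullbackRetraction {a j : Arrow E} (ρ : (leibniz δ).obj j ⟶ j) (κ : a ⟶ j)
    (hκ : IsPullback κ.left a.hom j.hom κ.right) (ψ : I.obj a.right ⟶ a.right)
    (h : ψ ≫ κ.right = I.map κ.right ≫ sqRight ρ) : (leibniz δ).obj a ⟶ a :=
  sqMk (hκ.lift (domMap δ κ ≫ sqLeft ρ) (hom δ a ≫ ψ) (by
    have e : domMap δ κ ≫ hom δ j = hom δ a ≫ I.map κ.right := Arrow.w ((leibniz δ).map κ)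
    rw [Category.assoc, Category.assoc, h, sq_w, reassoc_of% e])) ψ (hκ.lift_snd _ _ _)

variable {a j : Arrow E} {ρ : (leibniz δ).obj j ⟶ j} {κ : a ⟶ j}
    {hκ : IsPullback κ.left a.hom j.hom κ.right} {ψ : I.obj a.right ⟶ a.right}
    {h : ψ ≫ κ.right = I.map κ.right ≫ sqRight ρ}

lemma sqLeft_pullbackRetraction_comp :
    sqLeft (pullbackRetraction ρ κ hκ ψ h) ≫ κ.left = domMap δ κ ≫ sqLeft ρ :=
  hκ.lift_fst _ _ _

@[simp]
lemma sqRight_pullbackRetraction : sqRight (pullbackRetraction ρ κ hκ ψ h) = ψ := rfl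

/-- Tested on the legs of the pullback `hκ`, the claim splits into the unit laws of `ρ` and of `ψ`.
In use `δ'` is the endpoint opposite to `δ`, and the result is one half of `a` being a retract of
its Leibniz product. -/
lemma pullbackRetraction_unit {δ' : 𝟭 E ⟶ I}
    (h₁ : point δ' j.left ≫ inl δ j ≫ sqLeft ρ = 𝟙 _) (h₂ : point δ' a.right ≫ ψ = 𝟙 _) :
    point δ' a.left ≫ inl δ a ≫ sqLeft (pullbackRetraction ρ κ hκ ψ h) = 𝟙 _ := by
  have e₁ := point_naturality δ' κ.left
  have e₂ := point_naturality δ' a.hom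
  apply hκ.hom_ext
  · rw [Category.assoc, Category.assoc, sqLeft_pullbackRetraction_comp, inl_domMap_assoc,
      ← reassoc_of% e₁, h₁, Category.id_comp, Category.comp_id]
  · rw [Category.assoc, Category.assoc, sq_w, sqRight_pullbackRetraction, inl_hom_assoc,
      ← reassoc_of% e₂, h₂, Category.id_comp, Category.comp_id]

/-- The left side of the retraction is forced by `ρ` and `ψ`, so compatibility of these two with the
squares is enough. -/
lemma pullbackRetraction_comp {a' j' : Arrow E} {ρ' : (leibniz δ).obj j' ⟶ j'} {κ' : a' ⟶ j'}
    {hκ' : IsPullback κ'.left a'.hom j'.hom κ'.right} {ψ' : I.obj a'.right ⟶ a'.right}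
    {h' : ψ' ≫ κ'.right = I.map κ'.right ≫ sqRight ρ'} (m : a ⟶ a') (τ : j ⟶ j')
    (hm : κ ≫ τ = m ≫ κ') (hρ : ρ ≫ τ = (leibniz δ).map τ ≫ ρ')
    (hψ : ψ ≫ m.right = I.map m.right ≫ ψ') :
    pullbackRetraction ρ κ hκ ψ h ≫ m =
      (leibniz δ).map m ≫ pullbackRetraction ρ' κ' hκ' ψ' h' := by
  have e₁ : κ.left ≫ τ.left = m.left ≫ κ'.left := congrArg (fun z => z.left) hm
  have e₂ : sqLeft ρ ≫ τ.left = domMap δ τ ≫ sqLeft ρ' := congrArg (fun z => z.left) hρ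
  have e₃ : domMap δ κ ≫ domMap δ τ = domMap δ m ≫ domMap δ κ' := by
    have := congrArg (fun z => z.left) (congrArg (leibniz δ).map hm)
    simp only [Functor.map_comp] at this
    exact this
  have e₄ : domMap δ m ≫ hom δ a' = hom δ a ≫ I.map m.right := Arrow.w ((leibniz δ).map m)
  apply Arrow.hom_ext
  · change sqLeft _ ≫ m.left = domMap δ m ≫ sqLeft _
    apply hκ'.hom_ext
    · rw [Category.assoc, Category.assoc, ← e₁, sqLeft_pullbackRetraction_comp,
        ← Category.assoc, sqLeft_pullbackRetraction_comp, Category.assoc, e₂, reassoc_of% e₃]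
    · rw [Category.assoc, Category.assoc, Arrow.w, sq_w, reassoc_of% e₄, ← Category.assoc, sq_w,
        Category.assoc, sqRight_pullbackRetraction, sqRight_pullbackRetraction, hψ]
  · exact hψ

end leibniz

namespace FunctorialCylinder

variable {E : Type u} [Category.{v} E] {cyl : FunctorialCylinder E}
  {con : cyl.Contractions} (conn : cyl.Connections con) (k : Fin 2)

variable (con) in
lemma point_ε (X : E) : point (cyl.δ k) X ≫ con.ε.app X = 𝟙 X :=
  congrArg (fun z => z.app X) (con.δ_ε k)

variable (con) in
lemma ε_naturality {X Y : E} (f : X ⟶ Y) :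
    cyl.I.map f ≫ con.ε.app Y = con.ε.app X ≫ f := con.ε.naturality f

namespace Connections

lemma c_naturality {X Y : E} (f : X ⟶ Y) :
    cyl.I.map (cyl.I.map f) ≫ (conn.c k).app Y = (conn.c k).app X ≫ cyl.I.map f :=
  (conn.c k).naturality f

lemma point_c (X : E) : point (cyl.δ k) (cyl.I.obj X) ≫ (conn.c k).app X =
    con.ε.app X ≫ point (cyl.δ k) X := conn.δ_c k X

lemma map_point_c (X : E) : cyl.I.map (point (cyl.δ k) X) ≫ (conn.c k).app X =
    con.ε.app X ≫ point (cyl.δ k) X := conn.map_δ_c k X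

lemma point_c' (X : E) : point (cyl.δ (1 - k)) (cyl.I.obj X) ≫ (conn.c k).app X =
    𝟙 (cyl.I.obj X) := conn.δ_c' k X

end Connections

variable [HasPushouts E]

variable (cyl) in
lemma point_inl {x : Arrow E} (j : Fin 2) :
    leibniz.inl (cyl.δ k) x ≫ point (cyl.δ j) (leibniz.dom (cyl.δ k) x) =
      point (cyl.δ j) (cyl.I.obj x.left) ≫ cyl.I.map (leibniz.inl (cyl.δ k) x) :=
  point_naturality _ _

variable (cyl) in
lemma point_inr {x : Arrow E} (j : Fin 2) :
    leibniz.inr (cyl.δ k) x ≫ point (cyl.δ j) (leibniz.dom (cyl.δ k) x) =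
      point (cyl.δ j) x.right ≫ cyl.I.map (leibniz.inr (cyl.δ k) x) :=
  point_naturality _ _

variable [cyl.I.IsLeftAdjoint]

variable (cyl) in
lemma isPushout_map (x : Arrow E) :
    IsPushout (cyl.I.map (point (cyl.δ k) x.left)) (cyl.I.map x.hom)
      (cyl.I.map (leibniz.inl (cyl.δ k) x)) (cyl.I.map (leibniz.inr (cyl.δ k) x)) :=
  (leibniz.isPushout (cyl.δ k) x).map cyl.I

namespace Connections

/-- The contraction of the domain of a Leibniz product that is induced by a connection. -/
noncomputable def domHomotopy (x : Arrow E) :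
    cyl.I.obj (leibniz.dom (cyl.δ k) x) ⟶ leibniz.dom (cyl.δ k) x :=
  -- The connection on the cylinder part, the constant homotopy on the codomain part. They agree
  -- where the parts are glued because `c k`, restricted to the end `k` of the inner cylinder, is
  -- constant.
  (cyl.isPushout_map k x).desc ((conn.c k).app x.left ≫ leibniz.inl (cyl.δ k) x)
    (con.ε.app x.right ≫ leibniz.inr (cyl.δ k) x) (by
      rw [← Category.assoc, map_point_c, Category.assoc, leibniz.condition, ← Category.assoc,
        ← ε_naturality con, Category.assoc])

lemma map_inl_domHomotopy (x : Arrow E) :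
    cyl.I.map (leibniz.inl (cyl.δ k) x) ≫ conn.domHomotopy k x =
      (conn.c k).app x.left ≫ leibniz.inl (cyl.δ k) x :=
  IsPushout.inl_desc _ _ _ _

lemma map_inr_domHomotopy (x : Arrow E) :
    cyl.I.map (leibniz.inr (cyl.δ k) x) ≫ conn.domHomotopy k x =
      con.ε.app x.right ≫ leibniz.inr (cyl.δ k) x :=
  IsPushout.inr_desc _ _ _ _

/-- At the end `k` the connection collapses the cylinder onto the end that is glued to the codomain.
This is the gluing condition needed to extend `domHomotopy` to `retraction`. -/
lemma point_domHomotopy (x : Arrow E) :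
    point (cyl.δ k) (leibniz.dom (cyl.δ k) x) ≫ conn.domHomotopy k x =
      leibniz.hom (cyl.δ k) x ≫ con.ε.app x.right ≫ leibniz.inr (cyl.δ k) x := by
  apply leibniz.hom_ext
  · rw [← Category.assoc, point_inl cyl, Category.assoc, map_inl_domHomotopy, ← Category.assoc,
      point_c, Category.assoc, leibniz.condition, leibniz.inl_hom_assoc, ← Category.assoc,
      ← Category.assoc, ε_naturality con]
  · rw [← Category.assoc, point_inr cyl, Category.assoc, map_inr_domHomotopy, leibniz.inr_hom_assoc]

/-- `c k` is neutral at the end `1 - k`, and a constant homotopy is the identity at either end. -/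
lemma point_domHomotopy' (x : Arrow E) :
    point (cyl.δ (1 - k)) (leibniz.dom (cyl.δ k) x) ≫ conn.domHomotopy k x = 𝟙 _ := by
  apply leibniz.hom_ext
  · rw [← Category.assoc, point_inl cyl, Category.assoc, map_inl_domHomotopy, ← Category.assoc,
      point_c', Category.id_comp, Category.comp_id]
  · rw [← Category.assoc, point_inr cyl, Category.assoc, map_inr_domHomotopy, ← Category.assoc,
      point_ε con, Category.id_comp, Category.comp_id]

/-- The constant homotopy on the codomain part is itself the restriction of `c k` to the end `k` of
the inner cylinder, so both parts lie over the same connection. -/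
lemma domHomotopy_hom (x : Arrow E) :
    conn.domHomotopy k x ≫ leibniz.hom (cyl.δ k) x =
      cyl.I.map (leibniz.hom (cyl.δ k) x) ≫ (conn.c k).app x.right := by
  apply (cyl.isPushout_map k x).hom_ext
  · rw [← Category.assoc, map_inl_domHomotopy, Category.assoc, leibniz.inl_hom, ← Category.assoc,
      ← Functor.map_comp, leibniz.inl_hom, c_naturality]
  · rw [← Category.assoc, map_inr_domHomotopy, Category.assoc, leibniz.inr_hom, ← Category.assoc,
      ← Functor.map_comp, leibniz.inr_hom, map_point_c]

lemma map_domMap_domHomotopy {x y : Arrow E} (σ : x ⟶ y) :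
    cyl.I.map (leibniz.domMap (cyl.δ k) σ) ≫ conn.domHomotopy k y =
      conn.domHomotopy k x ≫ leibniz.domMap (cyl.δ k) σ := by
  apply (cyl.isPushout_map k x).hom_ext
  · rw [← Category.assoc, ← Functor.map_comp, leibniz.inl_domMap, Functor.map_comp, Category.assoc,
      map_inl_domHomotopy, ← Category.assoc, c_naturality, ← Category.assoc, map_inl_domHomotopy,
      Category.assoc, Category.assoc, leibniz.inl_domMap]
  · rw [← Category.assoc, ← Functor.map_comp, leibniz.inr_domMap, Functor.map_comp, Category.assoc,
      map_inr_domHomotopy, ← Category.assoc, ε_naturality con, ← Category.assoc,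
      map_inr_domHomotopy, Category.assoc, Category.assoc, leibniz.inr_domMap]

/-- The Leibniz product of an endpoint inclusion with an arrow is a strong homotopy
equivalence. -/
noncomputable def retraction (x : Arrow E) :
    (leibniz (cyl.δ k)).obj (Arrow.mk (leibniz.hom (cyl.δ k) x)) ⟶
      Arrow.mk (leibniz.hom (cyl.δ k) x) :=
  leibniz.sqMk (f := Arrow.mk (leibniz.hom (cyl.δ k) x)) (g := Arrow.mk (leibniz.hom (cyl.δ k) x))
    (leibniz.desc (f := Arrow.mk (leibniz.hom (cyl.δ k) x)) (conn.domHomotopy k x)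
      (con.ε.app x.right ≫ leibniz.inr (cyl.δ k) x) (conn.point_domHomotopy k x))
    ((conn.c k).app x.right) (by
      apply leibniz.hom_ext
      · rw [leibniz.inl_desc_assoc, leibniz.inl_hom_assoc]
        exact conn.domHomotopy_hom k x
      · rw [leibniz.inr_desc_assoc, leibniz.inr_hom_assoc, Category.assoc]
        refine (congrArg (fun z => _ ≫ z) (leibniz.inr_hom x)).trans ?_
        exact (conn.point_c k x.right).symm)

/-- The domain half of the section of `retraction`; the codomain half is `point_c'`. -/
lemma retraction_unit_left (x : Arrow E) :
    point (cyl.δ (1 - k)) (leibniz.dom (cyl.δ k) x) ≫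
      leibniz.inl (cyl.δ k) (Arrow.mk (leibniz.hom (cyl.δ k) x)) ≫
        leibniz.sqLeft (conn.retraction k x) = 𝟙 (leibniz.dom (cyl.δ k) x) :=
  (congrArg (fun z => _ ≫ z) (leibniz.inl_desc (f := Arrow.mk (leibniz.hom (cyl.δ k) x)) _ _
    (conn.point_domHomotopy k x))).trans (conn.point_domHomotopy' k x)

/-- Rests on naturality of the connections and of `ε`; it is what makes the later fillers uniform in
the generator. -/
lemma retraction_naturality {x y : Arrow E} (σ : x ⟶ y) :
    conn.retraction k x ≫ (leibniz (cyl.δ k)).map σ =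
      (leibniz (cyl.δ k)).map ((leibniz (cyl.δ k)).map σ) ≫ conn.retraction k y := by
  apply Arrow.hom_ext
  · change leibniz.desc _ _ _ ≫ leibniz.domMap (cyl.δ k) σ =
      leibniz.domMap (cyl.δ k) ((leibniz (cyl.δ k)).map σ) ≫ leibniz.desc _ _ _
    apply leibniz.hom_ext
    · refine (leibniz.inl_desc_assoc _ _ _ _).trans ?_
      refine Eq.trans ?_ (leibniz.inl_domMap_assoc _ _).symm
      refine Eq.trans ?_ (congrArg (fun z => _ ≫ z) (leibniz.inl_desc _ _ _)).symm
      exact (conn.map_domMap_domHomotopy k σ).symm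
    · refine (leibniz.inr_desc_assoc _ _ _ _).trans ?_
      refine Eq.trans ?_ (leibniz.inr_domMap_assoc _ _).symm
      refine Eq.trans ?_ (congrArg (fun z => _ ≫ z) (leibniz.inr_desc _ _ _)).symm
      refine Eq.trans ?_ (Category.assoc _ _ _)
      refine Eq.trans ?_ (congrArg (fun z => z ≫ _) (ε_naturality con σ.right)).symm
      exact (Category.assoc _ _ _).trans ((congrArg (fun z => _ ≫ z)
        (leibniz.inr_domMap σ)).trans (Category.assoc _ _ _).symm)
  · exact ((conn.c k).naturality σ.right).symm

end Connections

end FunctorialCylinder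

/-! ### Lifting homotopies -/

section HomotopyLifting

variable {E : Type u} [Category.{v} E] [HasPushouts E] [HasInitial E] {J : Type u₁}
  [Category.{v₁} J] {T : J ⥤ Arrow E} {I : E ⥤ E} {δ : 𝟭 E ⟶ I}

/-- The square that has to be filled in order to lift a homotopy with a given start. -/
noncomputable def homotopySquare [I.IsLeftAdjoint] {p : Arrow E} {X : E} (a : X ⟶ p.left)
    (b : I.obj X ⟶ p.right) (h : point δ X ≫ b = a ≫ p.hom) :
    (leibniz δ).obj (Arrow.mk (initial.to X)) ⟶ p :=
  -- A left adjoint preserves the initial object, so the Leibniz product with `⊥ ⟶ X` is, up to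
  -- isomorphism, the endpoint inclusion of `X`.
  have hI : IsInitial (I.obj (⊥_ E)) := IsInitial.isInitialObj I _ initialIsInitial
  leibniz.sqMk (f := Arrow.mk (initial.to X))
    (leibniz.desc (f := Arrow.mk (initial.to X)) (hI.to _) a (initialIsInitial.hom_ext _ _)) b (by
      apply leibniz.hom_ext
      · exact hI.hom_ext _ _
      · rw [leibniz.inr_desc_assoc, leibniz.inr_hom_assoc]
        exact h.symm)

variable [I.IsLeftAdjoint] (F : UniformFilling T (initialArrow E ⋙ leibniz δ))

namespace UniformFilling

/-- The lift of a homotopy with a given start. -/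
noncomputable def homotopyLift (p : RightMap T) {X : E} (a : X ⟶ p.arrow.left)
    (b : I.obj X ⟶ p.arrow.right) (h : point δ X ≫ b = a ≫ p.arrow.hom) :
    I.obj X ⟶ p.arrow.left :=
  F.fill p X (homotopySquare a b h)

variable {p p' : RightMap T} {X X' : E} {a : X ⟶ p.arrow.left} {b : I.obj X ⟶ p.arrow.right}
    {h : point δ X ≫ b = a ≫ p.arrow.hom} {a' : X' ⟶ p'.arrow.left} {b' : I.obj X' ⟶ p'.arrow.right}
    {h' : point δ X' ≫ b' = a' ≫ p'.arrow.hom}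

lemma point_homotopyLift : point δ X ≫ F.homotopyLift p a b h = a := by
  have e : leibniz.hom δ (Arrow.mk (initial.to X)) ≫ F.homotopyLift p a b h =
    leibniz.desc _ _ _ := F.fac_left p X (homotopySquare a b h)
  have e' := congrArg (fun z => leibniz.inr δ (Arrow.mk (initial.to X)) ≫ z) e
  simp only [leibniz.inr_desc] at e'
  refine Eq.trans ?_ e'
  exact (leibniz.inr_hom_assoc (δ := δ) (Arrow.mk (initial.to X)) _).symm

lemma homotopyLift_hom : F.homotopyLift p a b h ≫ p.arrow.hom = b :=
  F.fac_right p X (homotopySquare a b h)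

/-- Maps out of the cylinder on the initial object agree automatically, so the squares only have to
be compared on the start and on the homotopy. -/
lemma homotopyLift_comp (m : p ⟶ p') (f : X ⟶ X') (ha : a ≫ m.sq.left = f ≫ a')
    (hb : b ≫ m.sq.right = I.map f ≫ b') :
    F.homotopyLift p a b h ≫ m.sq.left = I.map f ≫ F.homotopyLift p' a' b' h' := by
  have hI : IsInitial (I.obj (⊥_ E)) := IsInitial.isInitialObj I _ initialIsInitial
  refine F.natural m f (homotopySquare a b h) (homotopySquare a' b' h') ?_
  apply leibniz.sq_ext (δ := δ) (f := Arrow.mk (initial.to X))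
  · exact hI.hom_ext _ _
  · refine (leibniz.inr_desc_assoc (δ := δ) (f := Arrow.mk (initial.to X)) _ _ _ _).trans (ha.trans ?_)
    refine Eq.trans ?_ (leibniz.inr_domMap_assoc ((initialArrow E).map f) _).symm
    exact congrArg (fun z => f ≫ z) (leibniz.inr_desc (δ := δ) (f := Arrow.mk (initial.to X')) _ _ _).symm
  · exact hb

end UniformFilling

end HomotopyLifting

end UniformFibrations

namespace UniformFibrations

/-! ### Arrows cartesian over a family of arrows -/

section CartOver

variable {E : Type u} [Category.{v} E] {C : Type u₁} [Category.{v₁} C]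

/-- An arrow together with a pullback square to one of the arrows `V c`. -/
structure CartOver (V : C ⥤ Arrow E) where
  /-- the index of the arrow that is pulled back -/
  base : C
  /-- the underlying arrow -/
  arrow : Arrow E
  /-- the pullback square -/
  sq : arrow ⟶ V.obj base
  isPullback : IsPullback sq.left arrow.hom (V.obj base).hom sq.right

namespace CartOver

variable {V : C ⥤ Arrow E}

/-- A morphism of pullback squares. -/
@[ext]
structure Hom (x y : CartOver V) where
  /-- the morphism of indices -/
  base : x.base ⟶ y.base
  /-- the square between the underlying arrows -/
  top : x.arrow ⟶ y.arrow
  comm : top ≫ y.sq = x.sq ≫ V.map base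

instance : Category (CartOver V) where
  Hom := Hom
  id x := ⟨𝟙 _, 𝟙 _, by simp⟩
  comp a b := ⟨a.base ≫ b.base, a.top ≫ b.top, by
    rw [Category.assoc, b.comm, ← Category.assoc, a.comm, V.map_comp, Category.assoc]⟩
  id_comp _ := Hom.ext (Category.id_comp _) (Category.id_comp _)
  comp_id _ := Hom.ext (Category.comp_id _) (Category.comp_id _)
  assoc _ _ _ := Hom.ext (Category.assoc _ _ _) (Category.assoc _ _ _)

variable (V) in
/-- The forgetful functor to arrows. -/
def forget : CartOver V ⥤ Arrow E where
  obj x := x.arrow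
  map m := m.top
  map_id _ := rfl
  map_comp _ _ := rfl

end CartOver

end CartOver

/-! ### The Frobenius property -/

section Frobenius

variable {E : Type u} [Category.{v} E] [HasPushouts E] {cyl : FunctorialCylinder E}
  {con : cyl.Contractions} (conn : cyl.Connections con) (k : Fin 2)
  {J : Type u₁} [Category.{v₁} J] {U : J ⥤ Arrow E} {J' : Type u₂} [Category.{v₂} J']
  {T : J' ⥤ Arrow E}

/-- A cartesian square to a right map `p` from the codomain part of a pullback square over
a Leibniz product `δ^k ⊗ U j`. -/
structure Pullbacks (U : J ⥤ Arrow E) (cyl : FunctorialCylinder E) (k : Fin 2) (p : Arrow E) where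
  /-- the pullback square over a Leibniz product -/
  cart : CartOver (U ⋙ leibniz (cyl.δ k))
  /-- the upper side of the square to `p` -/
  top : cart.arrow.right ⟶ p.left
  /-- the lower side of the square to `p` -/
  bot : cyl.I.obj (U.obj cart.base).right ⟶ p.right
  isPullback : IsPullback top (show cart.arrow.right ⟶ cyl.I.obj (U.obj cart.base).right from
    cart.sq.right) p.hom bot

namespace Pullbacks

variable {k} {p : Arrow E}

/-- The square to a Leibniz product. -/
noncomputable def sq (y : Pullbacks U cyl k p) :
    y.cart.arrow ⟶ Arrow.mk (leibniz.hom (cyl.δ k) (U.obj y.cart.base)) := y.cart.sq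

/-- The codomain part of the square to a Leibniz product. -/
noncomputable def codMap (y : Pullbacks U cyl k p) :
    y.cart.arrow.right ⟶ cyl.I.obj (U.obj y.cart.base).right := y.cart.sq.right

lemma codMap_w (y : Pullbacks U cyl k p) : y.top ≫ p.hom = y.codMap ≫ y.bot := y.isPullback.w

/-- The homotopy that has to be lifted, to contract the pullback of a Leibniz product. -/
noncomputable def baseHomotopy (y : Pullbacks U cyl k p) : cyl.I.obj y.cart.arrow.right ⟶
    cyl.I.obj (U.obj y.cart.base).right :=
  cyl.I.map y.codMap ≫ (conn.c k).app (U.obj y.cart.base).right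

/-- `c k` is neutral at the end `1 - k`, so the homotopy starts at the projection lying below
`y.top`; `y.top` can therefore serve as the start of its lift. -/
lemma point_baseHomotopy (y : Pullbacks U cyl k p) :
    point (cyl.δ (1 - k)) _ ≫ y.baseHomotopy conn = y.codMap := by
  rw [baseHomotopy, ← Category.assoc, ← point_naturality, Category.assoc, conn.point_c',
    Category.comp_id]

/-- A morphism of pullback squares, compatible with a square between right maps. -/
structure Hom {p' : Arrow E} (m : p ⟶ p') (y : Pullbacks U cyl k p)
    (y' : Pullbacks U cyl k p') where
  /-- the morphism of squares to the Leibniz products -/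
  cart : y.cart ⟶ y'.cart
  top : y.top ≫ m.left = cart.top.right ≫ y'.top
  bot : y.bot ≫ m.right = cyl.I.map (U.map cart.base).right ≫ y'.bot

variable {p' : Arrow E} {m : p ⟶ p'} {y : Pullbacks U cyl k p} {y' : Pullbacks U cyl k p'}

lemma Hom.codMap (σ : Hom m y y') :
    σ.cart.top.right ≫ y'.codMap = y.codMap ≫ cyl.I.map (U.map σ.cart.base).right :=
  congrArg (fun z => z.right) σ.cart.comm

lemma baseHomotopy_comp (σ : Hom m y y') :
    y.baseHomotopy conn ≫ cyl.I.map (U.map σ.cart.base).right =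
      cyl.I.map σ.cart.top.right ≫ y'.baseHomotopy conn := by
  rw [baseHomotopy, baseHomotopy, Category.assoc, ← conn.c_naturality, ← Category.assoc,
    ← Category.assoc, ← Functor.map_comp, ← Functor.map_comp, σ.codMap]

end Pullbacks

variable [cyl.I.IsLeftAdjoint] [HasInitial E] {k}
  (F₀ : UniformFilling T (initialArrow E ⋙ leibniz (cyl.δ (1 - k))))
  (F₁ : UniformFilling T (CartOver.forget (U ⋙ leibniz (cyl.δ k)) ⋙ leibniz (cyl.δ k)))

namespace UniformFilling

section

variable (p : RightMap T) (y : Pullbacks U cyl k p.arrow)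

/-- The contraction of the pullback of the codomain of a Leibniz product, before restriction. -/
noncomputable def frobeniusLift : cyl.I.obj y.cart.arrow.right ⟶ p.arrow.left :=
  F₀.homotopyLift p y.top (y.baseHomotopy conn ≫ y.bot) (by
    rw [← Category.assoc, y.point_baseHomotopy conn, y.codMap_w])

/-- The contraction of the pullback of the codomain of a Leibniz product. -/
noncomputable def frobeniusHomotopy : cyl.I.obj y.cart.arrow.right ⟶ y.cart.arrow.right :=
  y.isPullback.lift (F₀.frobeniusLift conn p y) (y.baseHomotopy conn) (F₀.homotopyLift_hom)

lemma frobeniusHomotopy_top :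
    F₀.frobeniusHomotopy conn p y ≫ y.top = F₀.frobeniusLift conn p y :=
  y.isPullback.lift_fst _ _ _

lemma frobeniusHomotopy_codMap :
    F₀.frobeniusHomotopy conn p y ≫ y.codMap = y.baseHomotopy conn :=
  y.isPullback.lift_snd _ _ _

/-- On the two projections of the pullback: the lifted homotopy starts at `y.top`, the homotopy
below it at `y.codMap`. -/
lemma point_frobeniusHomotopy :
    point (cyl.δ (1 - k)) _ ≫ F₀.frobeniusHomotopy conn p y = 𝟙 _ := by
  apply y.isPullback.hom_ext
  · rw [Category.assoc, frobeniusHomotopy_top, Category.id_comp]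
    exact F₀.point_homotopyLift
  · refine (Category.assoc _ _ _).trans ?_
    refine (congrArg (fun z => _ ≫ z) (F₀.frobeniusHomotopy_codMap conn p y)).trans ?_
    refine (y.point_baseHomotopy conn).trans (Category.id_comp _).symm

/-- The pullback of a Leibniz product along a right map is a strong homotopy equivalence. -/
noncomputable def frobeniusRetraction : (leibniz (cyl.δ k)).obj y.cart.arrow ⟶ y.cart.arrow :=
  leibniz.pullbackRetraction (conn.retraction k (U.obj y.cart.base)) y.sq y.cart.isPullback
    (F₀.frobeniusHomotopy conn p y) (F₀.frobeniusHomotopy_codMap conn p y)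

lemma frobeniusRetraction_unit :
    point (cyl.δ (1 - k)) _ ≫ leibniz.inl (cyl.δ k) _ ≫
      leibniz.sqLeft (F₀.frobeniusRetraction conn p y) = 𝟙 _ :=
  leibniz.pullbackRetraction_unit (conn.retraction_unit_left k _)
    (F₀.point_frobeniusHomotopy conn p y)

/-- The homotopy that ends in the filler of a square from the pullback of a Leibniz product along
a right map. -/
noncomputable def frobeniusExtension (g : RightMap T) (t : y.cart.arrow ⟶ g.arrow) :
    cyl.I.obj y.cart.arrow.right ⟶ g.arrow.left :=
  F₁.fill g y.cart (F₀.frobeniusRetraction conn p y ≫ t)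

lemma hom_frobeniusExtension (g : RightMap T) (t : y.cart.arrow ⟶ g.arrow) :
    leibniz.hom (cyl.δ k) _ ≫ frobeniusExtension conn F₀ F₁ p y g t =
      leibniz.sqLeft (F₀.frobeniusRetraction conn p y) ≫ t.left :=
  F₁.fac_left g y.cart (F₀.frobeniusRetraction conn p y ≫ t)

lemma frobeniusExtension_hom (g : RightMap T) (t : y.cart.arrow ⟶ g.arrow) :
    frobeniusExtension conn F₀ F₁ p y g t ≫ g.arrow.hom =
      F₀.frobeniusHomotopy conn p y ≫ t.right :=
  F₁.fac_right g y.cart (F₀.frobeniusRetraction conn p y ≫ t)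

/-- The filler of a square from the pullback of a Leibniz product along a right map. -/
noncomputable def frobeniusFill (g : RightMap T) (t : y.cart.arrow ⟶ g.arrow) :
    y.cart.arrow.right ⟶ g.arrow.left :=
  point (cyl.δ (1 - k)) _ ≫ frobeniusExtension conn F₀ F₁ p y g t

lemma frobeniusFill_fac_left (g : RightMap T) (t : y.cart.arrow ⟶ g.arrow) :
    y.cart.arrow.hom ≫ frobeniusFill conn F₀ F₁ p y g t = t.left := by
  -- The endpoint slides past the pulled back arrow, whose cylinder is `inl` followed by the Leibniz
  -- product. The extension is thus only met on the domain of that product, where the unit law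
  -- cancels the retraction.
  rw [frobeniusFill, ← Category.assoc, point_naturality, Category.assoc,
    ← leibniz.inl_hom_assoc (δ := cyl.δ k), hom_frobeniusExtension]
  have h := congrArg (fun z => z ≫ t.left) (F₀.frobeniusRetraction_unit conn p y)
  simp only [Category.assoc, Category.id_comp] at h
  exact h

lemma frobeniusFill_fac_right (g : RightMap T) (t : y.cart.arrow ⟶ g.arrow) :
    frobeniusFill conn F₀ F₁ p y g t ≫ g.arrow.hom = t.right := by
  rw [frobeniusFill, Category.assoc, frobeniusExtension_hom, ← Category.assoc,
    point_frobeniusHomotopy, Category.id_comp]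

end

variable {p p' : RightMap T} {y : Pullbacks U cyl k p.arrow} {y' : Pullbacks U cyl k p'.arrow}

/-- Maps into the pullback are compared on its projections: over `p'` homotopy lifting is natural,
over the Leibniz product the connection is. -/
lemma frobeniusHomotopy_comp (m : p ⟶ p') (σ : Pullbacks.Hom m.sq y y') :
    F₀.frobeniusHomotopy conn p y ≫ σ.cart.top.right =
      cyl.I.map σ.cart.top.right ≫ F₀.frobeniusHomotopy conn p' y' := by
  apply y'.isPullback.hom_ext
  · rw [Category.assoc, Category.assoc, ← σ.top, frobeniusHomotopy_top, ← Category.assoc,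
      frobeniusHomotopy_top]
    refine F₀.homotopyLift_comp m _ σ.top ?_
    rw [Category.assoc, σ.bot, ← Category.assoc, Pullbacks.baseHomotopy_comp, Category.assoc]
  · change (_ ≫ _) ≫ y'.codMap = (_ ≫ _) ≫ y'.codMap
    rw [Category.assoc, Category.assoc, σ.codMap, frobeniusHomotopy_codMap, ← Category.assoc,
      frobeniusHomotopy_codMap, Pullbacks.baseHomotopy_comp]

lemma frobeniusRetraction_comp (m : p ⟶ p') (σ : Pullbacks.Hom m.sq y y') :
    F₀.frobeniusRetraction conn p y ≫ σ.cart.top =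
      (leibniz (cyl.δ k)).map σ.cart.top ≫ F₀.frobeniusRetraction conn p' y' :=
  leibniz.pullbackRetraction_comp σ.cart.top ((leibniz (cyl.δ k)).map (U.map σ.cart.base))
    σ.cart.comm.symm (conn.retraction_naturality k (U.map σ.cart.base))
    (F₀.frobeniusHomotopy_comp conn m σ)

/-- The retraction is natural in the fibration and in the generator, and `F₁` is natural in `g` and
in the pulled back arrow. Naturality in all variables jointly is needed later, since the
Beck–Chevalley square changes the fibration and the right map together. -/
lemma frobeniusFill_comp (m : p ⟶ p') (σ : Pullbacks.Hom m.sq y y') {g g' : RightMap T}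
    (n : g ⟶ g') (t : y.cart.arrow ⟶ g.arrow) (t' : y'.cart.arrow ⟶ g'.arrow)
    (h : t ≫ n.sq = σ.cart.top ≫ t') :
    frobeniusFill conn F₀ F₁ p y g t ≫ n.sq.left =
      σ.cart.top.right ≫ frobeniusFill conn F₀ F₁ p' y' g' t' := by
  have e : frobeniusExtension conn F₀ F₁ p y g t ≫ n.sq.left =
      cyl.I.map σ.cart.top.right ≫ frobeniusExtension conn F₀ F₁ p' y' g' t' := by
    refine F₁.natural n σ.cart _ (F₀.frobeniusRetraction conn p' y' ≫ t') ?_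
    refine (Category.assoc _ _ _).trans ((congrArg (fun z => _ ≫ z) h).trans ?_)
    exact (Category.assoc _ _ _).symm.trans
      ((congrArg (fun z => z ≫ t') (F₀.frobeniusRetraction_comp conn m σ)).trans
        (Category.assoc _ _ _))
  rw [frobeniusFill, frobeniusFill, Category.assoc, e, ← Category.assoc, ← Category.assoc,
    point_naturality]

end UniformFilling

end Frobenius

end UniformFibrations

namespace UniformFibrations

/-! ### Natural fillers for pullbacks of generators along right maps -/

section FrobeniusFilling

variable {E : Type u} [Category.{v} E] {C : Type u₁} [Category.{v₁} C] {C' : Type u₂}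
  [Category.{v₂} C'] {J : Type u₃} [Category.{v₃} J]

/-- A pullback square over an arrow `V c`, whose codomain part is a pullback of the arrow `p`. -/
structure PullbackAlong (V : C ⥤ Arrow E) (p : Arrow E) where
  /-- the pullback square over one of the arrows `V c` -/
  cart : CartOver V
  /-- the upper side of the square to `p` -/
  top : cart.arrow.right ⟶ p.left
  /-- the lower side of the square to `p` -/
  bot : (V.obj cart.base).right ⟶ p.right
  isPullback : IsPullback top cart.sq.right p.hom bot

namespace PullbackAlong

variable {V : C ⥤ Arrow E}

/-- A morphism of pullback squares, compatible with a square between arrows. -/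
structure Hom {p p' : Arrow E} (m : p ⟶ p') (y : PullbackAlong V p) (y' : PullbackAlong V p') where
  /-- the morphism of pullback squares -/
  cart : y.cart ⟶ y'.cart
  top : y.top ≫ m.left = cart.top.right ≫ y'.top
  bot : y.bot ≫ m.right = (V.map cart.base).right ≫ y'.bot

end PullbackAlong

/-- Natural fillers of squares from pullbacks of arrows `V c` along right `T`-maps to right
`T`-maps. -/
structure FrobeniusFilling (V : C ⥤ Arrow E) (T : J ⥤ Arrow E) where
  /-- the chosen filler -/
  fill (p : RightMap T) (y : PullbackAlong V p.arrow) (g : RightMap T)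
    (t : y.cart.arrow ⟶ g.arrow) : y.cart.arrow.right ⟶ g.arrow.left
  fac_left (p : RightMap T) (y : PullbackAlong V p.arrow) (g : RightMap T)
    (t : y.cart.arrow ⟶ g.arrow) : y.cart.arrow.hom ≫ fill p y g t = t.left
  fac_right (p : RightMap T) (y : PullbackAlong V p.arrow) (g : RightMap T)
    (t : y.cart.arrow ⟶ g.arrow) : fill p y g t ≫ g.arrow.hom = t.right
  natural {p p' : RightMap T} (m : p ⟶ p') {y : PullbackAlong V p.arrow}
    {y' : PullbackAlong V p'.arrow} (σ : PullbackAlong.Hom m.sq y y') {g g' : RightMap T}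
    (n : g ⟶ g') (t : y.cart.arrow ⟶ g.arrow) (t' : y'.cart.arrow ⟶ g'.arrow)
    (h : t ≫ n.sq = σ.cart.top ≫ t') :
    fill p y g t ≫ n.sq.left = σ.cart.top.right ≫ fill p' y' g' t'

namespace FrobeniusFilling

variable {V : C ⥤ Arrow E} {V' : C' ⥤ Arrow E} {T : J ⥤ Arrow E}

/-- Fillers for two families of arrows give fillers for their coproduct. -/
def sum (F : FrobeniusFilling V T) (F' : FrobeniusFilling V' T) :
    FrobeniusFilling (V.sum' V') T where
  fill p y g t := match y, t with
    | ⟨⟨.inl c, a, κ, hκ⟩, b, b', hb⟩, t => F.fill p ⟨⟨c, a, κ, hκ⟩, b, b', hb⟩ g t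
    | ⟨⟨.inr c, a, κ, hκ⟩, b, b', hb⟩, t => F'.fill p ⟨⟨c, a, κ, hκ⟩, b, b', hb⟩ g t
  fac_left p y g t := match y, t with
    | ⟨⟨.inl c, a, κ, hκ⟩, b, b', hb⟩, t => F.fac_left p ⟨⟨c, a, κ, hκ⟩, b, b', hb⟩ g t
    | ⟨⟨.inr c, a, κ, hκ⟩, b, b', hb⟩, t => F'.fac_left p ⟨⟨c, a, κ, hκ⟩, b, b', hb⟩ g t
  fac_right p y g t := match y, t with
    | ⟨⟨.inl c, a, κ, hκ⟩, b, b', hb⟩, t => F.fac_right p ⟨⟨c, a, κ, hκ⟩, b, b', hb⟩ g t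
    | ⟨⟨.inr c, a, κ, hκ⟩, b, b', hb⟩, t => F'.fac_right p ⟨⟨c, a, κ, hκ⟩, b, b', hb⟩ g t
  natural m y y' σ _ _ n t t' h := match y, y', σ, t, t', h with
    | ⟨⟨.inl c, a, κ, hκ⟩, b, b', hb⟩, ⟨⟨.inl d, a₁, κ₁, hκ₁⟩, b₁, b₁', hb₁⟩,
        ⟨⟨f, r, hr⟩, hr₁, hr₂⟩, t, t', h =>
      F.natural m (y := ⟨⟨c, a, κ, hκ⟩, b, b', hb⟩) (y' := ⟨⟨d, a₁, κ₁, hκ₁⟩, b₁, b₁', hb₁⟩)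
        ⟨⟨f.down, r, hr⟩, hr₁, hr₂⟩ n t t' h
    | ⟨⟨.inr c, a, κ, hκ⟩, b, b', hb⟩, ⟨⟨.inr d, a₁, κ₁, hκ₁⟩, b₁, b₁', hb₁⟩,
        ⟨⟨f, r, hr⟩, hr₁, hr₂⟩, t, t', h =>
      F'.natural m (y := ⟨⟨c, a, κ, hκ⟩, b, b', hb⟩) (y' := ⟨⟨d, a₁, κ₁, hκ₁⟩, b₁, b₁', hb₁⟩)
        ⟨⟨f.down, r, hr⟩, hr₁, hr₂⟩ n t t' h
    -- There are no morphisms between different summands.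
    | ⟨⟨.inl _, _, _, _⟩, _, _, _⟩, ⟨⟨.inr _, _, _, _⟩, _, _, _⟩, ⟨⟨f, _, _⟩, _, _⟩, _, _, _ =>
      f.elim
    | ⟨⟨.inr _, _, _, _⟩, _, _, _⟩, ⟨⟨.inl _, _, _, _⟩, _, _, _⟩, ⟨⟨f, _, _⟩, _, _⟩, _, _, _ =>
      f.elim

end FrobeniusFilling

end FrobeniusFilling

/-! ### The Frobenius property for the generating trivial cofibrations -/

section

variable {E : Type u} [Category.{v} E] [HasPushouts E] [HasInitial E]
  {cyl : FunctorialCylinder E} [cyl.I.IsLeftAdjoint] {con : cyl.Contractions}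
  (conn : cyl.Connections con) {J : Type u₁} [Category.{v₁} J] {U : J ⥤ Arrow E}

/-- Pullbacks of Leibniz products `δ^k ⊗ U j` along right maps have fillers against right maps. -/
noncomputable def FrobeniusFilling.ofLeibniz {k : Fin 2} {J' : Type u₂} [Category.{v₂} J']
    {T : J' ⥤ Arrow E} (F₀ : UniformFilling T (initialArrow E ⋙ leibniz (cyl.δ (1 - k))))
    (F₁ : UniformFilling T (CartOver.forget (U ⋙ leibniz (cyl.δ k)) ⋙ leibniz (cyl.δ k))) :
    FrobeniusFilling (U ⋙ leibniz (cyl.δ k)) T where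
  fill p y := UniformFilling.frobeniusFill conn F₀ F₁ p ⟨y.cart, y.top, y.bot, y.isPullback⟩
  fac_left p y := UniformFilling.frobeniusFill_fac_left conn F₀ F₁ p
    ⟨y.cart, y.top, y.bot, y.isPullback⟩
  fac_right p y := UniformFilling.frobeniusFill_fac_right conn F₀ F₁ p
    ⟨y.cart, y.top, y.bot, y.isPullback⟩
  natural m y y' σ := UniformFilling.frobeniusFill_comp conn F₀ F₁ m
    (y := ⟨y.cart, y.top, y.bot, y.isPullback⟩) (y' := ⟨y'.cart, y'.top, y'.bot, y'.isPullback⟩)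
    ⟨σ.cart, σ.top, σ.bot⟩

variable [HasPullbacks E]

/-- Transposition of fillers for one of the two endpoint inclusions. -/
noncomputable def UniformFilling.trivCofGen {C : Type u₂} [Category.{v₂} C] {V : C ⥤ Arrow E}
    (F : UniformFilling U V) (k : Fin 2) :
    UniformFilling (cyl.trivCofGen U) (V ⋙ leibniz (cyl.δ k)) :=
  -- A uniform fibration is in particular a right map for the Leibniz products with a single
  -- endpoint, to which the transposition applies.
  match k with
  | 0 => UniformFilling.restrict (Sum.inl_ J J)
      (show UniformFilling (U ⋙ UniformFibrations.leibniz (cyl.δ 0)) _ from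
        F.ofLeibniz (Adjunction.ofIsLeftAdjoint cyl.I) _)
  | 1 => UniformFilling.restrict (Sum.inr_ J J)
      (show UniformFilling (U ⋙ UniformFibrations.leibniz (cyl.δ 1)) _ from
        F.ofLeibniz (Adjunction.ofIsLeftAdjoint cyl.I) _)

/-- If right `U`-maps have natural fillers against initial arrows and against pullbacks of Leibniz
products with `U`, then pullbacks of generating uniform trivial cofibrations along uniform
fibrations have fillers against uniform fibrations. -/
noncomputable def FrobeniusFilling.trivCofGen (F₀ : UniformFilling U (initialArrow E))
    (F₁ : ∀ k, UniformFilling U (CartOver.forget (U ⋙ leibniz (cyl.δ k)))) :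
    FrobeniusFilling (cyl.trivCofGen U) (cyl.trivCofGen U) :=
  -- Each summand `k` uses both halves of the fibration structure: the end `1 - k` to lift the
  -- homotopy, the end `k` to fill the Leibniz product.
  FrobeniusFilling.sum (.ofLeibniz conn (F₀.trivCofGen _) ((F₁ 0).trivCofGen 0))
    (.ofLeibniz conn (F₀.trivCofGen _) ((F₁ 1).trivCofGen 1))

end

end UniformFibrations

namespace UniformFibrations

/-! ### Pushforward of right maps along right maps -/

section

variable {E : Type u} [Category.{v} E] {J : Type u₁} [Category.{v₁} J] {T : J ⥤ Arrow E}

/-- The arrow in the slice category that underlies an object of the slice of right maps. -/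
abbrev Slice.left {X : E} (x : Slice (RightMap.forget T) X) : Over X := Over.mk x.a

/-- The codomain of the arrow in the slice category. -/
abbrev Slice.right {X : E} (x : Slice (RightMap.forget T) X) : Over X := Over.mk x.b

/-- The arrow in the slice category. -/
abbrev Slice.hom {X : E} (x : Slice (RightMap.forget T) X) : x.left ⟶ x.right :=
  Over.homMk x.index.arrow.hom x.w

namespace Slice

variable {X : E} {x x' : Slice (RightMap.forget T) X} (n : x ⟶ x')

/-- The upper side of the square in the slice category. -/
abbrev homLeft : x.left ⟶ x'.left := Over.homMk n.map.sq.left n.left_w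

/-- The lower side of the square in the slice category. -/
abbrev homRight : x.right ⟶ x'.right := Over.homMk n.map.sq.right n.right_w

lemma hom_comp_homRight : x.hom ≫ homRight n = homLeft n ≫ x'.hom :=
  Over.OverMorphism.ext (Arrow.w n.map.sq).symm

end Slice

/-- Compatibility on codomains of generators passes to their domains, so a morphism of generators
induces maps on both sides of the pullbacks. -/
lemma comp_gen {p p' : Arrow E} {m : p ⟶ p'} {j j' : J} {σ : j ⟶ j'}
    {v : (T.obj j).right ⟶ p.right} {v' : (T.obj j').right ⟶ p'.right}
    (h : v ≫ m.right = (T.map σ).right ≫ v') :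
    ((T.obj j).hom ≫ v) ≫ m.right = (T.map σ).left ≫ (T.obj j').hom ≫ v' := by
  rw [Category.assoc, h]
  exact (Arrow.w_assoc (T.map σ) v').symm

end

section Pushforward

variable {E : Type u} [Category.{v} E] [LocallyCartesianClosed E] {J : Type u₁} [Category.{v₁} J]
  {T : J ⥤ Arrow E}

/-- A generating arrow as an arrow over `Y`. -/
def genOver {Y : E} (j : J) (v : (T.obj j).right ⟶ Y) :
    Over.mk ((T.obj j).hom ≫ v) ⟶ Over.mk v :=
  Over.homMk (T.obj j).hom rfl

/-- The pullback of a generating arrow along a right map. -/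
noncomputable def genPullback (p : Arrow E) (j : J) (v : (T.obj j).right ⟶ p.right) :
    PullbackAlong T p where
  cart :=
    { base := j
      arrow := Arrow.mk ((Over.pullback p.hom).map (genOver j v)).left
      sq := pullbackSquare p.hom (genOver j v)
      isPullback := isPullback_pullback_map p.hom (genOver j v) }
  top := pullback.snd v p.hom
  bot := v
  isPullback := (IsPullback.of_hasPullback v p.hom).flip

/-- A square in a slice category from the pullback of a generating arrow. -/
structure GenSquare (p : RightMap T) (j : J) (v : (T.obj j).right ⟶ p.arrow.right)
    (x : Slice (RightMap.forget T) p.arrow.left) where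
  /-- the upper side -/
  top : (Over.pullback p.arrow.hom).obj (Over.mk ((T.obj j).hom ≫ v)) ⟶ x.left
  /-- the lower side -/
  bot : (Over.pullback p.arrow.hom).obj (Over.mk v) ⟶ x.right
  w : top ≫ x.hom = (Over.pullback p.arrow.hom).map (genOver j v) ≫ bot

/-- The underlying square of a square in a slice category. -/
noncomputable def GenSquare.sq {p : RightMap T} {j : J} {v : (T.obj j).right ⟶ p.arrow.right}
    {x : Slice (RightMap.forget T) p.arrow.left} (t : GenSquare p j v x) :
    (genPullback p.arrow j v).cart.arrow ⟶ x.index.arrow :=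
  Arrow.homMk t.top.left t.bot.left (congrArg (fun z => z.left) t.w)

namespace FrobeniusFilling

variable (F : FrobeniusFilling T T)

/-- The filler in the slice category. -/
noncomputable def overFill {p : RightMap T} {j : J} {v : (T.obj j).right ⟶ p.arrow.right}
    {x : Slice (RightMap.forget T) p.arrow.left} (t : GenSquare p j v x) :
    (Over.pullback p.arrow.hom).obj (Over.mk v) ⟶ x.left :=
  Over.homMk (F.fill p (genPullback p.arrow j v) x.index t.sq) (by
    have h := F.fac_right p (genPullback p.arrow j v) x.index t.sq
    have hw : x.index.arrow.hom ≫ x.b = x.a := x.w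
    exact (congrArg (fun z => _ ≫ z) hw).symm.trans ((Category.assoc _ _ _).symm.trans
      ((congrArg (fun z => z ≫ x.b) h).trans (Over.w t.bot))))

lemma map_overFill {p : RightMap T} {j : J} {v : (T.obj j).right ⟶ p.arrow.right}
    {x : Slice (RightMap.forget T) p.arrow.left} (t : GenSquare p j v x) :
    (Over.pullback p.arrow.hom).map (genOver j v) ≫ F.overFill t = t.top :=
  Over.OverMorphism.ext (F.fac_left p (genPullback p.arrow j v) x.index t.sq)

lemma overFill_hom {p : RightMap T} {j : J} {v : (T.obj j).right ⟶ p.arrow.right}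
    {x : Slice (RightMap.forget T) p.arrow.left} (t : GenSquare p j v x) :
    F.overFill t ≫ x.hom = t.bot :=
  Over.OverMorphism.ext (F.fac_right p (genPullback p.arrow j v) x.index t.sq)

end FrobeniusFilling

/-- The map between pullbacks that is induced by a square and a compatible map. -/
noncomputable def pullbackMap {p p' : Arrow E} (m : p ⟶ p') {Z Z' : E} {v : Z ⟶ p.right}
    {v' : Z' ⟶ p'.right} (e : Z ⟶ Z') (h : v ≫ m.right = e ≫ v') :
    ((Over.pullback p.hom).obj (Over.mk v)).left ⟶ ((Over.pullback p'.hom).obj (Over.mk v')).left :=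
  pullback.map v p.hom v' p'.hom e m.left m.right h (Arrow.w m).symm

lemma pullbackMap_fst {p p' : Arrow E} (m : p ⟶ p') {Z Z' : E} {v : Z ⟶ p.right}
    {v' : Z' ⟶ p'.right} (e : Z ⟶ Z') (h : v ≫ m.right = e ≫ v') :
    pullbackMap m e h ≫ pullback.fst v' p'.hom = pullback.fst v p.hom ≫ e :=
  pullback.lift_fst _ _ _

lemma pullbackMap_snd {p p' : Arrow E} (m : p ⟶ p') {Z Z' : E} {v : Z ⟶ p.right}
    {v' : Z' ⟶ p'.right} (e : Z ⟶ Z') (h : v ≫ m.right = e ≫ v') :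
    pullbackMap m e h ≫ pullback.snd v' p'.hom = pullback.snd v p.hom ≫ m.left :=
  pullback.lift_snd _ _ _

/-- Functoriality of the pullback of generating arrows. -/
noncomputable def genPullbackMap {p p' : Arrow E} (m : p ⟶ p') {j j' : J} (σ : j ⟶ j')
    {v : (T.obj j).right ⟶ p.right} {v' : (T.obj j').right ⟶ p'.right}
    (h : v ≫ m.right = (T.map σ).right ≫ v') :
    PullbackAlong.Hom m (genPullback p j v) (genPullback p' j' v') where
  cart :=
    { base := σ
      top := Arrow.homMk (pullbackMap m (T.map σ).left (comp_gen h))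
        (pullbackMap m (T.map σ).right h) (by
          apply pullback.hom_ext
          · refine (Category.assoc _ _ _).trans ?_
            refine (congrArg (fun z => _ ≫ z) (pullback.lift_fst _ _ _)).trans ?_
            refine Eq.trans ?_ (Category.assoc _ _ _).symm
            refine Eq.trans ?_ (congrArg (fun z => _ ≫ z) (pullbackMap_fst _ _ _)).symm
            refine Eq.trans ?_ (pullback.lift_fst_assoc _ _ _ _).symm
            refine (Category.assoc _ _ _).symm.trans ?_
            refine (congrArg (fun z => z ≫ _) (pullbackMap_fst _ _ _)).trans ?_
            refine (Category.assoc _ _ _).trans (Eq.trans ?_ (Category.assoc _ _ _).symm)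
            exact congrArg (fun z => _ ≫ z) (Arrow.w (T.map σ))
          · refine (Category.assoc _ _ _).trans ?_
            refine (congrArg (fun z => _ ≫ z) (pullback.lift_snd _ _ _)).trans ?_
            refine Eq.trans ?_ (Category.assoc _ _ _).symm
            refine Eq.trans ?_ (congrArg (fun z => _ ≫ z) (pullbackMap_snd _ _ _)).symm
            refine Eq.trans ?_ (pullback.lift_snd_assoc _ _ _ _).symm
            exact pullbackMap_snd _ _ _)
      comm := by
        apply Arrow.hom_ext
        · exact pullbackMap_fst _ _ (comp_gen h)
        · exact pullbackMap_fst _ _ h }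
  top := (pullbackMap_snd _ _ h).symm
  bot := h

/-- The objects `x` and `x'` live over different bases, so the comparison is one of underlying maps
in `E`; it is naturality of `F` along `genPullbackMap`. -/
lemma FrobeniusFilling.overFill_comp (F : FrobeniusFilling T T) {p p' : RightMap T} (m : p ⟶ p')
    {j j' : J} (σ : j ⟶ j') {v : (T.obj j).right ⟶ p.arrow.right}
    {v' : (T.obj j').right ⟶ p'.arrow.right} (h : v ≫ m.sq.right = (T.map σ).right ≫ v')
    {x : Slice (RightMap.forget T) p.arrow.left} {x' : Slice (RightMap.forget T) p'.arrow.left}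
    (n : x.index ⟶ x'.index) (t : GenSquare p j v x) (t' : GenSquare p' j' v' x')
    (hl : t.top.left ≫ n.sq.left = pullbackMap m.sq (T.map σ).left (comp_gen h) ≫ t'.top.left)
    (hr : t.bot.left ≫ n.sq.right = pullbackMap m.sq (T.map σ).right h ≫ t'.bot.left) :
    (F.overFill t).left ≫ n.sq.left = pullbackMap m.sq (T.map σ).right h ≫ (F.overFill t').left :=
  F.natural m (genPullbackMap m.sq σ h) n t.sq t'.sq (Arrow.hom_ext _ _ hl hr)

/-- Lets `overFill_comp`, at the identity of `p`, be read as a statement about the functor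
`Over.pullback`. -/
lemma pullback_map_left {p : Arrow E} {Z Z' : Over p.right} (e : Z ⟶ Z')
    (h : Z.hom ≫ Arrow.Hom.right (𝟙 p) = e.left ≫ Z'.hom) :
    ((Over.pullback p.hom).map e).left = pullbackMap (𝟙 p) e.left h := by
  apply pullback.hom_ext
  · exact (pullback.lift_fst _ _ _).trans (pullbackMap_fst _ _ _).symm
  · refine (pullback.lift_snd _ _ _).trans (Eq.trans ?_ (pullbackMap_snd _ _ _).symm)
    exact (Category.comp_id _).symm

section

variable {X Y : E} {f : X ⟶ Y} {x : Slice (RightMap.forget T) X} {j : J}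
  (sq : T.obj j ⟶ Arrow.mk ((pushforward f).map x.hom).left)

/-- The upper side of a square to a pushforward, as a map over the base. -/
noncomputable def pushTop : Over.mk ((T.obj j).hom ≫ sq.right ≫
    ((pushforward f).obj x.right).hom) ⟶ (pushforward f).obj x.left :=
  Over.homMk sq.left (by
    have h := Arrow.w sq
    have h' := Over.w ((pushforward f).map x.hom)
    change sq.left ≫ _ = _ ≫ _ ≫ _
    rw [← h', ← Category.assoc]
    exact (congrArg (fun z => z ≫ _) h).trans (Category.assoc _ _ _))

/-- The lower side of a square to a pushforward, as a map over the base. -/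
noncomputable def pushBot : Over.mk (sq.right ≫ ((pushforward f).obj x.right).hom) ⟶
    (pushforward f).obj x.right :=
  Over.homMk sq.right rfl

lemma pushTop_map : pushTop sq ≫ (pushforward f).map x.hom =
    genOver j (sq.right ≫ ((pushforward f).obj x.right).hom) ≫ pushBot sq :=
  Over.OverMorphism.ext (Arrow.w sq)

end

/-- The transpose of a square to a pushforward. -/
noncomputable def pushSquare (p : RightMap T) (x : Slice (RightMap.forget T) p.arrow.left) {j : J}
    (sq : T.obj j ⟶ Arrow.mk ((pushforward p.arrow.hom).map x.hom).left) :
    GenSquare p j (sq.right ≫ ((pushforward p.arrow.hom).obj x.right).hom) x where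
  top := ((pushforwardAdj p.arrow.hom).homEquiv _ _).symm (pushTop sq)
  bot := ((pushforwardAdj p.arrow.hom).homEquiv _ _).symm (pushBot sq)
  w := by
    rw [← Adjunction.homEquiv_naturality_right_symm, ← Adjunction.homEquiv_naturality_left_symm,
      pushTop_map]

/-- The square between pushforwards that is induced by a morphism in the slice of right maps. -/
noncomputable def pushMap {X Y : E} (f : X ⟶ Y) {x x' : Slice (RightMap.forget T) X} (n : x ⟶ x') :
    Arrow.mk ((pushforward f).map x.hom).left ⟶ Arrow.mk ((pushforward f).map x'.hom).left :=
  Arrow.homMk' ((pushforward f).map (Slice.homLeft n)).left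
    ((pushforward f).map (Slice.homRight n)).left (by
      rw [← Over.comp_left, ← Over.comp_left, ← Functor.map_comp, ← Functor.map_comp,
        Slice.hom_comp_homRight])

namespace FrobeniusFilling

variable (F : FrobeniusFilling T T)

/-- The filler of a square from a generating arrow to a pushforward. -/
noncomputable def pushFill (p : RightMap T) (x : Slice (RightMap.forget T) p.arrow.left) {j : J}
    (sq : T.obj j ⟶ Arrow.mk ((pushforward p.arrow.hom).map x.hom).left) :
    Over.mk (sq.right ≫ ((pushforward p.arrow.hom).obj x.right).hom) ⟶
      (pushforward p.arrow.hom).obj x.left :=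
  (pushforwardAdj p.arrow.hom).homEquiv _ _ (F.overFill (pushSquare p x sq))

/-- Precomposition with the generator transposes to precomposition with its pullback, where the
Frobenius filler has the right restriction. -/
lemma pushFill_fac_left (p : RightMap T) (x : Slice (RightMap.forget T) p.arrow.left) {j : J}
    (sq : T.obj j ⟶ Arrow.mk ((pushforward p.arrow.hom).map x.hom).left) :
    (T.obj j).hom ≫ (F.pushFill p x sq).left = sq.left := by
  have h : genOver j _ ≫ F.pushFill p x sq = pushTop sq := by
    rw [pushFill, ← Adjunction.homEquiv_naturality_left, map_overFill]
    exact Equiv.apply_symm_apply _ _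
  exact congrArg (fun z => z.left) h

lemma pushFill_fac_right (p : RightMap T) (x : Slice (RightMap.forget T) p.arrow.left) {j : J}
    (sq : T.obj j ⟶ Arrow.mk ((pushforward p.arrow.hom).map x.hom).left) :
    (F.pushFill p x sq).left ≫ ((pushforward p.arrow.hom).map x.hom).left = sq.right := by
  have h : F.pushFill p x sq ≫ (pushforward p.arrow.hom).map x.hom = pushBot sq := by
    rw [pushFill, ← Adjunction.homEquiv_naturality_right, overFill_hom]
    exact Equiv.apply_symm_apply _ _
  exact congrArg (fun z => z.left) h

/-- After transposition this is naturality of the Frobenius fillers at the identity of `p`. Taking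
`n` to be an identity gives uniformity in the generator; taking `σ` to be one gives functoriality in
the right map. -/
lemma pushFill_comp {p : RightMap T} {x x' : Slice (RightMap.forget T) p.arrow.left} (n : x ⟶ x')
    {j j' : J} (σ : j ⟶ j') (sq : T.obj j ⟶ Arrow.mk ((pushforward p.arrow.hom).map x.hom).left)
    (sq' : T.obj j' ⟶ Arrow.mk ((pushforward p.arrow.hom).map x'.hom).left)
    (h : sq ≫ pushMap p.arrow.hom n = T.map σ ≫ sq') :
    (F.pushFill p x sq).left ≫ ((pushforward p.arrow.hom).map (Slice.homLeft n)).left =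
      (T.map σ).right ≫ (F.pushFill p x' sq').left := by
  have hl : sq.left ≫ ((pushforward p.arrow.hom).map (Slice.homLeft n)).left =
    (T.map σ).left ≫ sq'.left := congrArg (fun z => z.left) h
  have hr : sq.right ≫ ((pushforward p.arrow.hom).map (Slice.homRight n)).left =
    (T.map σ).right ≫ sq'.right := congrArg (fun z => z.right) h
  have hv : (T.map σ).right ≫ sq'.right ≫ ((pushforward p.arrow.hom).obj x'.right).hom =
      sq.right ≫ ((pushforward p.arrow.hom).obj x.right).hom := by
    rw [← Over.w ((pushforward p.arrow.hom).map (Slice.homRight n)), reassoc_of% hr]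
  have hv₁ := comp_gen (m := 𝟙 p.arrow) (σ := σ) ((Category.comp_id _).trans hv.symm)
  let e : Over.mk (sq.right ≫ ((pushforward p.arrow.hom).obj x.right).hom) ⟶
    Over.mk (sq'.right ≫ ((pushforward p.arrow.hom).obj x'.right).hom) :=
    Over.homMk (T.map σ).right hv
  let e₀ : Over.mk ((T.obj j).hom ≫ sq.right ≫ ((pushforward p.arrow.hom).obj x.right).hom) ⟶
    Over.mk ((T.obj j').hom ≫ sq'.right ≫ ((pushforward p.arrow.hom).obj x'.right).hom) :=
    Over.homMk (T.map σ).left (hv₁.symm.trans (Category.comp_id _))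
  -- The transposed form of the claim; its hypotheses are the transposes of `hl` and `hr`.
  have h₁ : F.overFill (pushSquare p x sq) ≫ Slice.homLeft n =
      (Over.pullback p.arrow.hom).map e ≫ F.overFill (pushSquare p x' sq') := by
    apply Over.OverMorphism.ext
    refine Eq.trans ?_ (congrArg (fun z => z ≫ _)
      (pullback_map_left e ((Category.comp_id _).trans hv.symm))).symm
    refine F.overFill_comp (𝟙 p) σ ((Category.comp_id _).trans hv.symm) n.map _ _ ?_ ?_
    · refine Eq.trans ?_ (congrArg (fun z => z ≫ _) (pullback_map_left e₀ hv₁))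
      have h₂ : (pushSquare p x sq).top ≫ Slice.homLeft n =
          (Over.pullback p.arrow.hom).map e₀ ≫ (pushSquare p x' sq').top := by
        simp only [pushSquare]
        rw [← Adjunction.homEquiv_naturality_right_symm,
          ← Adjunction.homEquiv_naturality_left_symm]
        exact congrArg _ (Over.OverMorphism.ext hl)
      exact congrArg (fun z => z.left) h₂
    · refine Eq.trans ?_ (congrArg (fun z => z ≫ _)
        (pullback_map_left e ((Category.comp_id _).trans hv.symm)))
      have h₂ : (pushSquare p x sq).bot ≫ Slice.homRight n =
          (Over.pullback p.arrow.hom).map e ≫ (pushSquare p x' sq').bot := by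
        simp only [pushSquare]
        rw [← Adjunction.homEquiv_naturality_right_symm,
          ← Adjunction.homEquiv_naturality_left_symm]
        exact congrArg _ (Over.OverMorphism.ext hr)
      exact congrArg (fun z => z.left) h₂
  have h₃ : F.pushFill p x sq ≫ (pushforward p.arrow.hom).map (Slice.homLeft n) =
      e ≫ F.pushFill p x' sq' := by
    rw [pushFill, pushFill, ← Adjunction.homEquiv_naturality_right,
      ← Adjunction.homEquiv_naturality_left, h₁]
  exact congrArg (fun z => z.left) h₃

/-- The pushforward of a right map along a right map. -/
noncomputable def pushRight (p : RightMap T) (x : Slice (RightMap.forget T) p.arrow.left) :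
    RightMap T where
  arrow := Arrow.mk ((pushforward p.arrow.hom).map x.hom).left
  fill _ sq := (F.pushFill p x sq).left
  fac_left _ sq := F.pushFill_fac_left p x sq
  fac_right _ sq := F.pushFill_fac_right p x sq
  natural σ sq := by
    have hid : pushMap p.arrow.hom (𝟙 x) = 𝟙 _ := by
      apply Arrow.hom_ext
      · exact congrArg (fun z => z.left) ((pushforward p.arrow.hom).map_id x.left)
      · exact congrArg (fun z => z.left) ((pushforward p.arrow.hom).map_id x.right)
    have h := F.pushFill_comp (𝟙 x) σ (T.map σ ≫ sq) sq
      ((congrArg (fun z => _ ≫ z) hid).trans (Category.comp_id _))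
    refine h.symm.trans ?_
    exact (congrArg (fun z => _ ≫ z) (congrArg (fun z => z.left)
      ((pushforward p.arrow.hom).map_id x.left))).trans (Category.comp_id _)

/-- Pushforward along a right map as a functor between slices of right maps. -/
noncomputable def pushSlice (p : RightMap T) :
    Slice (RightMap.forget T) p.arrow.left ⥤ Slice (RightMap.forget T) p.arrow.right where
  obj x :=
    { index := F.pushRight p x
      a := ((pushforward p.arrow.hom).obj x.left).hom
      b := ((pushforward p.arrow.hom).obj x.right).hom
      w := Over.w ((pushforward p.arrow.hom).map x.hom) }
  map {x x'} n :=
    { map :=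
        { sq := pushMap p.arrow.hom n
          comm j t := by
            refine (F.pushFill_comp n (𝟙 j) t (t ≫ pushMap p.arrow.hom n) ?_).trans ?_
            · rw [T.map_id]
              exact (Category.id_comp _).symm
            · rw [T.map_id]
              exact Category.id_comp _ }
      left_w := Over.w ((pushforward p.arrow.hom).map (Slice.homLeft n))
      right_w := Over.w ((pushforward p.arrow.hom).map (Slice.homRight n)) }
  map_id x := by
    apply Slice.Hom.ext
    apply RightMap.Hom.ext
    apply Arrow.hom_ext
    · exact congrArg (fun z => z.left) ((pushforward p.arrow.hom).map_id x.left)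
    · exact congrArg (fun z => z.left) ((pushforward p.arrow.hom).map_id x.right)
  map_comp m n := by
    apply Slice.Hom.ext
    apply RightMap.Hom.ext
    apply Arrow.hom_ext
    · exact congrArg (fun z => z.left)
        ((pushforward p.arrow.hom).map_comp (Slice.homLeft m) (Slice.homLeft n))
    · exact congrArg (fun z => z.left)
        ((pushforward p.arrow.hom).map_comp (Slice.homRight m) (Slice.homRight n))

/-- The lift of pushforward along a right map to right maps. -/
noncomputable def pushLift (p : RightMap T) :
    Lift (Slice.forget (RightMap.forget T) p.arrow.left)
      (Slice.forget (RightMap.forget T) p.arrow.right) (pushforward p.arrow.hom).mapArrow where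
  functor := F.pushSlice p
  comm := rfl

end FrobeniusFilling

end Pushforward

end UniformFibrations

namespace UniformFibrations

/-! ### The Beck–Chevalley transformation -/

/-- Conjugate transformations are related through the counits. This allows the mate to be handled
only through `α`. -/
lemma homEquiv_symm_conjugateEquiv {C : Type u} [Category.{v} C] {D : Type u₁} [Category.{v₁} D]
    {L₁ L₂ : C ⥤ D} {R₁ R₂ : D ⥤ C} (adj₁ : L₁ ⊣ R₁) (adj₂ : L₂ ⊣ R₂) (α : L₂ ⟶ L₁) {c : C} {d : D}
    (z : c ⟶ R₁.obj d) :
    (adj₂.homEquiv c d).symm (z ≫ (conjugateEquiv adj₁ adj₂ α).app d) =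
      α.app c ≫ (adj₁.homEquiv c d).symm z := by
  rw [adj₂.homEquiv_naturality_left_symm, adj₁.homEquiv_counit, ← Category.assoc,
    ← NatTrans.naturality, Category.assoc, ← conjugateEquiv_counit adj₁ adj₂ α,
    adj₂.homEquiv_counit]

section

variable {E : Type u} [Category.{v} E] {J : Type u₁} [Category.{v₁} J] {U : J ⥤ Arrow E}

/-- Compatibility of `n` with the fillers, applied to a square composed with the inverse, is
compatibility of the inverse. -/
lemma RightMap.isIso_of_isIso_sq {f g : RightMap U} (n : f ⟶ g)
    [IsIso n.sq] : IsIso n := by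
  refine ⟨⟨inv n.sq, fun j t => ?_⟩, ?_, ?_⟩
  · have h := n.comm j (t ≫ inv n.sq)
    rw [Category.assoc, IsIso.inv_hom_id, Category.comp_id] at h
    rw [← h, Category.assoc, ← Arrow.comp_left, IsIso.hom_inv_id]
    exact Category.comp_id _
  · exact RightMap.Hom.ext (IsIso.hom_inv_id n.sq)
  · exact RightMap.Hom.ext (IsIso.inv_hom_id n.sq)

lemma Slice.isIso_of_isIso_map {X : E}
    {x x' : Slice U X} (n : x ⟶ x') [IsIso n.map] : IsIso n := by
  have hl : (U.map (inv n.map)).left ≫ (U.map n.map).left = 𝟙 _ := by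
    rw [← Arrow.comp_left, ← U.map_comp, IsIso.inv_hom_id, U.map_id]
    rfl
  have hr : (U.map (inv n.map)).right ≫ (U.map n.map).right = 𝟙 _ := by
    rw [← Arrow.comp_right, ← U.map_comp, IsIso.inv_hom_id, U.map_id]
    rfl
  refine ⟨⟨inv n.map, ?_, ?_⟩, ?_, ?_⟩
  · rw [← n.left_w, ← Category.assoc, hl, Category.id_comp]
  · rw [← n.right_w, ← Category.assoc, hr, Category.id_comp]
  · exact Slice.Hom.ext (IsIso.hom_inv_id n.map)
  · exact Slice.Hom.ext (IsIso.inv_hom_id n.map)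

end

section BeckChevalley

variable {E : Type u} [Category.{v} E] [LocallyCartesianClosed E]

lemma mapPullbackAdj_homEquiv_symm_left {Y V : E} (t : Y ⟶ V) {Z : Over Y} {A : Over V}
    (z : Z ⟶ (Over.pullback t).obj A) :
    (((Over.mapPullbackAdj t).homEquiv Z A).symm z).left = z.left ≫ pullback.fst A.hom t := by
  rw [Adjunction.homEquiv_counit, Over.mapPullbackAdj_counit_app]
  rfl

variable {X Y U V : E} {p : X ⟶ Y} {q : U ⟶ V} {s : X ⟶ U} {t : Y ⟶ V} (sq : s ≫ q = p ≫ t)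

/-- Beck–Chevalley is a mate with respect to two composite adjunctions, so transposing twice leaves
only the explicit comparison of pullbacks. -/
lemma beckChevalley_transpose {Z : Over Y} {A : Over U}
    (z : Z ⟶ (Over.pullback t).obj ((pushforward q).obj A)) :
    ((Over.mapPullbackAdj s).homEquiv _ _).symm (((pushforwardAdj p).homEquiv _ _).symm
        (z ≫ (beckChevalley sq).app A)) =
      (beckChevalleyPullback sq).app Z ≫ ((pushforwardAdj q).homEquiv _ _).symm
        (((Over.mapPullbackAdj t).homEquiv _ _).symm z) := by
  have h := homEquiv_symm_conjugateEquiv ((Over.mapPullbackAdj t).comp (pushforwardAdj q))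
    ((pushforwardAdj p).comp (Over.mapPullbackAdj s)) (beckChevalleyPullback sq) z
  simpa only [Adjunction.comp_homEquiv] using! h

/-- The transpose of a map into a pushforward, composed with the Beck–Chevalley transformation, is
a composite with the transpose of the original map. -/
lemma beckChevalley_transpose_left {Z : Over Y} {A : Over U}
    (z : Z ⟶ (Over.pullback t).obj ((pushforward q).obj A)) {Z' : Over V}
    (z' : Z' ⟶ (pushforward q).obj A) (e : Z.left ⟶ Z'.left) (he : Z.hom ≫ t = e ≫ Z'.hom)
    (h : z.left ≫ pullback.fst _ _ = e ≫ z'.left) :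
    (((pushforwardAdj p).homEquiv _ _).symm (z ≫ (beckChevalley sq).app A)).left ≫
        pullback.fst A.hom s =
      pullbackMap (p := Arrow.mk p) (p' := Arrow.mk q) (Arrow.homMk' s t sq) e he ≫
        (((pushforwardAdj q).homEquiv _ _).symm z').left := by
  let e' : (Over.map t).obj Z ⟶ Z' := Over.homMk e he.symm
  have h₁ : ((Over.mapPullbackAdj t).homEquiv _ _).symm z = e' ≫ z' :=
    Over.OverMorphism.ext ((mapPullbackAdj_homEquiv_symm_left t z).trans h)
  have h₂ := congrArg (fun w => w.left) (beckChevalley_transpose sq z)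
  rw [h₁, (pushforwardAdj q).homEquiv_naturality_left_symm e' z'] at h₂
  refine ((mapPullbackAdj_homEquiv_symm_left s _).symm.trans h₂).trans ?_
  refine (Category.assoc _ _ _).symm.trans (congrArg (fun w => w ≫ _) ?_)
  apply pullback.hom_ext
  · refine (Category.assoc _ _ _).trans ?_
    refine (congrArg (fun w => _ ≫ w) (pullback.lift_fst _ _ _)).trans ?_
    refine (pullback.lift_fst_assoc _ _ _ _).trans (pullbackMap_fst (p := Arrow.mk p) (p' := Arrow.mk q) (Arrow.homMk' s t sq) e he).symm
  · refine (Category.assoc _ _ _).trans ?_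
    refine (congrArg (fun w => _ ≫ w) (pullback.lift_snd _ _ _)).trans ?_
    refine (pullback.lift_snd _ _ _).trans (pullbackMap_snd (p := Arrow.mk p) (p' := Arrow.mk q) (Arrow.homMk' s t sq) e he).symm

/-- By pasting, the pullback of `Z` along `p` is also a pullback of `Z ⟶ V` along `q`; the
comparison of pullbacks is then invertible, and so is its mate. -/
lemma isIso_beckChevalley (h : IsPullback s p q t) : IsIso (beckChevalley h.w) := by
  have : ∀ Z, IsIso ((beckChevalleyPullback h.w).app Z) := by
    intro Z
    have h₁ := (IsPullback.of_hasPullback Z.hom p).flip.paste_horiz h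
    have h₂ : ((beckChevalleyPullback h.w).app Z).left =
        (h₁.isoIsPullback _ _ (IsPullback.of_hasPullback (Z.hom ≫ t) q).flip).hom := by
      apply pullback.hom_ext
      · refine (pullback.lift_fst _ _ _).trans ?_
        exact (IsPullback.isoIsPullback_hom_snd _ _ _ _).symm
      · refine (pullback.lift_snd _ _ _).trans ?_
        exact (IsPullback.isoIsPullback_hom_fst _ _ _ _).symm
    have : IsIso ((Over.forget U).map ((beckChevalleyPullback h.w).app Z)) := by
      change IsIso ((beckChevalleyPullback h.w).app Z).left
      rw [h₂]
      infer_instance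
    exact isIso_of_reflects_iso _ (Over.forget U)
  have := NatIso.isIso_of_isIso_app (beckChevalleyPullback h.w)
  exact conjugateEquiv_iso _ _ _

end BeckChevalley

/-! ### The Beck–Chevalley transformation on right maps -/

section

variable {E : Type u} [Category.{v} E] [LocallyCartesianClosed E] {J : Type u₁} [Category.{v₁} J]
  {T : J ⥤ Arrow E} (F : FrobeniusFilling T T)

/-- A base change of a right map, as a right map over the new base, maps to the original one. -/
noncomputable def pullbackSliceMap {X U : E} (s : X ⟶ U) (x : Slice (RightMap.forget T) U) :
    ((pullbackSlice s).obj x).index ⟶ x.index where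
  sq := pullbackSquare s x.hom
  comm _ _ := (isPullback_pullback_map s x.hom).lift_fst _ _ _

/-- The square that is given by the Beck–Chevalley transformation. -/
noncomputable def beckChevalleySquare {p q : Arrow E} (m : p ⟶ q) {A B : Over q.left}
    (f : A ⟶ B) :
    Arrow.mk ((Over.pullback m.right).map ((pushforward q.hom).map f)).left ⟶
      Arrow.mk ((pushforward p.hom).map ((Over.pullback m.left).map f)).left :=
  Arrow.homMk' ((beckChevalley (Arrow.w m)).app A).left ((beckChevalley (Arrow.w m)).app B).left
    (congrArg (fun z => z.left) ((beckChevalley (Arrow.w m)).naturality f)).symm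

namespace FrobeniusFilling

/-- Both sides are transposed along pullback by `p` and projected to the domain of `x`. There the
left side becomes the Frobenius filler for `q`, precomposed with the comparison of pullbacks.
Naturality of the Frobenius fillers along `m` identifies this with the filler for `p` into the base
change of `x`. -/
lemma fill_beckChevalleySquare {p q : RightMap T} (m : p ⟶ q)
    (x : Slice (RightMap.forget T) q.arrow.left) {j : J}
    (sq : T.obj j ⟶ Arrow.mk ((Over.pullback m.sq.right).map
      ((pushforward q.arrow.hom).map x.hom)).left)
    (z : (T.obj j).right ⟶ ((Over.pullback m.sq.right).obj
      ((pushforward q.arrow.hom).obj x.left)).left)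
    (hz : z ≫ pullback.fst _ _ = (F.pushFill q x
      (sq ≫ pullbackSquare m.sq.right ((pushforward q.arrow.hom).map x.hom))).left)
    (hz' : z ≫ ((Over.pullback m.sq.right).map ((pushforward q.arrow.hom).map x.hom)).left =
      sq.right) :
    z ≫ ((beckChevalley (Arrow.w m.sq)).app x.left).left =
      (F.pushFill p ((pullbackSlice m.sq.left).obj x)
        (sq ≫ beckChevalleySquare m.sq x.hom)).left := by
  let x' := (pullbackSlice m.sq.left).obj x
  let bc := beckChevalley (Arrow.w m.sq)
  let κ := pullbackSquare m.sq.right ((pushforward q.arrow.hom).map x.hom)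
  let v : (T.obj j).right ⟶ p.arrow.right := (sq ≫ beckChevalleySquare m.sq x.hom).right ≫
    ((pushforward p.arrow.hom).obj x'.right).hom
  let v' : (T.obj j).right ⟶ q.arrow.right := (sq ≫ κ).right ≫
    ((pushforward q.arrow.hom).obj x.right).hom
  have hv : v = sq.right ≫ pullback.snd _ _ :=
    (Category.assoc _ _ _).trans (congrArg (fun w => sq.right ≫ w) (Over.w (bc.app x.right)))
  -- The generator stays fixed; only the fibration changes, along `m`.
  have h : v ≫ m.sq.right = (T.map (𝟙 j)).right ≫ v' := by
    rw [hv, T.map_id]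
    refine Eq.trans ?_ (Category.id_comp _).symm
    refine (Category.assoc _ _ _).trans (Eq.trans ?_ (Category.assoc _ _ _).symm)
    exact congrArg (fun w => sq.right ≫ w) pullback.condition.symm
  have hw := Over.w ((Over.pullback m.sq.right).map ((pushforward q.arrow.hom).map x.hom))
  -- The lower side, the upper side and the filler `z`, as maps over the codomain of `p`.
  let zb : Over.mk v ⟶ (Over.pullback m.sq.right).obj ((pushforward q.arrow.hom).obj x.right) :=
    Over.homMk sq.right hv.symm
  let zt : Over.mk ((T.obj j).hom ≫ v) ⟶
      (Over.pullback m.sq.right).obj ((pushforward q.arrow.hom).obj x.left) :=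
    Over.homMk sq.left (by
      rw [hv]
      refine (congrArg (fun w => sq.left ≫ w) hw.symm).trans ?_
      refine (Category.assoc _ _ _).symm.trans ?_
      exact (congrArg (fun w => w ≫ _) (Arrow.w sq)).trans (Category.assoc _ _ _))
  let zf : Over.mk v ⟶ (Over.pullback m.sq.right).obj ((pushforward q.arrow.hom).obj x.left) :=
    Over.homMk z (by
      rw [hv]
      refine (congrArg (fun w => z ≫ w) hw.symm).trans ?_
      exact (Category.assoc _ _ _).symm.trans (congrArg (fun w => w ≫ _) hz'))
  have htop : zt ≫ bc.app x.left = pushTop (x := x') (sq ≫ beckChevalleySquare m.sq x.hom) :=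
    Over.OverMorphism.ext rfl
  have hbot : zb ≫ bc.app x.right = pushBot (x := x') (sq ≫ beckChevalleySquare m.sq x.hom) :=
    Over.OverMorphism.ext rfl
  have key : zf ≫ bc.app x.left =
      F.pushFill p x' (sq ≫ beckChevalleySquare m.sq x.hom) := by
    apply ((pushforwardAdj p.arrow.hom).homEquiv _ _).symm.injective
    refine Eq.trans ?_ (Equiv.symm_apply_apply _ _).symm
    apply Over.OverMorphism.ext
    apply pullback.hom_ext
    · refine (beckChevalley_transpose_left (Arrow.w m.sq) zf (F.pushFill q x (sq ≫ κ))
        (T.map (𝟙 j)).right h ?_).trans ?_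
      · rw [T.map_id]
        exact hz.trans (Category.id_comp _).symm
      · refine Eq.trans ?_ (F.overFill_comp m (𝟙 j) h (pullbackSliceMap m.sq.left x)
          (pushSquare p x' (sq ≫ beckChevalleySquare m.sq x.hom)) (pushSquare q x (sq ≫ κ))
          ?_ ?_).symm
        · have hs : ((pushforwardAdj q.arrow.hom).homEquiv _ _).symm (F.pushFill q x (sq ≫ κ)) =
              F.overFill (pushSquare q x (sq ≫ κ)) := Equiv.symm_apply_apply _ _
          exact congrArg (fun w => pullbackMap m.sq _ h ≫ Over.Hom.left w) hs
        -- The sides of the two transposed squares correspond by the same transposition formula as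
        -- the fillers.
        · refine (congrArg (fun w => (((pushforwardAdj p.arrow.hom).homEquiv _ _).symm w).left ≫
            pullback.fst x.left.hom m.sq.left) htop.symm).trans ?_
          refine beckChevalley_transpose_left (Arrow.w m.sq) zt (pushTop (sq ≫ κ))
            (T.map (𝟙 j)).left (comp_gen h) ?_
          rw [T.map_id]
          exact (Category.id_comp _).symm
        · refine (congrArg (fun w => (((pushforwardAdj p.arrow.hom).homEquiv _ _).symm w).left ≫
            pullback.fst x.right.hom m.sq.left) hbot.symm).trans ?_
          refine beckChevalley_transpose_left (Arrow.w m.sq) zb (pushBot (sq ≫ κ))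
            (T.map (𝟙 j)).right h ?_
          rw [T.map_id]
          exact (Category.id_comp _).symm
    -- The other projection carries no information: both transposes are maps over the domain of `p`.
    · exact (Over.w (((pushforwardAdj p.arrow.hom).homEquiv _ _).symm
        (zf ≫ bc.app x.left))).trans
        (Over.w (F.overFill (pushSquare p x' (sq ≫ beckChevalleySquare m.sq x.hom)))).symm
  exact congrArg (fun w => w.left) key

/-- The components of the lift of the Beck–Chevalley transformation. -/
noncomputable def beckChevalleyRight {p q : RightMap T} (m : p ⟶ q)
    (x : Slice (RightMap.forget T) q.arrow.left) :
    ((pullbackSlice m.sq.right).obj ((F.pushSlice q).obj x)).index ⟶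
      F.pushRight p ((pullbackSlice m.sq.left).obj x) where
  sq := beckChevalleySquare m.sq x.hom
  comm _ sq := F.fill_beckChevalleySquare m x sq _
    ((isPullback_pullback_map m.sq.right ((pushforward q.arrow.hom).map x.hom)).lift_fst _ _ _)
    ((isPullback_pullback_map m.sq.right ((pushforward q.arrow.hom).map x.hom)).lift_snd _ _ _)

/-- The lift of the Beck–Chevalley transformation. -/
noncomputable def beckChevalleyLift {p q : RightMap T} (m : p ⟶ q) :
    F.pushSlice q ⋙ pullbackSlice m.sq.right ⟶ pullbackSlice m.sq.left ⋙ F.pushSlice p where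
  app x :=
    { map := F.beckChevalleyRight m x
      left_w := Over.w ((beckChevalley (Arrow.w m.sq)).app x.left)
      right_w := Over.w ((beckChevalley (Arrow.w m.sq)).app x.right) }
  naturality x x' n := by
    apply Slice.Hom.ext
    apply RightMap.Hom.ext
    apply Arrow.hom_ext
    · exact congrArg (fun z => z.left)
        ((beckChevalley (Arrow.w m.sq)).naturality (Slice.homLeft n))
    · exact congrArg (fun z => z.left)
        ((beckChevalley (Arrow.w m.sq)).naturality (Slice.homRight n))

end FrobeniusFilling

lemma isIso_beckChevalleySquare {p q : Arrow E} (m : p ⟶ q)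
    (h : IsPullback m.left p.hom q.hom m.right) {A B : Over q.left} (f : A ⟶ B) :
    IsIso (beckChevalleySquare m f) := by
  have := isIso_beckChevalley h
  have (Z : Over q.left) : IsIso ((beckChevalley (Arrow.w m)).app Z).left :=
    inferInstanceAs (IsIso ((Over.forget _).map ((beckChevalley h.w).app Z)))
  have hA : IsIso (beckChevalleySquare m f).left := this A
  have hB : IsIso (beckChevalleySquare m f).right := this B
  exact Arrow.isIso_of_isIso_left_of_isIso_right _

theorem FrobeniusFilling.pushforwardLifts (F : FrobeniusFilling T T) : PushforwardLifts T := by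
  refine ⟨F.pushLift, fun p q m => ⟨F.beckChevalleyLift m, ?_, fun h => ?_⟩⟩
  · apply NatTrans.ext
    funext x
    -- Both lifts commute strictly with the forgetful functors, so the components of the two
    -- `eqToHom` are identities.
    simp only [NatTrans.comp_app, eqToHom_app]
    refine Eq.trans ?_ (Category.id_comp _).symm
    exact (Category.comp_id _).symm
  · have hx (x) : IsIso ((F.beckChevalleyLift m).app x) := by
      have : IsIso ((F.beckChevalleyLift m).app x).map.sq :=
        isIso_beckChevalleySquare m.sq h x.hom
      have := RightMap.isIso_of_isIso_sq ((F.beckChevalleyLift m).app x).map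
      exact Slice.isIso_of_isIso_map _
    exact NatIso.isIso_of_isIso_app (F.beckChevalleyLift m)

end

end UniformFibrations

namespace UniformFibrations

/-! ### Right maps of algebraically-free awfs have fillers against coalgebras -/

namespace AWFS

section

variable {E : Type u} [Category.{v} E] (W : AWFS E)

/-- The unit of `R` is the identity on codomains, so the unit law leaves no choice. -/
lemma algebra_a_right (a : W.monad.Algebra) : a.a.right = 𝟙 a.A.right :=
  (Category.id_comp _).symm.trans (congrArg (fun z => z.right) a.unit)

/-- The filler of a square from a coalgebra to an algebra. -/
def algebraFill (a : W.monad.Algebra) (c : W.LeftMap) (sq : c.arrow ⟶ a.A) :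
    c.arrow.right ⟶ a.A.left :=
  c.str.right ≫ W.F.Z.map sq ≫ a.a.left

lemma LeftMap.str_left {W : AWFS E} (c : W.LeftMap) : c.str.left = 𝟙 c.arrow.left :=
  (Category.comp_id _).symm.trans (congrArg (fun z => z.left) c.counit)

lemma LeftMap.hom_str_right {W : AWFS E} (c : W.LeftMap) :
    c.arrow.hom ≫ c.str.right = W.F.i.app c.arrow := by
  have h : c.str.left ≫ W.F.i.app c.arrow = c.arrow.hom ≫ c.str.right := Arrow.w c.str
  rw [← h, c.str_left]
  exact Category.id_comp _

lemma LeftMap.str_right_p {W : AWFS E} (c : W.LeftMap) :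
    c.str.right ≫ W.F.p.app c.arrow = 𝟙 c.arrow.right :=
  congrArg (fun z => z.right) c.counit

/-- The counit law identifies the composite with the left factor `i`; naturality carries `i` past
the square, and the unit law of the algebra cancels it. -/
lemma hom_algebraFill (a : W.monad.Algebra) (c : W.LeftMap) (sq : c.arrow ⟶ a.A) :
    c.arrow.hom ≫ W.algebraFill a c sq = sq.left := by
  have h₁ : sq.left ≫ W.F.i.app a.A = W.F.i.app c.arrow ≫ W.F.Z.map sq := W.F.i.naturality sq
  have h₂ : W.F.i.app a.A ≫ a.a.left = 𝟙 a.A.left := congrArg (fun z => z.left) a.unit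
  unfold algebraFill
  refine (Category.assoc _ _ _).symm.trans ?_
  refine (congrArg (fun z => z ≫ _) c.hom_str_right).trans ?_
  refine (Category.assoc _ _ _).symm.trans ?_
  refine (congrArg (fun z => z ≫ a.a.left) h₁.symm).trans ((Category.assoc _ _ _).trans ?_)
  exact (congrArg (fun z => sq.left ≫ z) h₂).trans (Category.comp_id _)

/-- The algebra structure lies over the right factor `p`; naturality carries `p` past the square,
and the counit law of the coalgebra cancels it. -/
lemma algebraFill_hom (a : W.monad.Algebra) (c : W.LeftMap) (sq : c.arrow ⟶ a.A) :
    W.algebraFill a c sq ≫ a.A.hom = sq.right := by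
  have h₁ : W.F.Z.map sq ≫ W.F.p.app a.A = W.F.p.app c.arrow ≫ sq.right := W.F.p.naturality sq
  have h₂ : a.a.left ≫ a.A.hom = W.F.p.app a.A ≫ a.a.right := Arrow.w a.a
  have h₃ : a.a.left ≫ a.A.hom = W.F.p.app a.A :=
    h₂.trans ((congrArg (fun z => _ ≫ z) (W.algebra_a_right a)).trans (Category.comp_id _))
  have h₄ := c.str_right_p
  unfold algebraFill
  refine (Category.assoc _ _ _).trans ?_
  refine (congrArg (fun z => c.str.right ≫ z) ((Category.assoc _ _ _).trans
    ((congrArg (fun z => W.F.Z.map sq ≫ z) h₃).trans h₁))).trans ?_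
  refine (Category.assoc _ _ _).symm.trans ?_
  exact (congrArg (fun z => z ≫ sq.right) h₄).trans (Category.id_comp _)

lemma algebraFill_comp {a a' : W.monad.Algebra} (m : a ⟶ a') {c c' : W.LeftMap} (n : c ⟶ c')
    (sq : c.arrow ⟶ a.A) (sq' : c'.arrow ⟶ a'.A) (h : sq ≫ m.f = n.sq ≫ sq') :
    W.algebraFill a c sq ≫ m.f.left = n.sq.right ≫ W.algebraFill a' c' sq' := by
  have h₁ : W.F.Z.map m.f ≫ a'.a.left = a.a.left ≫ m.f.left := congrArg (fun z => z.left) m.h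
  have h₂ : c.str.right ≫ W.F.Z.map n.sq = n.sq.right ≫ c'.str.right :=
    congrArg (fun z => z.right) n.comm
  have h₃ : W.F.Z.map sq ≫ W.F.Z.map m.f = W.F.Z.map n.sq ≫ W.F.Z.map sq' := by
    rw [← Functor.map_comp, h, Functor.map_comp]
  unfold algebraFill
  refine (Category.assoc _ _ _).trans ?_
  refine (congrArg (fun z => c.str.right ≫ z) ((Category.assoc _ _ _).trans
    (congrArg (fun z => W.F.Z.map sq ≫ z) h₁.symm))).trans ?_
  refine (congrArg (fun z => c.str.right ≫ z) ((Category.assoc _ _ _).symm.trans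
    ((congrArg (fun z => z ≫ a'.a.left) h₃).trans (Category.assoc _ _ _)))).trans ?_
  refine (Category.assoc _ _ _).symm.trans ?_
  exact (congrArg (fun z => z ≫ _) h₂).trans (Category.assoc _ _ _)

variable {J : Type u₁} [Category.{v₁} J] {U : J ⥤ Arrow E} {W}

/-- Right maps have fillers against coalgebras if they are algebras for the monad. -/
def fillingOfAlgebras (H : RightMap U ⥤ W.monad.Algebra)
    (e : H ⋙ W.monad.forget ≅ RightMap.forget U) :
    UniformFilling U (LeftMap.forget W) where
  fill g c sq := W.algebraFill (H.obj g) c (sq ≫ e.inv.app g) ≫ (e.hom.app g).left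
  fac_left g c sq := by
    refine (Category.assoc _ _ _).symm.trans ?_
    refine (congrArg (fun z => z ≫ _) (W.hom_algebraFill (H.obj g) c (sq ≫ e.inv.app g))).trans ?_
    exact congrArg (fun z => z.left) ((Category.assoc _ _ _).trans
      ((congrArg (fun z => sq ≫ z) (e.inv_hom_id_app g)).trans (Category.comp_id sq)))
  fac_right g c sq := by
    refine (Category.assoc _ _ _).trans ?_
    refine (congrArg (fun z => _ ≫ z) (Arrow.w (e.hom.app g))).trans ?_
    refine (Category.assoc _ _ _).symm.trans ?_
    refine (congrArg (fun z => z ≫ _) (W.algebraFill_hom (H.obj g) c (sq ≫ e.inv.app g))).trans ?_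
    exact congrArg (fun z => z.right) ((Category.assoc _ _ _).trans
      ((congrArg (fun z => sq ≫ z) (e.inv_hom_id_app g)).trans (Category.comp_id sq)))
  natural {g g'} n {c c'} σ sq sq' h := by
    have h₁ := e.inv.naturality n
    have h₂ := congrArg (fun z => z.left) (e.hom.naturality n)
    have h₃ := W.algebraFill_comp (H.map n) σ (sq ≫ e.inv.app g) (sq' ≫ e.inv.app g')
      ((Category.assoc _ _ _).trans ((congrArg (fun z => sq ≫ z) h₁.symm).trans
        ((Category.assoc _ _ _).symm.trans ((congrArg (fun z => z ≫ _) h).trans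
          (Category.assoc _ _ _)))))
    refine (Category.assoc _ _ _).trans ?_
    refine (congrArg (fun z => _ ≫ z) h₂.symm).trans ?_
    refine (Category.assoc _ _ _).symm.trans ?_
    exact (congrArg (fun z => z ≫ _) h₃).trans (Category.assoc _ _ _)

/-- If the free algebras are right maps, then the generating arrows are coalgebras. -/
def leftMapOfAlgebras (G : W.monad.Algebra ⥤ RightMap U)
    (e : G ⋙ RightMap.forget U ≅ W.monad.forget) : J ⥤ W.LeftMap :=
  let free (j : J) : RightMap U := G.obj (W.monad.free.obj (U.obj j))
  let φ (j : J) : (free j).arrow ⟶ W.F.R.obj (U.obj j) := e.hom.app (W.monad.free.obj (U.obj j))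
  let φ' (j : J) : W.F.R.obj (U.obj j) ⟶ (free j).arrow := e.inv.app (W.monad.free.obj (U.obj j))
  have φ'φ (j : J) : φ' j ≫ φ j = 𝟙 _ := e.inv_hom_id_app _
  -- The unit is a square from the generator to its free algebra. The filler chosen by the right map
  -- structure of that algebra is the nontrivial part of the coalgebra structure.
  let s (j : J) : (U.obj j).right ⟶ W.F.Z.obj (U.obj j) :=
    (free j).fill j (W.F.unit.app (U.obj j) ≫ φ' j) ≫ (φ j).left
  { obj j :=
      { arrow := U.obj j
        str := Arrow.homMk (𝟙 _) (s j) (by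
          refine (Category.id_comp _).trans (Eq.symm ?_)
          refine (Category.assoc _ _ _).symm.trans ?_
          refine (congrArg (fun z => z ≫ _) ((free j).fac_left j _)).trans ?_
          exact congrArg (fun z => z.left) ((Category.assoc _ _ _).trans
            ((congrArg (fun z => W.F.unit.app (U.obj j) ≫ z) (φ'φ j)).trans (Category.comp_id _))))
        counit := by
          apply Arrow.hom_ext
          · exact Category.comp_id _
          · refine (Category.assoc _ _ _).trans ?_
            refine (congrArg (fun z => _ ≫ z) (Arrow.w (φ j))).trans ?_
            refine (Category.assoc _ _ _).symm.trans ?_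
            refine (congrArg (fun z => z ≫ _) ((free j).fac_right j _)).trans ?_
            exact congrArg (fun z => z.right) ((Category.assoc _ _ _).trans
              ((congrArg (fun z => W.F.unit.app (U.obj j) ≫ z) (φ'φ j)).trans
                (Category.comp_id _))) }
    map {i j} σ :=
      { sq := U.map σ
        comm := by
          have h₁ := e.inv.naturality (W.monad.free.map (U.map σ))
          have h₂ := congrArg (fun z => z.left) (e.hom.naturality (W.monad.free.map (U.map σ)))
          -- A morphism of generators induces a morphism of free algebras, hence of right maps, so
          -- the two fillers are compatible.
          have h₃ := (G.map (W.monad.free.map (U.map σ))).fill_comp σ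
            (W.F.unit.app (U.obj i) ≫ φ' i) (W.F.unit.app (U.obj j) ≫ φ' j) (by
              refine (Category.assoc _ _ _).trans ?_
              refine (congrArg (fun z => _ ≫ z) h₁.symm).trans ?_
              refine (Category.assoc _ _ _).symm.trans (Eq.trans ?_ (Category.assoc _ _ _))
              exact congrArg (fun z => z ≫ _) (W.F.unit.naturality (U.map σ)).symm)
          apply Arrow.hom_ext
          · exact (Category.id_comp _).trans (Category.comp_id _).symm
          · refine (Category.assoc _ _ _).trans ?_
            refine (congrArg (fun z => _ ≫ z) h₂.symm).trans ?_
            refine (Category.assoc _ _ _).symm.trans ?_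
            exact (congrArg (fun z => z ≫ _) h₃).trans (Category.assoc _ _ _) }
    map_id j := LeftMap.Hom.ext (U.map_id j)
    map_comp σ τ := LeftMap.Hom.ext (U.map_comp σ τ) }

end

/-! ### Pullbacks of coalgebras -/

section

variable {E : Type u} [Category.{v} E] {W : AWFS E}
  {C : Type u₁} [Category.{v₁} C] {V : C ⥤ Arrow E} (N : C ⥤ W.LeftMap)
  (ν : V ≅ N ⋙ LeftMap.forget W)

lemma cartOver_comm {x x' : CartOver V} (n : x ⟶ x') :
    n.top ≫ x'.sq ≫ ν.hom.app x'.base = (x.sq ≫ ν.hom.app x.base) ≫ (N.map n.base).sq := by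
  refine (Category.assoc _ _ _).symm.trans ?_
  refine (congrArg (fun z => z ≫ _) n.comm).trans ?_
  refine (Category.assoc _ _ _).trans (Eq.trans ?_ (Category.assoc _ _ _).symm)
  exact congrArg (fun z => x.sq ≫ z) (ν.hom.naturality n.base)

/-- The cospan of a pullback square over a coalgebra. -/
def cartOverCospan :
    CartOver V ⥤ Comma (𝟭 E) (LeftMap.forget W ⋙ (Arrow.rightFunc : Arrow E ⥤ E)) where
  obj x :=
    { left := x.arrow.right
      right := N.obj x.base
      hom := (x.sq ≫ ν.hom.app x.base).right }
  map {x x'} n :=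
    { left := n.top.right
      right := N.map n.base
      w := congrArg (fun z => z.right) (cartOver_comm N ν n) }
  map_id x := by
    apply CommaMorphism.ext
    · rfl
    · exact N.map_id _
  map_comp m n := by
    apply CommaMorphism.ext
    · rfl
    · exact N.map_comp _ _

lemma cartOver_isPullback (x : CartOver V) :
    IsPullback (x.sq ≫ ν.hom.app x.base).left x.arrow.hom (N.obj x.base).arrow.hom
      (x.sq ≫ ν.hom.app x.base).right := by
  have hl : IsIso (ν.hom.app x.base).left :=
    inferInstanceAs (IsIso (Arrow.leftFunc.map (ν.hom.app x.base)))
  have hr : IsIso (ν.hom.app x.base).right :=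
    inferInstanceAs (IsIso (Arrow.rightFunc.map (ν.hom.app x.base)))
  exact x.isPullback.paste_horiz (@IsPullback.of_horiz_isIso _ _ _ _ _ _ _ _ _ _ hl hr
    ⟨Arrow.w (ν.hom.app x.base)⟩)

/-- A pullback square over a coalgebra is isomorphic to the chosen pullback. -/
noncomputable def cartOverIso [HasPullbacks E] : CartOver.forget V ≅
    (cartOverCospan N ν ⋙ Comma.preRight (𝟭 E) (LeftMap.forget W) Arrow.rightFunc) ⋙
      cospanPullback E :=
  NatIso.ofComponents
    (fun x => Arrow.isoMk (cartOver_isPullback N ν x).isoPullback (Iso.refl _) (by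
      refine (IsPullback.isoPullback_hom_snd _).trans (Category.comp_id _).symm))
    (fun {x x'} n => by
      apply Arrow.hom_ext
      · apply pullback.hom_ext
        · refine (Category.assoc _ _ _).trans ?_
          refine (congrArg (fun z => _ ≫ z) (IsPullback.isoPullback_hom_fst _)).trans ?_
          refine Eq.trans ?_ (Category.assoc _ _ _).symm
          refine Eq.trans ?_ (congrArg (fun z => _ ≫ z) (pullback.lift_fst _ _ _)).symm
          refine Eq.trans ?_ (Category.assoc _ _ _)
          refine Eq.trans ?_ (congrArg (fun z => z ≫ _) (IsPullback.isoPullback_hom_fst _)).symm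
          exact congrArg (fun z => z.left) (cartOver_comm N ν n)
        · refine (Category.assoc _ _ _).trans ?_
          refine (congrArg (fun z => _ ≫ z) (IsPullback.isoPullback_hom_snd _)).trans ?_
          refine Eq.trans ?_ (Category.assoc _ _ _).symm
          refine Eq.trans ?_ (congrArg (fun z => _ ≫ z) (pullback.lift_snd _ _ _)).symm
          refine Eq.trans ?_ (Category.assoc _ _ _)
          refine Eq.trans ?_ (congrArg (fun z => z ≫ _) (IsPullback.isoPullback_hom_snd _)).symm
          exact Arrow.w n.top
      · exact (Category.comp_id _).trans (Category.id_comp _).symm)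

end

/-- Right `U`-maps lift against coalgebras, and suitability makes coalgebras of the arrows from the
initial object and of pullbacks of Leibniz products of generators. These are the two families of
fillers that the Frobenius argument needs. -/
theorem pushforwardLifts {E : Type u} [Category.{v} E] [LocallyCartesianClosed E]
    [HasPushouts E] [HasInitial E] {cyl : FunctorialCylinder E} [cyl.I.IsLeftAdjoint]
    {con : cyl.Contractions} (conn : cyl.Connections con) (W : AWFS E) (hW : Suitable.{w} W cyl)
    {J : Type u₁} [Category.{v₁} J] {U : J ⥤ Arrow E} (hU : W.IsAlgebraicallyFreeOn U) :
    PushforwardLifts (cyl.trivCofGen U) := by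
  obtain ⟨G, H, -, hHG, hG⟩ := hU
  obtain ⟨L₀⟩ := hW.initial
  obtain ⟨L₁⟩ := hW.pullback
  let L₂ (k : Fin 2) := (hW.leibniz k).some
  have hH : H ⋙ W.monad.forget = RightMap.forget U := by
    rw [← hG, ← Functor.assoc, hHG, Functor.id_comp]
  let F := fillingOfAlgebras H (eqToIso hH)
  -- Generators are coalgebras, functorially in `J`; hence so are their Leibniz products with the
  -- endpoints.
  let N₀ := leftMapOfAlgebras G (eqToIso hG)
  let N (k : Fin 2) : J ⥤ W.LeftMap := N₀ ⋙ (L₂ k).functor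
  have hN (k : Fin 2) : U ⋙ leibniz (cyl.δ k) = N k ⋙ LeftMap.forget W :=
    congrArg (fun Z => N₀ ⋙ Z) (L₂ k).comm.symm
  let F₀ : UniformFilling U (initialArrow E) := F.precomp L₀.functor (eqToIso L₀.comm.symm)
  let F₁ (k : Fin 2) : UniformFilling U (CartOver.forget (U ⋙ leibniz (cyl.δ k))) :=
    F.precomp (cartOverCospan (N k) (eqToIso (hN k)) ⋙ L₁.functor)
      (cartOverIso (N k) (eqToIso (hN k)) ≪≫
        Functor.isoWhiskerLeft (cartOverCospan (N k) (eqToIso (hN k))) (eqToIso L₁.comm.symm))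
  exact (FrobeniusFilling.trivCofGen conn F₀ F₁).pushforwardLifts

end AWFS

end UniformFibrations

namespace UniformFibrations

/-! ### Connections given by operations on an interval -/

section Interval

variable {E : Type u} [Category.{v} E] [CartesianMonoidalCategory E] {I : E}
  {δ : Fin 2 → (𝟙_ E ⟶ I)}

open CartesianMonoidalCategory

lemma intervalCylinder_δ_app (k : Fin 2) (X : E) :
    ((intervalCylinder I δ).δ k).app X = lift (toUnit X ≫ δ k) (𝟙 X) := by
  apply CartesianMonoidalCategory.hom_ext
  · refine Eq.trans ?_ (lift_fst _ _).symm
    refine (Category.assoc _ _ _).trans ?_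
    rw [whiskerRight_fst, ← Category.assoc]
    exact congrArg (fun z => z ≫ δ k) (toUnit_unique _ _)
  · refine Eq.trans ?_ (lift_snd _ _).symm
    refine (Category.assoc _ _ _).trans ?_
    rw [whiskerRight_snd]
    exact leftUnitor_inv_snd X

/-- The contractions of an interval cylinder: the projections. -/
def intervalContractions : (intervalCylinder I δ).Contractions where
  ε := { app X := snd I X, naturality _ _ f := whiskerLeft_snd I f }
  δ_ε k := by
    apply NatTrans.ext
    funext X
    refine (congrArg (fun z => z ≫ snd I X) (intervalCylinder_δ_app k X)).trans ?_
    exact lift_snd _ _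

/-- An operation on an interval as a transformation of cylinders. -/
def intervalMul (m : I ⊗ I ⟶ I) :
    (intervalCylinder I δ).I ⋙ (intervalCylinder I δ).I ⟶ (intervalCylinder I δ).I where
  app X := (α_ I I X).inv ≫ m ▷ X
  naturality X Y f := by
    change I ◁ I ◁ f ≫ (α_ I I Y).inv ≫ m ▷ Y = ((α_ I I X).inv ≫ m ▷ X) ≫ I ◁ f
    rw [Category.assoc, ← whisker_exchange, associator_inv_naturality_right_assoc]

/-- An endpoint of the outer cylinder fixes the first argument of `m`; for an endpoint of the inner
cylinder, as in `map_δ_intervalMul`, it is the second. -/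
lemma δ_intervalMul (m : I ⊗ I ⟶ I) (k : Fin 2) {X : E} :
    lift (toUnit (I ⊗ X) ≫ δ k) (𝟙 (I ⊗ X)) ≫ (α_ I I X).inv ≫ m ▷ X =
      (lift (toUnit I ≫ δ k) (𝟙 I) ≫ m) ▷ X := by
  apply CartesianMonoidalCategory.hom_ext
  · simp only [Category.assoc, whiskerRight_fst]
    rw [← Category.assoc, ← Category.assoc, ← Category.assoc]
    congr 1
    apply CartesianMonoidalCategory.hom_ext <;> simp
  · simp

lemma map_δ_intervalMul (m : I ⊗ I ⟶ I) (k : Fin 2) {X : E} :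
    I ◁ lift (toUnit X ≫ δ k) (𝟙 X) ≫ (α_ I I X).inv ≫ m ▷ X =
      (lift (𝟙 I) (toUnit I ≫ δ k) ≫ m) ▷ X := by
  apply CartesianMonoidalCategory.hom_ext
  · simp only [Category.assoc, whiskerRight_fst]
    rw [← Category.assoc, ← Category.assoc, ← Category.assoc]
    congr 1
    apply CartesianMonoidalCategory.hom_ext <;> simp
  · simp

/-- Operations on an interval for which the endpoints are absorbing and neutral give connections
on the interval cylinder. -/
def intervalConnections (m : Fin 2 → (I ⊗ I ⟶ I))
    (δ_m : ∀ k, lift (toUnit I ≫ δ k) (𝟙 I) ≫ m k = toUnit I ≫ δ k)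
    (m_δ : ∀ k, lift (𝟙 I) (toUnit I ≫ δ k) ≫ m k = toUnit I ≫ δ k)
    (δ_m' : ∀ k, lift (toUnit I ≫ δ (1 - k)) (𝟙 I) ≫ m k = 𝟙 I)
    (m_δ' : ∀ k, lift (𝟙 I) (toUnit I ≫ δ (1 - k)) ≫ m k = 𝟙 I) :
    (intervalCylinder I δ).Connections intervalContractions :=
  have h (k : Fin 2) (X : E) :
      (toUnit I ≫ δ k) ▷ X = snd I X ≫ lift (toUnit X ≫ δ k) (𝟙 X) := by
    apply CartesianMonoidalCategory.hom_ext <;> simp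
  { c k := intervalMul (m k)
    δ_c k X := by
      rw [intervalCylinder_δ_app, intervalCylinder_δ_app]
      refine (δ_intervalMul (m k) k).trans ?_
      rw [δ_m, h]
      rfl
    map_δ_c k X := by
      rw [intervalCylinder_δ_app]
      refine (map_δ_intervalMul (m k) k).trans ?_
      rw [m_δ, h]
      rfl
    δ_c' k X := by
      rw [intervalCylinder_δ_app]
      refine (δ_intervalMul (m k) (1 - k)).trans ?_
      rw [δ_m']
      exact id_whiskerRight _ _
    map_δ_c' k X := by
      rw [intervalCylinder_δ_app]
      refine (map_δ_intervalMul (m k) (1 - k)).trans ?_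
      rw [m_δ']
      exact id_whiskerRight _ _ }

end Interval

end UniformFibrations

namespace UniformFibrations

/-! ### Monomorphisms of presheaves -/

section

variable {E : Type u} [Category.{v} E] [HasPullbacks E] {P Q : ObjectProperty E}

namespace CartMono

/-- The pullback of a monomorphism. -/
noncomputable def baseChange (f : CartMono E Q) {B : E} (χ : B ⟶ f.arrow.right) (hB : P B) :
    CartMono E P where
  arrow := Arrow.mk (pullback.snd f.arrow.hom χ)
  mono := have := f.mono; inferInstanceAs (Mono (pullback.snd f.arrow.hom χ))
  cod := hB

/-- The pullback square of a base change. -/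
noncomputable def baseChangeSq (f : CartMono E Q) {B : E} (χ : B ⟶ f.arrow.right) (hB : P B) :
    (f.baseChange χ hB).arrow ⟶ f.arrow :=
  Arrow.homMk (pullback.fst f.arrow.hom χ) χ pullback.condition

lemma isPullback_baseChangeSq (f : CartMono E Q) {B : E} (χ : B ⟶ f.arrow.right) (hB : P B) :
    IsPullback (f.baseChangeSq χ hB).left (f.baseChange χ hB).arrow.hom f.arrow.hom
      (f.baseChangeSq χ hB).right :=
  (IsPullback.of_hasPullback f.arrow.hom χ)

/-- Functoriality of base change. -/
noncomputable def baseChangeMap {f f' : CartMono E Q} (σ : f ⟶ f') {B B' : E}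
    {χ : B ⟶ f.arrow.right} {χ' : B' ⟶ f'.arrow.right} (hB : P B) (hB' : P B') (ρ : B ⟶ B')
    (h : χ ≫ σ.sq.right = ρ ≫ χ') : f.baseChange χ hB ⟶ f'.baseChange χ' hB' where
  sq := Arrow.homMk (pullback.map _ _ _ _ σ.sq.left ρ σ.sq.right (Arrow.w σ.sq).symm h) ρ
    (pullback.lift_snd _ _ _)
  isPullback := by
    refine IsPullback.of_right ?_ (pullback.lift_snd _ _ _) (f'.isPullback_baseChangeSq χ' hB')
    have h₁ := (f.isPullback_baseChangeSq χ hB).paste_horiz σ.isPullback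
    refine h₁.of_iso (Iso.refl _) (Iso.refl _) (Iso.refl _) (Iso.refl _) ?_ ?_ ?_ ?_
    · refine (Category.comp_id _).trans (Eq.trans ?_ (Category.id_comp _).symm)
      exact (pullback.lift_fst _ _ _).symm
    · exact (Category.comp_id _).trans (Category.id_comp _).symm
    · exact (Category.comp_id _).trans (Category.id_comp _).symm
    · exact (Category.comp_id _).trans (h.trans (Category.id_comp _).symm)

lemma baseChangeMap_comp {f f' : CartMono E Q} (σ : f ⟶ f') {B B' : E}
    {χ : B ⟶ f.arrow.right} {χ' : B' ⟶ f'.arrow.right} (hB : P B) (hB' : P B') (ρ : B ⟶ B')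
    (h : χ ≫ σ.sq.right = ρ ≫ χ') :
    (baseChangeMap σ hB hB' ρ h).sq ≫ f'.baseChangeSq χ' hB' = f.baseChangeSq χ hB ≫ σ.sq := by
  apply Arrow.hom_ext
  · exact pullback.lift_fst _ _ _
  · exact h.symm

/-- The filler of a base change of a square. -/
noncomputable def baseChangeFill (g : RightMap (CartMono.forget E P)) (f : CartMono E Q)
    (sq : f.arrow ⟶ g.arrow) {B : E} (χ : B ⟶ f.arrow.right) (hB : P B) : B ⟶ g.arrow.left :=
  g.fill (f.baseChange χ hB) (f.baseChangeSq χ hB ≫ sq)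

lemma baseChangeFill_hom (g : RightMap (CartMono.forget E P)) (f : CartMono E Q)
    (sq : f.arrow ⟶ g.arrow) {B : E} (χ : B ⟶ f.arrow.right) (hB : P B) :
    baseChangeFill g f sq χ hB ≫ g.arrow.hom = χ ≫ sq.right :=
  g.fac_right (f.baseChange χ hB) (f.baseChangeSq χ hB ≫ sq)

/-- Over a point that comes from the domain of `f` the base change has a section, so the filler is
determined by its upper triangle. -/
lemma baseChangeFill_eq (g : RightMap (CartMono.forget E P)) (f : CartMono E Q)
    (sq : f.arrow ⟶ g.arrow) {B : E} (χ : B ⟶ f.arrow.left) (hB : P B) :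
    baseChangeFill g f sq (χ ≫ f.arrow.hom) hB = χ ≫ sq.left := by
  have h₁ := g.fac_left (f.baseChange (χ ≫ f.arrow.hom) hB) (f.baseChangeSq _ hB ≫ sq)
  let s : B ⟶ pullback f.arrow.hom (χ ≫ f.arrow.hom) :=
    pullback.lift χ (𝟙 B) (Category.id_comp _).symm
  have h₂ : s ≫ pullback.snd _ _ = 𝟙 B := pullback.lift_snd _ _ _
  have h₃ : s ≫ pullback.fst _ _ = χ := pullback.lift_fst _ _ _
  refine (Category.id_comp _).symm.trans ((congrArg (fun z => z ≫ _) h₂.symm).trans ?_)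
  refine (Category.assoc _ _ _).trans ((congrArg (fun z => s ≫ z) h₁).trans ?_)
  exact (Category.assoc _ _ _).symm.trans (congrArg (fun z => z ≫ sq.left) h₃)

/-- Base changes of a pullback square are joined by a pullback square, that is, by a morphism of
generators, for which the fillers are natural. -/
lemma baseChangeFill_comp {g g' : RightMap (CartMono.forget E P)} (n : g ⟶ g') {f f' : CartMono E Q}
    (σ : f ⟶ f') (sq : f.arrow ⟶ g.arrow) (sq' : f'.arrow ⟶ g'.arrow)
    (hsq : sq ≫ n.sq = σ.sq ≫ sq') {B B' : E} {χ : B ⟶ f.arrow.right} {χ' : B' ⟶ f'.arrow.right}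
    (hB : P B) (hB' : P B') (ρ : B ⟶ B') (h : χ ≫ σ.sq.right = ρ ≫ χ') :
    baseChangeFill g f sq χ hB ≫ n.sq.left = ρ ≫ baseChangeFill g' f' sq' χ' hB' := by
  refine n.fill_comp (baseChangeMap σ hB hB' ρ h) (f.baseChangeSq χ hB ≫ sq)
    (f'.baseChangeSq χ' hB' ≫ sq') ?_
  refine (Category.assoc _ _ _).trans ((congrArg (fun z => _ ≫ z) hsq).trans ?_)
  refine (Category.assoc _ _ _).symm.trans (Eq.trans ?_ (Category.assoc _ _ _))
  exact congrArg (fun z => z ≫ sq') (baseChangeMap_comp σ hB hB' ρ h).symm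

end CartMono

end

/-! ### Gluing fillers over representables -/

section

variable {D : Type u₁} [Category.{v₁} D]

section

variable {P : ObjectProperty (Dᵒᵖ ⥤ Type (max w v₁))} (hP : ∀ d, P (uliftYoneda.{w}.obj d))

namespace CartMono

/-- The filler that is obtained by gluing the fillers of base changes to representables. -/
noncomputable def glueFill (g : RightMap (CartMono.forget _ P))
    (f : CartMono (Dᵒᵖ ⥤ Type (max w v₁)) ⊤) (sq : f.arrow ⟶ g.arrow) :
    f.arrow.right ⟶ g.arrow.left where
  app d := TypeCat.ofHom fun b =>
    uliftYonedaEquiv.{w} (baseChangeFill g f sq (uliftYonedaEquiv.{w}.symm b) (hP d.unop))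
  naturality d d' φ := by
    refine ConcreteCategory.hom_ext _ _ fun b => ?_
    refine Eq.trans ?_ (uliftYonedaEquiv_naturality.{w}
      (baseChangeFill g f sq (uliftYonedaEquiv.{w}.symm b) (hP d.unop)) φ).symm
    refine congrArg uliftYonedaEquiv.{w} ?_
    -- Restricting an element along `φ` is precomposition with a map of representables. Uniformity
    -- of the fillers in pullback squares makes the pointwise definition natural.
    have h := baseChangeFill_comp (𝟙 g) (𝟙 f) sq sq
      ((Category.comp_id _).trans (Category.id_comp _).symm)
      (χ := uliftYonedaEquiv.{w}.symm (f.arrow.right.map φ b))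
      (χ' := uliftYonedaEquiv.{w}.symm b) (hP d'.unop) (hP d.unop)
      (uliftYoneda.{w}.map φ.unop)
      ((Category.comp_id _).trans (uliftYonedaEquiv_symm_map φ b))
    exact (Category.comp_id _).symm.trans h

/-- By the Yoneda lemma only the universal element of the representable has to be checked, and there
this is the definition. -/
lemma comp_glueFill (g : RightMap (CartMono.forget _ P))
    (f : CartMono (Dᵒᵖ ⥤ Type (max w v₁)) ⊤) (sq : f.arrow ⟶ g.arrow) {d : D}
    (χ : uliftYoneda.{w}.obj d ⟶ f.arrow.right) :
    χ ≫ glueFill hP g f sq = baseChangeFill g f sq χ (hP d) := by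
  apply uliftYonedaEquiv.{w}.injective
  refine (uliftYonedaEquiv_comp _ _).trans ?_
  change uliftYonedaEquiv.{w} (baseChangeFill g f sq (uliftYonedaEquiv.{w}.symm _) _) = _
  rw [Equiv.symm_apply_apply]

/-- Right maps for the monomorphisms with representable codomains have fillers against all
monomorphisms. -/
noncomputable def filling : UniformFilling (CartMono.forget _ P)
    (CartMono.forget (Dᵒᵖ ⥤ Type (max w v₁)) ⊤) where
  fill := glueFill hP
  fac_left g f sq := by
    apply hom_ext_uliftYoneda
    intro d χ
    refine (Category.assoc _ _ _).symm.trans ?_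
    exact (comp_glueFill hP g f sq (χ ≫ f.arrow.hom)).trans (baseChangeFill_eq g f sq χ (hP d))
  fac_right g f sq := by
    apply hom_ext_uliftYoneda
    intro d χ
    refine (Category.assoc _ _ _).symm.trans ?_
    exact (congrArg (fun z => z ≫ g.arrow.hom) (comp_glueFill hP g f sq χ)).trans
      (baseChangeFill_hom g f sq χ (hP d))
  natural {g g'} n {f f'} σ sq sq' h := by
    apply hom_ext_uliftYoneda
    intro d χ
    refine (Category.assoc _ _ _).symm.trans ?_
    refine (congrArg (fun z => z ≫ n.sq.left) (comp_glueFill hP g f sq χ)).trans ?_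
    -- Since `σ` is a pullback square, base change of `f` along `χ` and of `f'` along `χ ≫
    -- σ.sq.right` are related over the identity of the representable.
    refine (baseChangeFill_comp n σ sq sq' h (χ' := χ ≫ σ.sq.right) (hP d) (hP d) (𝟙 _)
      (Category.id_comp _).symm).trans ?_
    refine (Category.id_comp _).trans ?_
    exact (comp_glueFill hP g' f' sq' (χ ≫ σ.sq.right)).symm.trans (Category.assoc _ _ _)

end CartMono

end

/-! ### Arrows from the initial presheaf -/

section

/-- Evaluation at an object preserves colimits, in particular the initial object. -/
lemma isEmpty_initial_obj (d : Dᵒᵖ) : IsEmpty ((⊥_ (Dᵒᵖ ⥤ Type (max w v₁))).obj d) :=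
  have : HasInitial (Type (max w v₁)) := inferInstance
  (Types.initial_iff_empty _).1 ⟨(initialIsInitial.isInitialObj
    ((evaluation Dᵒᵖ (Type (max w v₁))).obj d))⟩

lemma mono_initial_to (X : Dᵒᵖ ⥤ Type (max w v₁)) : Mono (initial.to X) := by
  rw [NatTrans.mono_iff_mono_app]
  intro d
  rw [mono_iff_injective]
  exact fun x => (isEmpty_initial_obj d).elim x

variable (D) in
/-- The monomorphisms from the initial object. -/
noncomputable def CartMono.initialMono :
    (Dᵒᵖ ⥤ Type (max w v₁)) ⥤ CartMono (Dᵒᵖ ⥤ Type (max w v₁)) ⊤ where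
  obj X := ⟨Arrow.mk (initial.to X), mono_initial_to X, trivial⟩
  map {X Y} f :=
    { sq := (initialArrow _).map f
      isPullback := by
        apply IsPullback.of_forall_isPullback_app
        intro d
        rw [Types.isPullback_iff]
        refine ⟨?_, fun x => (isEmpty_initial_obj d).elim x,
          fun x => (isEmpty_initial_obj d).elim x⟩
        rw [← NatTrans.comp_app, ← NatTrans.comp_app]
        exact congrArg (fun z => z.app d) (Arrow.w ((initialArrow _).map f)) }
  map_id X := CartMono.Hom.ext ((initialArrow _).map_id X)
  map_comp f g := CartMono.Hom.ext ((initialArrow _).map_comp f g)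

end

end

end UniformFibrations

namespace UniformFibrations

/-! ### Leibniz products of monomorphisms of presheaves -/

section

variable {E : Type u} [Category.{v} E]

/-- A pullback-preserving pointed endofunctor with cartesian monic point. -/
structure IsCartesianPoint {F : E ⥤ E} (δ : 𝟭 E ⟶ F) : Prop where
  map_isPullback {A A' B B' : E} {a : A ⟶ A'} {f : A ⟶ B} {g : A' ⟶ B'} {b : B ⟶ B'}
    (h : IsPullback a f g b) : IsPullback (F.map a) (F.map f) (F.map g) (F.map b)
  isPullback {X Y : E} (f : X ⟶ Y) : IsPullback (point δ X) f (F.map f) (point δ Y)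
  mono (X : E) : Mono (point δ X)

/-- Being a monomorphism is a pullback condition, and `F` preserves pullbacks. -/
lemma IsCartesianPoint.mono_map {F : E ⥤ E} {δ : 𝟭 E ⟶ F} (hδ : IsCartesianPoint δ) {X Y : E}
    (f : X ⟶ Y) (hf : Mono f) : Mono (F.map f) := by
  have h := hδ.map_isPullback ((mono_iff_isPullback f).1 hf)
  rw [F.map_id] at h
  exact (mono_iff_isPullback _).2 h

section

variable [CartesianMonoidalCategory E]

open CartesianMonoidalCategory

lemma isPullback_snd_whiskerLeft (I : E) {X Y : E} (f : X ⟶ Y) :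
    IsPullback (snd I X) (I ◁ f) f (snd I Y) where
  w := (whiskerLeft_snd I f).symm
  isLimit' := ⟨PullbackCone.IsLimit.mk _ (fun s => lift (s.snd ≫ fst I Y) s.fst)
    (fun s => lift_snd _ _)
    (fun s => by
      apply CartesianMonoidalCategory.hom_ext
      · simp
      · simpa using s.condition)
    (fun s m h₁ h₂ => by
      apply CartesianMonoidalCategory.hom_ext
      · simp [← h₂]
      · simpa using h₁)⟩

/-- The naturality squares of the projection from the cylinder are pullbacks, and pullback
cancellation against them gives both pullback claims. The endpoint inclusion is a section of the
projection, hence monic. -/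
lemma isCartesianPoint_intervalCylinder (I : E) (δ : Fin 2 → (𝟙_ E ⟶ I)) (k : Fin 2) :
    IsCartesianPoint ((intervalCylinder I δ).δ k) where
  map_isPullback {A A' B B' a f g b} h := by
    have h₁ := (isPullback_snd_whiskerLeft I f).paste_horiz h
    refine IsPullback.of_right (h₁₁ := I ◁ a) (h₂₁ := I ◁ b) ?_ ?_
      (isPullback_snd_whiskerLeft I g)
    · rw [whiskerLeft_snd, whiskerLeft_snd]
      exact h₁
    · exact (MonoidalCategory.whiskerLeft_comp I a g).symm.trans
        ((congrArg (fun z => I ◁ z) h.w).trans (MonoidalCategory.whiskerLeft_comp I f b))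
  isPullback {X Y} f := by
    have hs (Z : E) : point ((intervalCylinder I δ).δ k) Z ≫ snd I Z = 𝟙 Z :=
      (congrArg (fun z => z ≫ snd I Z) (intervalCylinder_δ_app k Z)).trans (lift_snd _ _)
    refine IsPullback.of_right ?_ (point_naturality _ f).symm (isPullback_snd_whiskerLeft I f)
    rw [hs, hs]
    exact IsPullback.of_horiz_isIso ⟨(Category.id_comp _).trans (Category.comp_id _).symm⟩
  mono Z := by
    have hs : point ((intervalCylinder I δ).δ k) Z ≫ snd I Z = 𝟙 Z :=
      (congrArg (fun z => z ≫ snd I Z) (intervalCylinder_δ_app k Z)).trans (lift_snd _ _)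
    have : Mono (point ((intervalCylinder I δ).δ k) Z ≫ snd I Z) := by
      rw [hs]
      infer_instance
    exact mono_of_mono _ (snd I Z)

end

end

/-! ### Elementwise description of Leibniz products of presheaves -/

section

variable {D : Type u₁} [Category.{v₁} D]

namespace IsCartesianPoint

variable {F : (D ⥤ Type w) ⥤ (D ⥤ Type w)} {δ : 𝟭 (D ⥤ Type w) ⟶ F}

lemma leibniz_cases (f : Arrow (D ⥤ Type w)) {d : D} (z : (leibniz.dom δ f).obj d) :
    (∃ x, (leibniz.inl δ f).app d x = z) ∨ ∃ y, (leibniz.inr δ f).app d y = z :=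
  Types.eq_or_eq_of_isPushout ((leibniz.isPushout δ f).app d) z

lemma hom_app_inl (f : Arrow (D ⥤ Type w)) {d : D} (x : (F.obj f.left).obj d) :
    (leibniz.hom δ f).app d ((leibniz.inl δ f).app d x) = (F.map f.hom).app d x :=
  ConcreteCategory.congr_hom (NatTrans.congr_app (leibniz.inl_hom f) d) x

lemma hom_app_inr (f : Arrow (D ⥤ Type w)) {d : D} (y : f.right.obj d) :
    (leibniz.hom δ f).app d ((leibniz.inr δ f).app d y) = (point δ f.right).app d y :=
  ConcreteCategory.congr_hom (NatTrans.congr_app (leibniz.inr_hom f) d) y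

lemma domMap_app_inl {f g : Arrow (D ⥤ Type w)} (m : f ⟶ g) {d : D} (x : (F.obj f.left).obj d) :
    (leibniz.domMap δ m).app d ((leibniz.inl δ f).app d x) =
      (leibniz.inl δ g).app d ((F.map m.left).app d x) :=
  ConcreteCategory.congr_hom (NatTrans.congr_app (leibniz.inl_domMap m) d) x

lemma domMap_app_inr {f g : Arrow (D ⥤ Type w)} (m : f ⟶ g) {d : D} (y : f.right.obj d) :
    (leibniz.domMap δ m).app d ((leibniz.inr δ f).app d y) =
      (leibniz.inr δ g).app d (m.right.app d y) :=
  ConcreteCategory.congr_hom (NatTrans.congr_app (leibniz.inr_domMap m) d) y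

/-- The naturality square of `δ` at `f.hom` is a pullback, so the two elements come from a common
element of the domain of `f`, and the pushout identifies its images. -/
lemma inl_eq_inr (hδ : IsCartesianPoint δ) (f : Arrow (D ⥤ Type w)) {d : D}
    (x : (F.obj f.left).obj d) (y : f.right.obj d)
    (h : (F.map f.hom).app d x = (point δ f.right).app d y) :
    (leibniz.inl δ f).app d x = (leibniz.inr δ f).app d y := by
  obtain ⟨a, rfl, rfl⟩ := Types.exists_of_isPullback ((hδ.isPullback f.hom).app d) x y h
  exact ConcreteCategory.congr_hom (NatTrans.congr_app (leibniz.condition f) d) a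

lemma app_injective {X Y : D ⥤ Type w} {f : X ⟶ Y} (hf : Mono f) (d : D) :
    Function.Injective (f.app d) :=
  (mono_iff_injective _).1 ((NatTrans.mono_iff_mono_app f).1 hf d)

/-- Both legs of the pushout are subobjects of the cylinder on the codomain, and by `inl_eq_inr`
they meet only where they are glued; the pushout is their union. -/
lemma mono_leibniz (hδ : IsCartesianPoint δ) {f : Arrow (D ⥤ Type w)} (hf : Mono f.hom) :
    Mono (leibniz.hom δ f) := by
  rw [NatTrans.mono_iff_mono_app]
  intro d
  rw [mono_iff_injective]
  intro z z' h
  obtain ⟨x, rfl⟩ | ⟨y, rfl⟩ := leibniz_cases f z <;>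
  obtain ⟨x', rfl⟩ | ⟨y', rfl⟩ := leibniz_cases f z'
  · rw [hom_app_inl, hom_app_inl] at h
    rw [app_injective (hδ.mono_map _ hf) d h]
  · rw [hom_app_inl, hom_app_inr] at h
    exact inl_eq_inr hδ f x y' h
  · rw [hom_app_inl, hom_app_inr] at h
    exact (inl_eq_inr hδ f x' y h.symm).symm
  · rw [hom_app_inr, hom_app_inr] at h
    rw [app_injective (hδ.mono _) d h]

/-- Uniqueness of lifts is injectivity. For existence, an element of the pushout for `g` lies in one
of its two legs: on the first it lifts because `F` preserves the given pullback, on the second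
because `δ` is cartesian. -/
lemma isPullback_leibniz (hδ : IsCartesianPoint δ) {f g : Arrow (D ⥤ Type w)} (hf : Mono f.hom)
    (m : f ⟶ g) (hm : IsPullback m.left f.hom g.hom m.right) :
    IsPullback (leibniz.domMap δ m) (leibniz.hom δ f) (leibniz.hom δ g) (F.map m.right) := by
  have w : leibniz.domMap δ m ≫ leibniz.hom δ g = leibniz.hom δ f ≫ F.map m.right :=
    Arrow.w ((leibniz δ).map m)
  apply IsPullback.of_forall_isPullback_app
  intro d
  rw [Types.isPullback_iff]
  refine ⟨NatTrans.congr_app w d, fun z z' h => app_injective (mono_leibniz hδ hf) d h.2,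
    fun z y h => ?_⟩
  obtain ⟨x, rfl⟩ | ⟨x, rfl⟩ := leibniz_cases g z
  · rw [hom_app_inl] at h
    obtain ⟨x', rfl, rfl⟩ := Types.exists_of_isPullback ((hδ.map_isPullback hm).app d) x y h
    exact ⟨(leibniz.inl δ f).app d x', domMap_app_inl m x', hom_app_inl f x'⟩
  · rw [hom_app_inr] at h
    obtain ⟨x', rfl, rfl⟩ := Types.exists_of_isPullback ((hδ.isPullback m.right).app d) y x h.symm
    exact ⟨(leibniz.inr δ f).app d x', domMap_app_inr m x', hom_app_inr f x'⟩

/-- Pullbacks of Leibniz products of monomorphisms are monomorphisms. -/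
def cartMono (hδ : IsCartesianPoint δ) {P : ObjectProperty (D ⥤ Type w)} :
    CartOver (CartMono.forget _ P ⋙ leibniz δ) ⥤ CartMono (D ⥤ Type w) ⊤ where
  obj x :=
    { arrow := x.arrow
      mono := x.isPullback.mono_snd_of_mono (mono_leibniz hδ x.base.mono)
      cod := trivial }
  map {x x'} n :=
    { sq := n.top
      isPullback := by
        -- By `n.comm`, pasting with the square of `x'` gives the square of `x` pasted with the
        -- Leibniz product of a pullback square; the square of `x'` can then be cancelled.
        refine IsPullback.of_right ?_ (Arrow.w n.top) x'.isPullback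
        have h := x.isPullback.paste_horiz
          (isPullback_leibniz hδ x.base.mono n.base.sq n.base.isPullback)
        have hl := congrArg (fun z => z.left) n.comm
        have hr := congrArg (fun z => z.right) n.comm
        refine h.of_iso (Iso.refl _) (Iso.refl _) (Iso.refl _) (Iso.refl _) ?_ ?_ ?_ ?_
        · exact (Category.comp_id _).trans (hl.symm.trans (Category.id_comp _).symm)
        · exact (Category.comp_id _).trans (Category.id_comp _).symm
        · exact (Category.comp_id _).trans (Category.id_comp _).symm
        · exact (Category.comp_id _).trans (hr.symm.trans (Category.id_comp _).symm) }
  map_id _ := rfl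
  map_comp _ _ := rfl

end IsCartesianPoint

variable (I : Dᵒᵖ ⥤ Type (max w v₁)) (δ : Fin 2 → (𝟙_ (Dᵒᵖ ⥤ Type (max w v₁)) ⟶ I))
  {P : ObjectProperty (Dᵒᵖ ⥤ Type (max w v₁))}

/-- Monomorphisms and pullback squares play the role of coalgebras and their morphisms: they include
the arrows from the initial presheaf and the pullbacks of Leibniz products of generators. -/
theorem pushforwardLifts_intervalCylinder [LocallyCartesianClosed (Dᵒᵖ ⥤ Type (max w v₁))]
    [(intervalCylinder I δ).I.IsLeftAdjoint]
    (conn : (intervalCylinder I δ).Connections intervalContractions)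
    (hP : ∀ d, P (uliftYoneda.{w}.obj d)) :
    PushforwardLifts ((intervalCylinder I δ).trivCofGen (CartMono.forget _ P)) := by
  have hδ := isCartesianPoint_intervalCylinder I δ
  let F₀ : UniformFilling (CartMono.forget _ P) (initialArrow _) :=
    (CartMono.filling hP).precomp (CartMono.initialMono D) (Iso.refl _)
  let F₁ (k : Fin 2) : UniformFilling (CartMono.forget _ P)
      (CartOver.forget (CartMono.forget _ P ⋙ leibniz ((intervalCylinder I δ).δ k))) :=
    (CartMono.filling hP).precomp (hδ k).cartMono (Iso.refl _)
  exact (FrobeniusFilling.trivCofGen conn F₀ F₁).pushforwardLifts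

end

end UniformFibrations

namespace UniformFibrations

/-! ### Connections on the simplicial and the cubical interval -/

section SSet

open Simplicial CartesianMonoidalCategory

/-- The operation on the simplicial interval that is induced by a monotone operation. -/
def ssetIntervalMul (op : Fin 2 → Fin 2 → Fin 2)
    (hop : ∀ a a' b b', a ≤ a' → b ≤ b' → op a b ≤ op a' b') :
    (Δ[1] : SSet.{w}) ⊗ Δ[1] ⟶ Δ[1] where
  app _ := TypeCat.ofHom fun x => SSet.stdSimplex.objEquiv.symm (SimplexCategory.Hom.mk
    { toFun i := op ((SSet.stdSimplex.objEquiv x.1).toOrderHom i)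
        ((SSet.stdSimplex.objEquiv x.2).toOrderHom i)
      monotone' _ _ h := hop _ _ _ _ ((SSet.stdSimplex.objEquiv x.1).toOrderHom.monotone h)
        ((SSet.stdSimplex.objEquiv x.2).toOrderHom.monotone h) })
  naturality _ _ _ := rfl

/-- A simplex of the interval is a monotone map to a two-element order, hence determined by its
values. -/
lemma ssetInterval_hom_ext {X : SSet.{w}} {f g : X ⟶ Δ[1]}
    (h : ∀ n (x : X.obj n) i, (SSet.stdSimplex.objEquiv (f.app n x)).toOrderHom i =
      (SSet.stdSimplex.objEquiv (g.app n x)).toOrderHom i) : f = g := by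
  apply NatTrans.ext
  funext n
  refine ConcreteCategory.hom_ext _ _ fun x => ?_
  apply SSet.stdSimplex.objEquiv.injective
  apply SimplexCategory.Hom.ext
  apply OrderHom.ext
  funext i
  exact h n x i

/-- The connections on the simplicial interval. -/
noncomputable def ssetConnections : ssetCylinder.{w}.Connections intervalContractions :=
  intervalConnections
    -- The operation for `k` must absorb the endpoint `k` and be neutral at `1 - k`: minimum for
    -- `0`, maximum for `1`.
    ![ssetIntervalMul (fun a b => a ⊓ b) (by decide), ssetIntervalMul (fun a b => a ⊔ b) (by decide)]
    (fun k => ssetInterval_hom_ext fun _ _ _ => match k with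
      | 0 => (by decide : ∀ a : Fin 2, 0 ⊓ a = 0) _
      | 1 => (by decide : ∀ a : Fin 2, 1 ⊔ a = 1) _)
    (fun k => ssetInterval_hom_ext fun _ _ _ => match k with
      | 0 => (by decide : ∀ a : Fin 2, a ⊓ 0 = 0) _
      | 1 => (by decide : ∀ a : Fin 2, a ⊔ 1 = 1) _)
    (fun k => ssetInterval_hom_ext fun _ _ _ => match k with
      | 0 => (by decide : ∀ a : Fin 2, 1 ⊓ a = a) _
      | 1 => (by decide : ∀ a : Fin 2, 0 ⊔ a = a) _)
    (fun k => ssetInterval_hom_ext fun _ _ _ => match k with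
      | 0 => (by decide : ∀ a : Fin 2, a ⊓ 1 = a) _
      | 1 => (by decide : ∀ a : Fin 2, a ⊔ 0 = a) _)

instance : ssetCylinder.{w}.I.IsLeftAdjoint :=
  inferInstanceAs (tensorLeft (Δ[1] : SSet.{w})).IsLeftAdjoint

theorem pushforwardLifts_sset :
    PushforwardLifts (ssetCylinder.{w}.trivCofGen ssetCofGen.{w}) :=
  have : (intervalCylinder (Δ[1] : SSet.{w})
    fun k => SSet.const (SSet.stdSimplex.obj₀Equiv.symm k)).I.IsLeftAdjoint :=
    inferInstanceAs ssetCylinder.{w}.I.IsLeftAdjoint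
  pushforwardLifts_intervalCylinder.{w} (D := SimplexCategory) Δ[1]
    (fun k => SSet.const (SSet.stdSimplex.obj₀Equiv.symm k)) ssetConnections
    fun d => ⟨d.len, ⟨Iso.refl _⟩⟩

end SSet

/-! ### The cubical interval -/

section CSet

namespace FreeDeMorgan

variable {A : Type} (x y : FreeDeMorgan A)

lemma inf_comm : x ⊓ y = y ⊓ x := by
  obtain ⟨x, rfl⟩ := Quot.exists_rep x
  obtain ⟨y, rfl⟩ := Quot.exists_rep y
  exact Quot.sound (.inf_comm x y)

lemma sup_comm : x ⊔ y = y ⊔ x := by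
  obtain ⟨x, rfl⟩ := Quot.exists_rep x
  obtain ⟨y, rfl⟩ := Quot.exists_rep y
  exact Quot.sound (.sup_comm x y)

lemma inf_sup_self : x ⊓ (x ⊔ y) = x := by
  obtain ⟨x, rfl⟩ := Quot.exists_rep x
  obtain ⟨y, rfl⟩ := Quot.exists_rep y
  exact Quot.sound (.inf_sup_self x y)

lemma sup_inf_self : x ⊔ (x ⊓ y) = x := by
  obtain ⟨x, rfl⟩ := Quot.exists_rep x
  obtain ⟨y, rfl⟩ := Quot.exists_rep y
  exact Quot.sound (.sup_inf_self x y)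

lemma inf_top : x ⊓ ⊤ = x := by
  obtain ⟨x, rfl⟩ := Quot.exists_rep x
  exact Quot.sound (.inf_top x)

lemma sup_bot : x ⊔ ⊥ = x := by
  obtain ⟨x, rfl⟩ := Quot.exists_rep x
  exact Quot.sound (.sup_bot x)

lemma top_inf : ⊤ ⊓ x = x := (inf_comm _ _).trans (inf_top x)

lemma bot_sup : ⊥ ⊔ x = x := (sup_comm _ _).trans (sup_bot x)

/-- A case of absorption, since `⊥ ⊔ x = x`. -/
lemma bot_inf : ⊥ ⊓ x = ⊥ := by
  simpa only [bot_sup] using inf_sup_self ⊥ x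

lemma top_sup : ⊤ ⊔ x = ⊤ := by
  simpa only [top_inf] using sup_inf_self ⊤ x

lemma inf_bot : x ⊓ ⊥ = ⊥ := (inf_comm _ _).trans (bot_inf x)

lemma sup_top : x ⊔ ⊤ = ⊤ := (sup_comm _ _).trans (top_sup x)

end FreeDeMorgan

open CartesianMonoidalCategory

/-- The operation on the cubical interval that is induced by an operation on free de Morgan
algebras that is preserved by substitution. -/
def cubeIntervalMul (op : ∀ n : Box, FreeDeMorgan (Fin n.dim) → FreeDeMorgan (Fin n.dim) →
      FreeDeMorgan (Fin n.dim))
    (hop : ∀ (m n : Box) (f : Fin n.dim → FreeDeMorgan (Fin m.dim)) (x y),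
      FreeDeMorgan.lift f (op n x y) = op m (FreeDeMorgan.lift f x) (FreeDeMorgan.lift f y)) :
    cube.{w} 1 ⊗ cube 1 ⟶ cube 1 where
  app n := TypeCat.ofHom fun x => ULift.up fun i => op n.unop (x.1.down i) (x.2.down i)
  naturality m n f := by
    refine ConcreteCategory.hom_ext _ _ fun x => ?_
    apply ULift.ext
    funext i
    exact (hop n.unop m.unop f.unop (x.1.down i) (x.2.down i)).symm

lemma cubeInterval_hom_ext {X : CSet.{w}} {f g : X ⟶ cube 1}
    (h : ∀ n (x : X.obj n) i, (f.app n x).down i = (g.app n x).down i) : f = g := by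
  apply NatTrans.ext
  funext n
  refine ConcreteCategory.hom_ext _ _ fun x => ?_
  apply ULift.ext
  funext i
  exact h n x i

/-- The connections on the cubical interval. -/
def csetConnections : csetCylinder.{w}.Connections intervalContractions :=
  intervalConnections
    -- Meet and join commute with substitution, so they define natural operations on the interval;
    -- `⊥` and `⊤` are absorbing and neutral for them as in the simplicial case.
    ![cubeIntervalMul (fun _ x y => x ⊓ y) (fun _ _ => FreeDeMorgan.lift_inf),
      cubeIntervalMul (fun _ x y => x ⊔ y) (fun _ _ => FreeDeMorgan.lift_sup)]
    (fun k => cubeInterval_hom_ext fun _ _ _ => match k with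
      | 0 => FreeDeMorgan.bot_inf _
      | 1 => FreeDeMorgan.top_sup _)
    (fun k => cubeInterval_hom_ext fun _ _ _ => match k with
      | 0 => FreeDeMorgan.inf_bot _
      | 1 => FreeDeMorgan.sup_top _)
    (fun k => cubeInterval_hom_ext fun _ _ _ => match k with
      | 0 => FreeDeMorgan.top_inf _
      | 1 => FreeDeMorgan.bot_sup _)
    (fun k => cubeInterval_hom_ext fun _ _ _ => match k with
      | 0 => FreeDeMorgan.inf_top _
      | 1 => FreeDeMorgan.sup_bot _)

theorem pushforwardLifts_cset :
    PushforwardLifts (csetCylinder.{w}.trivCofGen csetCofGen.{w}) :=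
  have : (intervalCylinder (cube.{w} 1)
      ![endpoint (fun _ => ⊥) (fun _ _ _ => rfl),
        endpoint (fun _ => ⊤) (fun _ _ _ => rfl)]).I.IsLeftAdjoint :=
    inferInstanceAs (tensorLeft (cube.{w} 1)).IsLeftAdjoint
  pushforwardLifts_intervalCylinder.{w} (D := Box) (cube 1)
    ![endpoint (fun _ => ⊥) (fun _ _ _ => rfl), endpoint (fun _ => ⊤) (fun _ _ _ => rfl)]
    csetConnections fun d => ⟨d.dim, ⟨Iso.refl _⟩⟩

end CSet

end UniformFibrations

/-! ### The main theorem -/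

theorem mainTheorem4 :
    (∀ (E : Type u) [Category.{v} E] [IsLocallyPresentable.{w} E] [HasFiniteColimits E]
      [UniformFibrations.LocallyCartesianClosed E]
      (cyl : UniformFibrations.FunctorialCylinder E) [cyl.I.IsLeftAdjoint]
      (con : cyl.Contractions) (_ : cyl.Connections con)
      (W : UniformFibrations.AWFS E) (_ : UniformFibrations.AWFS.Suitable.{w} W cyl)
      (J : Type w) [SmallCategory J] (U : J ⥤ Arrow E) (_ : W.IsAlgebraicallyFreeOn U),
      UniformFibrations.PushforwardLifts (cyl.trivCofGen U)) ∧
    UniformFibrations.PushforwardLifts (UniformFibrations.ssetCylinder.{w}.trivCofGen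
      UniformFibrations.ssetCofGen.{w}) ∧
    UniformFibrations.PushforwardLifts (UniformFibrations.csetCylinder.{w}.trivCofGen
      UniformFibrations.csetCofGen.{w}) :=
  ⟨fun _ _ _ _ _ _ _ _ conn W hW _ _ _ hU => W.pushforwardLifts conn hW hU,
    UniformFibrations.pushforwardLifts_sset, UniformFibrations.pushforwardLifts_cset⟩
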